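/- Let $(M^5,g)$ be a connected, complete, smooth five-dimensional Riemannian manifold and let $f:M\to\mathbb R$ be a smooth function such that $$\mathrm{Ric}+\nabla^2 f=\tfrac12\, g ,$$ that is, $(M,g,f)$ is a gradient shrinking Ricci soliton. Suppose that the scalar curvature is constant, $R=\tfrac32$. For $a,s\in\mathbb R$ put $D(a)=\{x\in M: f(x)\le a\}$ and $\Sigma(s)=\{x\in M: f(x)=s\}$. For $x\in M$ let $\lambda_1\le\lambda_2\le\lambda_3\le\lambda_4\le\lambda_5$ be the eigenvalues of the Ricci tensor at $x$, counted with multiplicity, and let $\{e_1,\dots,e_5\}$ be an orthonormal basis of $T_xM$ consisting of corresponding eigenvectors; $K_{12}$ denotes the sectional curvature of the plane spanned by $e_1$ and $e_2$. Then there exist constants $C>0$ and $a>0$ (which may depend on $(M,g,f)$) such that, for every $x\in M\setminus D(a)$, the level set $\Sigma(s)$ with $s=f(x)$ is a smooth hypersurface near $x$ and, for every choice of the orthonormal eigenbasis at $x$, $$|\nabla \mathrm{Ric}|^2\le C(\lambda_1+\lambda_2)+K_{12}+C\,|W^{\Sigma(s)}|^2\qquad\text{at } x,$$ where $W^{\Sigma(s)}$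 is the Weyl tensor of the metric induced by $g$ on $\Sigma(s)$, and $|\cdot|$ denotes tensor norms. -/

import Mathlib

open Bundle
open scoped Manifold ContDiff Topology

noncomputable section

namespace ShrinkerEstimate

/-- The coordinate space `ℝⁿ`. -/
abbrev Coord (n : ℕ) := EuclideanSpace ℝ (Fin n)

/-- The `i`-th coordinate vector of `ℝⁿ`. -/
def coordVec {n : ℕ} (i : Fin n) : Coord n := EuclideanSpace.single i (1 : ℝ)

/-- The partial derivative `∂ᵢ u` at `x`. -/
def pd {n : ℕ} (i : Fin n) (u : Coord n → ℝ) (x : Coord n) : ℝ :=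
  fderiv ℝ u x (coordVec i)

/-! ### Riemannian geometry in local coordinates

Here `g` is the matrix of the metric in local coordinates, `g x i j = g_{ij}(x)`; the inverse
matrix `(g x)⁻¹` has the entries `g^{ij}(x)`. -/

section Local

variable {n : ℕ} (g : Coord n → Matrix (Fin n) (Fin n) ℝ)

/-- The Christoffel symbol `Γᵏᵢⱼ` of the Levi-Civita connection. -/
def christoffel (x : Coord n) (k i j : Fin n) : ℝ :=
  (1 / 2) * ∑ l, (g x)⁻¹ k l *
    (pd i (fun y => g y j l) x + pd j (fun y => g y i l) x - pd l (fun y => g y i j) x)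

/-- The component `Rˡₖᵢⱼ` determined by `R(∂ᵢ, ∂ⱼ) ∂ₖ = Rˡₖᵢⱼ ∂ₗ`, where
`R(X, Y) Z = ∇_X ∇_Y Z - ∇_Y ∇_X Z - ∇_{[X, Y]} Z`. -/
def curvUp (x : Coord n) (l k i j : Fin n) : ℝ :=
  pd i (fun y => christoffel g y l j k) x - pd j (fun y => christoffel g y l i k) x
    + ∑ m, (christoffel g x l i m * christoffel g x m j k
        - christoffel g x l j m * christoffel g x m i k)

/-- The curvature tensor `Rᵢⱼₖₗ = ⟨R(∂ᵢ, ∂ⱼ) ∂ₗ, ∂ₖ⟩`; with this sign `R(X, Y, X, Y)` is positive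
on round spheres. -/
def riem (x : Coord n) (i j k l : Fin n) : ℝ :=
  ∑ m, g x k m * curvUp g x m l i j

/-- The Ricci tensor `Rⱼₗ = gⁱᵏ Rᵢⱼₖₗ`. -/
def ricci (x : Coord n) (j l : Fin n) : ℝ :=
  ∑ i, ∑ k, (g x)⁻¹ i k * riem g x i j k l

/-- The scalar curvature `R = gʲˡ Rⱼₗ`. -/
def scal (x : Coord n) : ℝ :=
  ∑ j, ∑ l, (g x)⁻¹ j l * ricci g x j l

/-- The Hessian `(∇²u)ᵢⱼ = ∂ᵢ∂ⱼu - Γᵏᵢⱼ ∂ₖu`. -/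
def hess (u : Coord n → ℝ) (x : Coord n) (i j : Fin n) : ℝ :=
  pd i (fun y => pd j u y) x - ∑ k, christoffel g x k i j * pd k u x

/-- The covariant derivative of the Ricci tensor, `∇ₖRᵢⱼ`. -/
def covRicci (x : Coord n) (k i j : Fin n) : ℝ :=
  pd k (fun y => ricci g y i j) x
    - ∑ m, (christoffel g x m k i * ricci g x m j + christoffel g x m k j * ricci g x i m)

/-- `|∇Ric|²`, the full tensor norm. -/
def covRicciNormSq (x : Coord n) : ℝ :=
  ∑ k, ∑ i, ∑ j, ∑ c, ∑ a, ∑ b,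
    (g x)⁻¹ k c * (g x)⁻¹ i a * (g x)⁻¹ j b * covRicci g x k i j * covRicci g x c a b

/-- The Weyl tensor (meaningful in dimension `n ≥ 3`):
`Wᵢⱼₖₗ = Rᵢⱼₖₗ - (gᵢₖRⱼₗ - gᵢₗRⱼₖ - gⱼₖRᵢₗ + gⱼₗRᵢₖ)/(n-2) + R(gᵢₖgⱼₗ - gᵢₗgⱼₖ)/((n-1)(n-2))`. -/
def weyl (x : Coord n) (i j k l : Fin n) : ℝ :=
  riem g x i j k l
    - 1 / ((n : ℝ) - 2) *
      (g x i k * ricci g x j l - g x i l * ricci g x j k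
        - g x j k * ricci g x i l + g x j l * ricci g x i k)
    + scal g x / (((n : ℝ) - 1) * ((n : ℝ) - 2)) * (g x i k * g x j l - g x i l * g x j k)

/-- `|W|²`, the full tensor norm. -/
def weylNormSq (x : Coord n) : ℝ :=
  ∑ i, ∑ j, ∑ k, ∑ l, ∑ a, ∑ b, ∑ c, ∑ d,
    (g x)⁻¹ i a * (g x)⁻¹ j b * (g x)⁻¹ k c * (g x)⁻¹ l d
      * weyl g x i j k l * weyl g x a b c d

/-- The inner product of the tangent vectors at `x` with components `v` and `w`. -/
def metricForm (x v w : Coord n) : ℝ :=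
  ∑ i, ∑ j, g x i j * v i * w j

/-- The sectional curvature of the plane spanned by `v` and `w`,
`R(v, w, v, w) / (|v|²|w|² - ⟨v, w⟩²)`. -/
def sectional (x v w : Coord n) : ℝ :=
  (∑ i, ∑ j, ∑ k, ∑ l, riem g x i j k l * v i * w j * v k * w l) /
    (metricForm g x v v * metricForm g x w w - metricForm g x v w ^ 2)

/-- `lam` lists the eigenvalues of the Ricci tensor at `x` in increasing order, with multiplicity,
and `e` is a corresponding orthonormal basis of eigenvectors. -/
structure IsRicciEigenframe (x : Coord n) (lam : Fin n → ℝ) (e : Fin n → Coord n) : Prop where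
  mono : Monotone lam
  orthonormal : ∀ a b, metricForm g x (e a) (e b) = if a = b then 1 else 0
  eigen : ∀ a i, ∑ j, ricci g x i j * e a j = lam a * ∑ j, g x i j * e a j

end Local

/-! ### Five-dimensional gradient shrinking Ricci solitons -/

section Global

variable {M : Type*} [TopologicalSpace M] [ChartedSpace (Coord 5) M]

/-- The matrix of the Riemannian metric pulled back by a map `Φ : ℝⁿ → M`,
`(Φ^* g)_{ab}(u) = ⟨∂_a Φ, ∂_b Φ⟩` at `Φ u`. When `Φ` is the inverse of a chart this is the metric in
the local coordinates; when `Φ` parametrizes a hypersurface it is the induced metric. -/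
def pullbackMetric [RiemannianBundle (fun x : M => TangentSpace (𝓡 5) x)] {n : ℕ}
    (Φ : Coord n → M) (u : Coord n) : Matrix (Fin n) (Fin n) ℝ :=
  Matrix.of fun a b =>
    inner ℝ (mfderiv (𝓡 n) (𝓡 5) Φ u (coordVec a) : TangentSpace (𝓡 5) (Φ u))
      (mfderiv (𝓡 n) (𝓡 5) Φ u (coordVec b) : TangentSpace (𝓡 5) (Φ u))

/-- The metric of `M` in the local coordinates of the chart `φ`. -/
def chartMetric [RiemannianBundle (fun x : M => TangentSpace (𝓡 5) x)]
    (φ : OpenPartialHomeomorph M (Coord 5)) : Coord 5 → Matrix (Fin 5) (Fin 5) ℝ :=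
  pullbackMetric φ.symm

/-- `f` is a smooth function with `Ric + ∇²f = g/2`, an equation that is written out in every chart
of the atlas. -/
def IsShrinkerPotential [RiemannianBundle (fun x : M => TangentSpace (𝓡 5) x)]
    (f : M → ℝ) : Prop :=
  ContMDiff (𝓡 5) 𝓘(ℝ, ℝ) ∞ f ∧
    ∀ φ ∈ atlas (Coord 5) M, ∀ y ∈ φ.target, ∀ i j,
      ricci (chartMetric φ) y i j + hess (chartMetric φ) (f ∘ φ.symm) y i j
        = (1 / 2) * chartMetric φ y i j

variable (M) in
/-- The scalar curvature of `M` is constant, equal to `c`. -/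
def HasConstantScalarCurvature [RiemannianBundle (fun x : M => TangentSpace (𝓡 5) x)]
    (c : ℝ) : Prop :=
  ∀ φ ∈ atlas (Coord 5) M, ∀ y ∈ φ.target, scal (chartMetric φ) y = c

/-- The sublevel set `D(a) = {f ≤ a}`. -/
def sublevelSet (f : M → ℝ) (a : ℝ) : Set M := {x | f x ≤ a}

/-- The level set `Σ(s) = {f = s}`. -/
def levelSet (f : M → ℝ) (s : ℝ) : Set M := {x | f x = s}

/-- `ψ` is, near `u`, a smooth local parametrization (an immersion of an open subset of `ℝ⁴`) of the
hypersurface `S` of `M`, and `ψ u = x`. -/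
structure IsHypersurfaceParam (S : Set M) (x : M) (ψ : Coord 4 → M) (u : Coord 4) : Prop where
  smooth : ContMDiffAt (𝓡 4) (𝓡 5) ∞ ψ u
  immersion : Function.Injective (mfderiv (𝓡 4) (𝓡 5) ψ u)
  mem : ∀ᶠ v in 𝓝 u, ψ v ∈ S
  base : ψ u = x

/-- Local parametrizations of the level sets of a function on `ℝ⁵` around a regular point. -/
theorem exists_localParam {F : Coord 5 → ℝ} {p : Coord 5} (hF : ContDiffAt ℝ ∞ F p)
    (h : fderiv ℝ F p ≠ 0) :
    ∃ γ : Coord 4 → Coord 5, ContDiffAt ℝ ∞ γ 0 ∧ Function.Injective (fderiv ℝ γ 0) ∧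
      (∀ᶠ v in 𝓝 0, F (γ v) = F p) ∧ γ 0 = p := by
  have hs : HasStrictFDerivAt F (fderiv ℝ F p) p := hF.hasStrictFDerivAt (by simp)
  set L := fderiv ℝ F p with hL
  have hr : L.range = ⊤ := by
    refine LinearMap.range_eq_top.2 (LinearMap.surjective (f := L.toLinearMap) ?_)
    intro h0
    exact h (by ext v; simpa using congrArg (fun T : Coord 5 →ₗ[ℝ] ℝ => T v) h0)
  have hk : Module.finrank ℝ L.ker = Module.finrank ℝ (Coord 4) := by
    have h1 := LinearMap.finrank_range_add_finrank_ker L.toLinearMap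
    have h2 : Module.finrank ℝ (LinearMap.range L.toLinearMap) = 1 := by
      have : LinearMap.range L.toLinearMap = ⊤ := hr
      rw [this]; simp
    have h3 : Module.finrank ℝ (LinearMap.ker L.toLinearMap) = 4 := by
      rw [h2] at h1; simp at h1; omega
    simpa using h3
  let A : Coord 4 ≃L[ℝ] L.ker := ContinuousLinearEquiv.ofFinrankEq hk.symm
  let D := HasStrictFDerivAt.implicitFunctionDataOfComplemented F L hs hr
    L.ker_closedComplemented_of_finiteDimensional_range
  let G := hs.implicitFunction F L hr (F p)
  have hG' : HasFDerivAt (G ∘ A) (L.ker.subtypeL.comp (A : Coord 4 →L[ℝ] L.ker)) 0 := by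
    have : HasFDerivAt G L.ker.subtypeL (A 0) := by
      rw [map_zero]; exact (hs.to_implicitFunction hr).hasFDerivAt
    exact this.comp 0 A.hasFDerivAt
  have hD : D.prodFun D.pt = (F p, 0) := by simp [D]
  refine ⟨G ∘ A, ?_, ?_, ?_, ?_⟩
  · have h1 := D.contDiffAt_implicitFunction (n := ∞) (by simpa [D] using hF)
      (by
        have : ContDiff ℝ ∞ D.rightFun := by
          simp only [D, HasStrictFDerivAt.implicitFunctionDataOfComplemented]
          fun_prop
        exact this.contDiffAt) (by simp)
    rw [hD] at h1
    have h2 : ContDiffAt ℝ ∞ (fun v : Coord 4 => (F p, A v)) 0 :=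
      contDiffAt_const.prodMk A.contDiff.contDiffAt
    exact ContDiffAt.comp (0 : Coord 4) (g := D.implicitFunction.uncurry)
      (f := fun v : Coord 4 => (F p, A v)) (by simpa using h1) h2
  · rw [hG'.fderiv]
    exact Subtype.val_injective.comp A.injective
  · have h2 : Filter.Tendsto (fun v : Coord 4 => (F p, A v)) (𝓝 0) (𝓝 (F p, 0)) := by
      have : Continuous (fun v : Coord 4 => (F p, A v)) := by fun_prop
      simpa using this.tendsto 0
    exact h2.eventually (hs.map_implicitFunction_eq hr)
  · simp [G]

/-- A level set of a smooth function admits local parametrizations around its regular points. -/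
theorem exists_isHypersurfaceParam [IsManifold (𝓡 5) ∞ M] {f : M → ℝ} {x : M}
    (hf : ContMDiff (𝓡 5) 𝓘(ℝ, ℝ) ∞ f)
    (h : mfderiv (𝓡 5) 𝓘(ℝ, ℝ) f x ≠ 0) :
    ∃ ψ : Coord 4 → M, IsHypersurfaceParam (levelSet f (f x)) x ψ 0 := by
  have : IsManifold (𝓡 5) 1 M := IsManifold.of_le (n := ∞) (by simp)
  let φ := chartAt (Coord 5) x
  have hx : x ∈ φ.source := mem_chart_source _ x
  have hy : φ x ∈ φ.target := φ.map_source hx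
  have hφs : ContMDiffAt (𝓡 5) (𝓡 5) ∞ φ.symm (φ x) :=
    (contMDiffOn_chart_symm (I := 𝓡 5) (n := ∞) (x := x)).contMDiffAt (φ.open_target.mem_nhds hy)
  have hsx : φ.symm (φ x) = x := φ.left_inv hx
  have hF : ContMDiffAt (𝓡 5) 𝓘(ℝ, ℝ) ∞ (f ∘ φ.symm) (φ x) :=
    (hf.contMDiffAt).comp (φ x) hφs
  have hd : MDifferentiableAt (𝓡 5) (𝓡 5) φ.symm (φ x) := hφs.mdifferentiableAt (by simp)
  have hφ := mdifferentiable_chart (I := 𝓡 5) x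
  have hne : fderiv ℝ (f ∘ φ.symm) (φ x) ≠ 0 := by
    intro h0
    rw [← mfderiv_eq_fderiv] at h0
    have hcomp : mfderiv (𝓡 5) 𝓘(ℝ, ℝ) f x
        = (mfderiv (𝓡 5) 𝓘(ℝ, ℝ) (f ∘ φ.symm) (φ x)).comp (mfderiv (𝓡 5) (𝓡 5) φ x) := by
      rw [← mfderiv_comp x (hF.mdifferentiableAt (by simp)) (hφ.mdifferentiableAt hx)]
      refine Filter.EventuallyEq.mfderiv_eq ?_
      filter_upwards [φ.open_source.mem_nhds hx] with z hz
      simp [φ.left_inv hz]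
    apply h
    rw [hcomp, h0]
    exact ContinuousLinearMap.zero_comp _
  obtain ⟨γ, h1, h2, h3, h4⟩ := exists_localParam hF.contDiffAt hne
  have hγ : ContMDiffAt (𝓡 4) (𝓡 5) ∞ γ 0 := h1.contMDiffAt
  have hdγ : MDifferentiableAt (𝓡 4) (𝓡 5) γ 0 := hγ.mdifferentiableAt (by simp)
  refine ⟨φ.symm ∘ γ, ?_, ?_, ?_, ?_⟩
  · exact ContMDiffAt.comp (0 : Coord 4) (by rw [h4]; exact hφs) hγ
  · rw [mfderiv_comp (0 : Coord 4) (by rw [h4]; exact hd) hdγ]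
    refine Function.Injective.comp (g := mfderiv (𝓡 5) (𝓡 5) φ.symm (γ 0)) ?_ ?_
    · rw [h4]; exact hφ.symm.mfderiv_injective hy
    · rw [mfderiv_eq_fderiv]; exact h2
  · filter_upwards [h3] with v hv
    simpa [levelSet, hsx] using hv
  · simp [h4, hsx]

end Global

end ShrinkerEstimate

end

open ShrinkerEstimate

/-! Constancy of R makes a shrinker rigid. The contracted Bianchi identity together with the Codazzi
form of the soliton equation gives div Ric = 0 and Ric(∇f) = 0, hence |Ric|² = R/2 = 3/4 and |∇f|² =
f + const. As |Ric|² is constant, the Bochner formula for Ric degenerates to an algebraic identity,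
|∇Ric|² = 2 Σ Kᵢⱼ lᵢ lⱼ - 3/4 (`IsLocalShrinker.norm_covEnd_sq`), and the estimate becomes algebra
at a point.

Outside a sublevel set |∇f| ≥ 1. One eigenvalue vanishes, in the direction ν = ∇f/|∇f|, and all are
nonnegative, so λ₁ = 0. Let l₀ ≤ lᵢ be the eigenvalues on the level set and d = l₀ = λ₁ + λ₂. The
plane of e₁, e₂ contains ν, so K₁₂ = k₀, where kᵢ is the sectional curvature of ν and the i-th
tangential eigenvector (`IsLocalShrinker.exists_adaptedFrame`). With xᵢ = lᵢ - 1/2 for i ≥ 1 the two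
trace conditions read Σ xᵢ = -d and Σ xᵢ² = d - d²: the other eigenvalues are within √d of 1/2.

The Gauss equation expresses Kᵢⱼ by the Weyl and Ricci tensors of the level set. In dimension four
the Weyl part has two independent sectional components, and each meets a factor of size √d. The
Ricci part is lᵢ - kᵢ + |∇f|⁻² lᵢ(1/2 - lᵢ). At l = (0, 1/2, 1/2, 1/2) the normal curvatures enter
as -(k₁ + k₂ + k₃), which is k₀ because Ric(ν, ν) = 0; this is why K₁₂ has coefficient exactly one.
The remaining errors are O(d + |W|²) or products xᵢ (∇_ν Ric)(eᵢ, eᵢ), bounded by √(d |∇Ric|²) and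
absorbed by the left-hand side (`estimate_of_terms`, `frame_estimate`). -/

noncomputable section

namespace ShrinkerEstimate

set_option synthInstance.maxHeartbeats 400000

/-! ### Structures on spaces of continuous linear maps. -/

section Shortcuts

variable {E F : Type*} [NormedAddCommGroup E] [NormedSpace ℝ E]
  [NormedAddCommGroup F] [NormedSpace ℝ F]

instance instNormedAddCommGroupCLM : NormedAddCommGroup (E →L[ℝ] F) :=
  ContinuousLinearMap.toNormedAddCommGroup

instance instSeminormedAddCommGroupCLM : SeminormedAddCommGroup (E →L[ℝ] F) :=
  ContinuousLinearMap.toSeminormedAddCommGroup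

instance instAddCommGroupCLM : AddCommGroup (E →L[ℝ] F) := ContinuousLinearMap.addCommGroup

instance instAddCommMonoidCLM : AddCommMonoid (E →L[ℝ] F) := ContinuousLinearMap.addCommMonoid

instance instModuleCLM : Module ℝ (E →L[ℝ] F) := ContinuousLinearMap.module

instance instTopologicalSpaceCLM : TopologicalSpace (E →L[ℝ] F) :=
  ContinuousLinearMap.topologicalSpace

instance instNormedSpaceCLM : NormedSpace ℝ (E →L[ℝ] F) := ContinuousLinearMap.toNormedSpace

end Shortcuts

/-! ### Derivatives of operator-valued functions. -/

section Calculus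

variable {E F G : Type*} [NormedAddCommGroup E] [NormedSpace ℝ E]
  [NormedAddCommGroup F] [NormedSpace ℝ F] [NormedAddCommGroup G] [NormedSpace ℝ G]

theorem differentiableAt_of_smooth {T : E → F} {y : E} (h : ContDiffAt ℝ ∞ T y) :
    DifferentiableAt ℝ T y :=
  h.differentiableAt (by simp)

theorem smooth_fderiv {T : E → F} {y : E} (h : ContDiffAt ℝ ∞ T y) :
    ContDiffAt ℝ ∞ (fderiv ℝ T) y :=
  h.fderiv_right (by simp)

theorem smooth_fderiv_apply {T : E → F} {y : E} (h : ContDiffAt ℝ ∞ T y) (v : E) :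
    ContDiffAt ℝ ∞ (fun z => fderiv ℝ T z v) y :=
  (smooth_fderiv h).clm_apply contDiffAt_const

theorem fderiv_apply_const {T : E → F →L[ℝ] G} {y : E} (h : DifferentiableAt ℝ T y) (v : F) (u : E) :
    fderiv ℝ (fun z => T z v) y u = fderiv ℝ T y u v := by
  rw [fderiv_clm_apply h (differentiableAt_const v)]
  simp

theorem fderiv_apply_map {T : E → F →L[ℝ] G} {V : E → F} {y : E} (h : DifferentiableAt ℝ T y)
    (hV : DifferentiableAt ℝ V y) (u : E) :
    fderiv ℝ (fun z => T z (V z)) y u = fderiv ℝ T y u (V y) + T y (fderiv ℝ V y u) := by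
  rw [fderiv_clm_apply h hV]
  simp [add_comm]

theorem fderiv_end_mul {S T : E → F →L[ℝ] F} {y : E} (hS : DifferentiableAt ℝ S y)
    (hT : DifferentiableAt ℝ T y) (u : E) :
    fderiv ℝ (fun z => S z * T z) y u = fderiv ℝ S y u * T y + S y * fderiv ℝ T y u := by
  rw [fderiv_fun_mul' hS hT]
  simp [add_comm]

/-- Only C² is required, because immersed hypersurfaces are treated below with finite
differentiability. -/
theorem fderiv_fderiv_comm_of_two {T : E → F} {y : E} (h : ContDiffAt ℝ 2 T y) (u v : E) :
    fderiv ℝ (fun z => fderiv ℝ T z v) y u = fderiv ℝ (fun z => fderiv ℝ T z u) y v := by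
  have hd : DifferentiableAt ℝ (fderiv ℝ T) y :=
    (h.fderiv_right (m := 1) (by rw [one_add_one_eq_two])).differentiableAt (by simp)
  rw [fderiv_apply_const hd, fderiv_apply_const hd]
  exact (h.isSymmSndFDerivAt (by simp)) u v

theorem fderiv_fderiv_comm {T : E → F} {y : E} (h : ContDiffAt ℝ ∞ T y) (u v : E) :
    fderiv ℝ (fun z => fderiv ℝ T z v) y u = fderiv ℝ (fun z => fderiv ℝ T z u) y v :=
  fderiv_fderiv_comm_of_two (h.of_le (WithTop.coe_le_coe.2 le_top)) u v

theorem fderiv_eq_of_eqOn {S T : E → F} {U : Set E} (hU : IsOpen U) (h : ∀ z ∈ U, S z = T z)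
    {y : E} (hy : y ∈ U) : fderiv ℝ S y = fderiv ℝ T y :=
  Filter.EventuallyEq.fderiv_eq (by filter_upwards [hU.mem_nhds hy] with z hz using h z hz)

end Calculus

/-! ### Traces, orthonormal frames, and the curvature of a connection on an open set of a vector
space. -/

section Connection

variable {E : Type*} [NormedAddCommGroup E] [NormedSpace ℝ E]

section Trace

variable [FiniteDimensional ℝ E]

/-- The trace of an endomorphism of a finite-dimensional space. -/
def coordTrace (L : E → E) : ℝ :=
  ∑ i, (Module.finBasis ℝ E).coord i (L (Module.finBasis ℝ E i))

/-- `coordTrace` takes bare functions, so that maps such as u ↦ R(u, v)w can be traced without being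
bundled. This is the bridge to the basis-free trace. -/
theorem coordTrace_eq_trace {L : E → E} (hL : IsLinearMap ℝ L) :
    coordTrace L = LinearMap.trace ℝ E (hL.mk' L) := by
  rw [LinearMap.trace_eq_matrix_trace ℝ (Module.finBasis ℝ E)]
  simp [coordTrace, Matrix.trace, LinearMap.toMatrix_apply]

theorem coordTrace_add (L K : E → E) :
    coordTrace (fun v => L v + K v) = coordTrace L + coordTrace K := by
  simp [coordTrace, Finset.sum_add_distrib]

theorem coordTrace_sub (L K : E → E) :
    coordTrace (fun v => L v - K v) = coordTrace L - coordTrace K := by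
  simp [coordTrace, Finset.sum_sub_distrib]

theorem coordTrace_comp_comm {L K : E → E} (hL : IsLinearMap ℝ L)
    (hK : IsLinearMap ℝ K) : coordTrace (fun v => L (K v)) = coordTrace (fun v => K (L v)) := by
  have := LinearMap.trace_mul_comm ℝ (hL.mk' L) (hK.mk' K)
  have e1 : IsLinearMap ℝ (fun v => L (K v)) := ((hL.mk' L) ∘ₗ (hK.mk' K)).isLinear
  have e2 : IsLinearMap ℝ (fun v => K (L v)) := ((hK.mk' K) ∘ₗ (hL.mk' L)).isLinear
  rw [coordTrace_eq_trace e1, coordTrace_eq_trace e2]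
  exact this

theorem fderiv_coordTrace {T : E → E → E} {y : E}
    (h : ∀ v, DifferentiableAt ℝ (fun z => T z v) y) (u : E) :
    fderiv ℝ (fun z => coordTrace (T z)) y u
      = coordTrace (fun v => fderiv ℝ (fun z => T z v) y u) := by
  unfold coordTrace
  set e := Module.finBasis ℝ E
  have hc : ∀ i, HasFDerivAt (fun z => e.coord i (T z (e i)))
      ((LinearMap.toContinuousLinearMap (e.coord i)).comp (fderiv ℝ (fun z => T z (e i)) y)) y :=
    fun i => (LinearMap.toContinuousLinearMap (e.coord i)).hasFDerivAt.comp y (h _).hasFDerivAt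
  rw [(HasFDerivAt.fun_sum fun i _ => hc i).fderiv]
  simp

/-- `b` is an orthonormal basis for the inner product `q`. -/
structure IsOrthoFrame {ι : Type*} [Fintype ι] [DecidableEq ι] (q : E →L[ℝ] E →L[ℝ] ℝ)
    (b : ι → E) : Prop where
  card : Fintype.card ι = Module.finrank ℝ E
  apply : ∀ i j, q (b i) (b j) = if i = j then 1 else 0

namespace IsOrthoFrame

variable {ι : Type*} [Fintype ι] [DecidableEq ι] {q : E →L[ℝ] E →L[ℝ] ℝ} {b : ι → E}

omit [FiniteDimensional ℝ E] in
theorem linearIndependent (h : IsOrthoFrame q b) : LinearIndependent ℝ b := by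
  rw [Fintype.linearIndependent_iff]
  intro c hc j
  have := congrArg (fun v => q v (b j)) hc
  simpa [h.apply] using this

/-- The basis given by an orthonormal frame. -/
def basis (h : IsOrthoFrame q b) : Module.Basis ι ℝ E :=
  basisOfLinearIndependentOfCardEqFinrank' b h.linearIndependent h.card

theorem basis_apply (h : IsOrthoFrame q b) (i : ι) : h.basis i = b i := by
  simp [basis]

theorem repr_eq (h : IsOrthoFrame q b) (v : E) (i : ι) : h.basis.repr v i = q v (b i) := by
  have := congrArg (fun w => q w (b i)) (h.basis.sum_repr v)
  simpa [h.basis_apply, h.apply] using this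

theorem expand (h : IsOrthoFrame q b) (v : E) : v = ∑ i, q v (b i) • b i := by
  conv_lhs => rw [← h.basis.sum_repr v]
  simp [h.repr_eq, h.basis_apply]

theorem trace_eq (h : IsOrthoFrame q b) {L : E → E} (hL : IsLinearMap ℝ L) :
    coordTrace L = ∑ i, q (L (b i)) (b i) := by
  rw [coordTrace_eq_trace hL, LinearMap.trace_eq_matrix_trace ℝ h.basis]
  simp [Matrix.trace, LinearMap.toMatrix_apply, h.repr_eq, h.basis_apply]

theorem ext (h : IsOrthoFrame q b) {v w : E} (hvw : ∀ z, q v z = q w z) : v = w := by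
  rw [h.expand v, h.expand w]; simp [hvw]

theorem inner_eq_sum (h : IsOrthoFrame q b) (v w : E) :
    q v w = ∑ i, q v (b i) * q (b i) w := by
  conv_lhs => rw [h.expand v]
  simp

end IsOrthoFrame

end Trace

/-- `Γ` is the connection of the Riemannian metric `g` on the open set `U`, under minimal regularity
assumptions. -/
structure IsMetricConnection (U : Set E) (g : E → E →L[ℝ] E →L[ℝ] ℝ)
    (Γ : E → E →L[ℝ] E →L[ℝ] E) : Prop where
  isOpen : IsOpen U
  differentiable_metric : ∀ y ∈ U, DifferentiableAt ℝ g y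
  differentiable_connection : ∀ y ∈ U, DifferentiableAt ℝ Γ y
  symm : ∀ y ∈ U, ∀ v w, g y v w = g y w v
  pos : ∀ y ∈ U, ∀ v, v ≠ 0 → 0 < g y v v
  torsionFree : ∀ y ∈ U, ∀ v w, Γ y v w = Γ y w v
  compat : ∀ y ∈ U, ∀ u v w, fderiv ℝ g y u v w = g y (Γ y u v) w + g y v (Γ y u w)

/-- `Γ` is the Levi-Civita connection of the smooth Riemannian metric `g` on the open set `U`. -/
structure IsLeviCivita (U : Set E) (g : E → E →L[ℝ] E →L[ℝ] ℝ)
    (Γ : E → E →L[ℝ] E →L[ℝ] E) : Prop extends IsMetricConnection U g Γ where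
  smooth_metric : ∀ y ∈ U, ContDiffAt ℝ ∞ g y
  smooth_connection : ∀ y ∈ U, ContDiffAt ℝ ∞ Γ y

variable (Γ : E → E →L[ℝ] E →L[ℝ] E)

/-- The curvature operator `R(u, v)` of the connection `Γ`. -/
def curvOp (y u v : E) : E →L[ℝ] E :=
  fderiv ℝ Γ y u v - fderiv ℝ Γ y v u + (Γ y u * Γ y v - Γ y v * Γ y u)

/-- The covariant derivative of a field of endomorphisms. -/
def covEnd (T : E → E →L[ℝ] E) (y u : E) : E →L[ℝ] E :=
  fderiv ℝ T y u + (Γ y u * T y - T y * Γ y u)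

/-- The second covariant derivative of a field of endomorphisms. -/
def covEnd₂ (T : E → E →L[ℝ] E) (y u v : E) : E →L[ℝ] E :=
  covEnd Γ (fun z => covEnd Γ T z v) y u - covEnd Γ T y (Γ y u v)

/-- The covariant derivative of the curvature operator. -/
def covCurv (y m u v : E) : E →L[ℝ] E :=
  covEnd Γ (fun z => curvOp Γ z u v) y m - curvOp Γ y (Γ y m u) v - curvOp Γ y u (Γ y m v)

/-- The covariant derivative of a vector field, as an endomorphism. -/
def covVec (V : E → E) (y : E) : E →L[ℝ] E :=
  fderiv ℝ V y + (Γ y).flip (V y)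

variable {Γ}

theorem covVec_apply (V : E → E) (y v : E) :
    covVec Γ V y v = fderiv ℝ V y v + Γ y v (V y) := by
  simp [covVec]

theorem curvOp_add_left (y u u' v : E) :
    curvOp Γ y (u + u') v = curvOp Γ y u v + curvOp Γ y u' v := by
  simp only [curvOp, map_add, add_mul, mul_add, add_apply]; abel

theorem curvOp_smul_left (y : E) (c : ℝ) (u v : E) :
    curvOp Γ y (c • u) v = c • curvOp Γ y u v := by
  simp only [curvOp, map_smul, smul_apply, smul_sub, smul_add,
    smul_mul_assoc, mul_smul_comm]

theorem curvOp_swap (y u v : E) : curvOp Γ y u v = -curvOp Γ y v u := by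
  simp only [curvOp]; abel

theorem curvOp_add_right (y u v v' : E) :
    curvOp Γ y u (v + v') = curvOp Γ y u v + curvOp Γ y u v' := by
  rw [curvOp_swap, curvOp_add_left, curvOp_swap y v u, curvOp_swap y v' u]; abel

theorem curvOp_smul_right (y : E) (c : ℝ) (u v : E) :
    curvOp Γ y u (c • v) = c • curvOp Γ y u v := by
  rw [curvOp_swap, curvOp_smul_left, curvOp_swap y v u]; simp

theorem covEnd_add (T : E → E →L[ℝ] E) (y u v : E) :
    covEnd Γ T y (u + v) = covEnd Γ T y u + covEnd Γ T y v := by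
  simp only [covEnd, map_add, add_mul, mul_add]; abel

theorem covEnd_smul (T : E → E →L[ℝ] E) (y : E) (c : ℝ) (u : E) :
    covEnd Γ T y (c • u) = c • covEnd Γ T y u := by
  rw [covEnd, covEnd, map_smul, map_smul, smul_mul_assoc, mul_smul_comm, smul_add, smul_sub]

theorem isLinearMap_curvOp_left (y v w : E) : IsLinearMap ℝ fun u => curvOp Γ y u v w where
  map_add u u' := by simp [curvOp_add_left]
  map_smul c u := by simp [curvOp_smul_left]

theorem isLinearMap_covEnd (T : E → E →L[ℝ] E) (y w : E) :
    IsLinearMap ℝ fun u => covEnd Γ T y u w where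
  map_add u u' := by simp [covEnd_add]
  map_smul c u := by simp [covEnd_smul]

theorem smooth_curvOp {y : E} (h : ContDiffAt ℝ ∞ Γ y) (u v : E) :
    ContDiffAt ℝ ∞ (fun z => curvOp Γ z u v) y := by
  have h1 : ∀ w, ContDiffAt ℝ ∞ (fun z => Γ z w) y := fun w => h.clm_apply contDiffAt_const
  have h2 : ∀ w w', ContDiffAt ℝ ∞ (fun z => fderiv ℝ Γ z w w') y :=
    fun w w' => (smooth_fderiv_apply h w).clm_apply contDiffAt_const
  unfold curvOp
  exact ((h2 u v).sub (h2 v u)).add (((h1 u).clm_comp (h1 v)).sub ((h1 v).clm_comp (h1 u)))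

theorem smooth_covEnd {y : E} (h : ContDiffAt ℝ ∞ Γ y)
    {T : E → E →L[ℝ] E} (hT : ContDiffAt ℝ ∞ T y) (u : E) :
    ContDiffAt ℝ ∞ (fun z => covEnd Γ T z u) y := by
  have h1 : ∀ w, ContDiffAt ℝ ∞ (fun z => Γ z w) y := fun w => h.clm_apply contDiffAt_const
  unfold covEnd
  exact (smooth_fderiv_apply hT u).add (((h1 u).clm_comp hT).sub (hT.clm_comp (h1 u)))

theorem smooth_covVec {y : E} (h : ContDiffAt ℝ ∞ Γ y)
    {V : E → E} (hV : ContDiffAt ℝ ∞ V y) : ContDiffAt ℝ ∞ (covVec Γ V) y := by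
  have h1 : ContDiffAt ℝ ∞ (fun z => (Γ z).flip) y :=
    (ContinuousLinearMap.flipₗᵢ ℝ (E) (E) (E)).contDiff.contDiffAt.comp y h
  exact (smooth_fderiv hV).add (h1.clm_apply hV)

/-- The Ricci identity for endomorphisms. -/
theorem covEnd₂_comm {y : E} (h : ContDiffAt ℝ ∞ Γ y) (ht : ∀ v w, Γ y v w = Γ y w v)
    {T : E → E →L[ℝ] E} (hT : ContDiffAt ℝ ∞ T y) (u v : E) :
    covEnd₂ Γ T y u v - covEnd₂ Γ T y v u = curvOp Γ y u v * T y - T y * curvOp Γ y u v := by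
  have h1 : ∀ w, DifferentiableAt ℝ (fun z => Γ z w) y :=
    fun w => differentiableAt_of_smooth (h.clm_apply contDiffAt_const)
  have hT1 := differentiableAt_of_smooth hT
  -- The product rule with constant v. The only second-order term in T is symmetric in u and v and
  -- drops out of the commutator.
  have key : ∀ u v, fderiv ℝ (fun z => covEnd Γ T z v) y u
      = fderiv ℝ (fun z => fderiv ℝ T z v) y u
        + (fderiv ℝ Γ y u v * T y + Γ y v * fderiv ℝ T y u
          - (fderiv ℝ T y u * Γ y v + T y * fderiv ℝ Γ y u v)) := by
    intro u v
    have e1 : DifferentiableAt ℝ (fun z => Γ z v * T z) y := (h1 v).fun_mul hT1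
    have e2 : DifferentiableAt ℝ (fun z => T z * Γ z v) y := hT1.fun_mul (h1 v)
    have e3 := differentiableAt_of_smooth (smooth_fderiv_apply hT v)
    unfold covEnd
    rw [fderiv_fun_add e3 (e1.fun_sub e2), fderiv_fun_sub e1 e2]
    simp only [add_apply, sub_apply]
    rw [fderiv_end_mul (h1 v) hT1, fderiv_end_mul hT1 (h1 v),
      fderiv_apply_const (differentiableAt_of_smooth h)]
  unfold covEnd₂
  -- Absence of torsion makes the correction along Γ(u, v) symmetric, so it cancels too.
  rw [ht v u]
  have key2 : ∀ u v, covEnd Γ (fun z => covEnd Γ T z v) y u = _ := fun u v =>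
    congrArg (· + (Γ y u * covEnd Γ T y v - covEnd Γ T y v * Γ y u)) (key u v)
  rw [key2, key2, fderiv_fderiv_comm hT v u]
  simp only [covEnd, curvOp]
  simp only [mul_add, add_mul, mul_sub, sub_mul, mul_assoc]
  abel

/-- The curvature measures the failure of second covariant derivatives of a vector field to
commute. -/
theorem covEnd_covVec_comm {y : E} (h : ContDiffAt ℝ ∞ Γ y) (ht : ∀ v w, Γ y v w = Γ y w v)
    {V : E → E} (hV : ContDiffAt ℝ ∞ V y) (u v : E) :
    covEnd Γ (covVec Γ V) y u v - covEnd Γ (covVec Γ V) y v u = curvOp Γ y u v (V y) := by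
  have h1 : ∀ w, DifferentiableAt ℝ (fun z => Γ z w) y :=
    fun w => differentiableAt_of_smooth (h.clm_apply contDiffAt_const)
  have hV1 := differentiableAt_of_smooth hV
  have key : ∀ u v, fderiv ℝ (covVec Γ V) y u v = fderiv ℝ (fun z => fderiv ℝ V z v) y u
      + (fderiv ℝ Γ y u v (V y) + Γ y v (fderiv ℝ V y u)) := by
    intro u v
    rw [← fderiv_apply_const (differentiableAt_of_smooth (smooth_covVec h hV))]
    simp only [covVec_apply]
    rw [fderiv_fun_add (differentiableAt_of_smooth (smooth_fderiv_apply hV v))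
      ((h1 v).clm_apply hV1)]
    simp only [add_apply]
    rw [fderiv_apply_map (h1 v) hV1, fderiv_apply_const (differentiableAt_of_smooth h)]
  simp only [covEnd, add_apply, sub_apply,
    mul_apply_eq_comp, key, covVec_apply, curvOp, ht v u, fderiv_fderiv_comm hV v u,
    map_add]
  abel

/-- The second Bianchi identity. -/
theorem covCurv_cyclic {y : E} (h : ContDiffAt ℝ ∞ Γ y) (ht : ∀ v w, Γ y v w = Γ y w v)
    (m u v : E) : covCurv Γ y m u v + covCurv Γ y u v m + covCurv Γ y v m u = 0 := by
  have h1 : ∀ w, DifferentiableAt ℝ (fun z => Γ z w) y :=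
    fun w => differentiableAt_of_smooth (h.clm_apply contDiffAt_const)
  have h2 := differentiableAt_of_smooth (smooth_fderiv h)
  have h3 : ∀ w w', DifferentiableAt ℝ (fun z => fderiv ℝ Γ z w w') y := fun w w' =>
    differentiableAt_of_smooth ((smooth_fderiv_apply h w).clm_apply contDiffAt_const)
  have key : ∀ m u v, fderiv ℝ (fun z => curvOp Γ z u v) y m
      = fderiv ℝ (fun z => fderiv ℝ Γ z u) y m v - fderiv ℝ (fun z => fderiv ℝ Γ z v) y m u
        + (fderiv ℝ Γ y m u * Γ y v + Γ y u * fderiv ℝ Γ y m v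
          - (fderiv ℝ Γ y m v * Γ y u + Γ y v * fderiv ℝ Γ y m u)) := by
    intro m u v
    have e1 : DifferentiableAt ℝ (fun z => Γ z u * Γ z v) y := (h1 u).fun_mul (h1 v)
    have e2 : DifferentiableAt ℝ (fun z => Γ z v * Γ z u) y := (h1 v).fun_mul (h1 u)
    have e3 : ∀ u, DifferentiableAt ℝ (fun z => fderiv ℝ Γ z u) y :=
      fun u => differentiableAt_of_smooth (smooth_fderiv_apply h u)
    unfold curvOp
    rw [fderiv_fun_add ((h3 u v).fun_sub (h3 v u)) (e1.fun_sub e2), fderiv_fun_sub e1 e2,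
      fderiv_fun_sub (h3 u v) (h3 v u)]
    simp only [add_apply, sub_apply]
    rw [fderiv_end_mul (h1 u) (h1 v), fderiv_end_mul (h1 v) (h1 u),
      fderiv_apply_const (e3 u), fderiv_apply_const (e3 v)]
    simp only [fderiv_apply_const (differentiableAt_of_smooth h)]
  unfold covCurv
  -- By symmetry of Γ and antisymmetry of R the corrections R(Γ(m, u), v) cancel in pairs around the
  -- cycle. What is left is the symmetry of second derivatives of Γ and the Jacobi identity for
  -- commutators.
  simp only [ht u m, ht v m, ht v u]
  rw [curvOp_swap y u (Γ y m v), curvOp_swap y (Γ y u v) m,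
    curvOp_swap y v (Γ y m u)]
  rw [covEnd, covEnd, covEnd, key, key, key]
  simp only [fderiv_fderiv_comm h u m, fderiv_fderiv_comm h v m,
    fderiv_fderiv_comm h v u, curvOp]
  simp only [mul_add, add_mul, mul_sub, sub_mul, mul_assoc]
  abel

/-- The first Bianchi identity. -/
theorem curvOp_cyclic {U : Set (E)} (hU : IsOpen U) (h : ∀ y ∈ U, ContDiffAt ℝ ∞ Γ y)
    (ht : ∀ y ∈ U, ∀ v w, Γ y v w = Γ y w v) {y : E} (hy : y ∈ U) (u v w : E) :
    curvOp Γ y u v w + curvOp Γ y v w u + curvOp Γ y w u v = 0 := by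
  have hd := differentiableAt_of_smooth (h y hy)
  -- Absence of torsion holds on an open set, so it may be differentiated.
  have key : ∀ u v w, fderiv ℝ Γ y u v w = fderiv ℝ Γ y u w v := by
    intro u v w
    have e : ∀ v w, fderiv ℝ (fun z => Γ z v w) y u = fderiv ℝ Γ y u v w := by
      intro v w
      rw [fderiv_apply_const (hd.clm_apply (differentiableAt_const v)), fderiv_apply_const hd]
    rw [← e v w, ← e w v, fderiv_eq_of_eqOn hU (fun z hz => ht z hz v w) hy]
  simp only [curvOp, add_apply, sub_apply,
    mul_apply_eq_comp, ht y hy w v, ht y hy w u, ht y hy v u, key u w v, key v w u,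
    key w v u]
  abel

end Connection

/-! ### Symmetries of the curvature of a metric connection and of its covariant derivative. -/

section LeviCivita

variable {E : Type*} [NormedAddCommGroup E] [NormedSpace ℝ E]

omit [NormedAddCommGroup E] [NormedSpace ℝ E] in
/-- A tensor with the symmetries of a curvature operator is symmetric under exchange of pairs. -/
theorem pair_symm_of_cyclic {Q : E → E → E → E → ℝ} (h1 : ∀ u v w z, Q u v w z = -Q v u w z)
    (h2 : ∀ u v w z, Q u v w z = -Q u v z w)
    (h3 : ∀ u v w z, Q u v w z + Q v w u z + Q w u v z = 0) (u v w z : E) :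
    Q u v w z = Q z w v u := by
  -- The octahedron argument: four cyclic sums, reduced by the two antisymmetries.
  linarith [h3 u v w z, h3 v w z u, h3 w z u v, h3 z u v w, h1 u v w z, h2 u v w z, h1 v w u z,
    h2 v w u z, h1 w u v z, h2 w u v z, h1 v w z u, h2 v w z u, h1 w z v u, h2 w z v u,
    h1 z v w u, h2 z v w u, h1 w z u v, h2 w z u v, h1 z u w v, h2 z u w v, h1 u w z v,
    h2 u w z v, h1 z u v w, h2 z u v w, h1 u v z w, h2 u v z w, h1 v z u w, h2 v z u w]

variable {U : Set E} {g : E → E →L[ℝ] E →L[ℝ] ℝ} {Γ : E → E →L[ℝ] E →L[ℝ] E}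

theorem fderiv_apply₂_const {F : Type*} [NormedAddCommGroup F] [NormedSpace ℝ F]
    {T : F → E →L[ℝ] E →L[ℝ] ℝ} {X Y : F → E} {y : F} (hT : DifferentiableAt ℝ T y)
    (hX : DifferentiableAt ℝ X y) (hY : DifferentiableAt ℝ Y y) (u : F) :
    fderiv ℝ (fun z => T z (X z) (Y z)) y u
      = fderiv ℝ T y u (X y) (Y y) + T y (fderiv ℝ X y u) (Y y)
        + T y (X y) (fderiv ℝ Y y u) := by
  rw [fderiv_apply_map (hT.clm_apply hX) hY, fderiv_apply_map hT hX]
  simp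

namespace IsMetricConnection

/-- The connection is compatible with the metric. -/
theorem fderiv_metric (h : IsMetricConnection U g Γ) {y : E} (hy : y ∈ U) {X Y : E → E}
    (hX : DifferentiableAt ℝ X y) (hY : DifferentiableAt ℝ Y y) (u : E) :
    fderiv ℝ (fun z => g z (X z) (Y z)) y u
      = g y (fderiv ℝ X y u + Γ y u (X y)) (Y y) + g y (X y) (fderiv ℝ Y y u + Γ y u (Y y)) := by
  rw [fderiv_apply₂_const (h.differentiable_metric y hy) hX hY,
    h.compat y hy]
  simp only [map_add, add_apply]
  ring

theorem exists_orthoFrame [FiniteDimensional ℝ E] (h : IsMetricConnection U g Γ) {y : E} (hy : y ∈ U) :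
    ∃ b : Fin (Module.finrank ℝ E) → E, IsOrthoFrame (g y) b := by
  let B : LinearMap.BilinForm ℝ E := LinearMap.mk₂ ℝ (fun v w => g y v w) (by simp) (by simp)
    (by simp) (by simp)
  have hB : ∀ v w, B v w = g y v w := fun v w => rfl
  have hBs : LinearMap.IsSymm B := ⟨fun v w => by simpa [hB] using h.symm y hy v w⟩
  obtain ⟨b, hb⟩ := LinearMap.BilinForm.exists_orthogonal_basis hBs
  have hpos : ∀ i, 0 < g y (b i) (b i) := fun i => h.pos y hy _ (b.ne_zero i)
  refine ⟨fun i => (Real.sqrt (g y (b i) (b i)))⁻¹ • b i, by simp, fun i j => ?_⟩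
  by_cases hij : i = j
  · subst hij
    have := Real.mul_self_sqrt (hpos i).le
    have h0 := (Real.sqrt_pos.2 (hpos i)).ne'
    simp only [map_smul, smul_apply, smul_eq_mul, if_true]
    field_simp
    rw [sq, this]
  · have : g y (b i) (b j) = 0 := by
      have := hb hij
      simpa [Function.onFun, hB] using this
    simp [this, hij]

end IsMetricConnection

namespace IsLeviCivita

theorem connection_apply (h : IsLeviCivita U g Γ) {y : E} (hy : y ∈ U) (v : E) :
    ContDiffAt ℝ ∞ (fun z => Γ z v) y :=
  (h.smooth_connection y hy).clm_apply contDiffAt_const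

/-- For constant w and z the second derivatives of the function g(w, z) commute. Expanded by metric
compatibility, their commutator is g(R w, z) + g(w, R z). -/
theorem curvOp_skew (h : IsLeviCivita U g Γ) {y : E} (hy : y ∈ U) (u v w z : E) :
    g y (curvOp Γ y u v w) z = -g y (curvOp Γ y u v z) w := by
  have hg := h.smooth_metric y hy
  have hΓ := differentiableAt_of_smooth (h.smooth_connection y hy)
  have hq : ContDiffAt ℝ ∞ (fun x => g x w z) y :=
    (hg.clm_apply contDiffAt_const).clm_apply contDiffAt_const
  have hd : ∀ u a, DifferentiableAt ℝ (fun x => Γ x u a) y := fun u a =>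
    differentiableAt_of_smooth ((h.connection_apply hy u).clm_apply contDiffAt_const)
  have key : ∀ u v, fderiv ℝ (fun x => fderiv ℝ (fun x => g x w z) x v) y u
      = g y (fderiv ℝ Γ y u v w + Γ y u (Γ y v w)) z + g y (Γ y v w) (Γ y u z)
        + (g y (Γ y u w) (Γ y v z) + g y w (fderiv ℝ Γ y u v z + Γ y u (Γ y v z))) := by
    intro u v
    have e : ∀ x ∈ U, fderiv ℝ (fun x => g x w z) x v = g x (Γ x v w) z + g x w (Γ x v z) := by
      intro x hx
      rw [h.fderiv_metric hx (differentiableAt_const w) (differentiableAt_const z)]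
      simp
    have e2 : ∀ a, fderiv ℝ (fun x => Γ x v a) y u = fderiv ℝ Γ y u v a := by
      intro a
      rw [fderiv_apply_const (differentiableAt_of_smooth (h.connection_apply hy v)),
        fderiv_apply_const hΓ]
    have hg' := differentiableAt_of_smooth hg
    rw [fderiv_eq_of_eqOn h.isOpen e hy, fderiv_fun_add
      ((hg'.clm_apply (hd v w)).clm_apply (differentiableAt_const z))
      ((hg'.clm_apply (differentiableAt_const w)).clm_apply (hd v z)), add_apply,
      h.fderiv_metric hy (hd v w) (differentiableAt_const z),
      h.fderiv_metric hy (differentiableAt_const w) (hd v z)]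
    simp [e2]
  have := fderiv_fderiv_comm hq u v
  rw [key, key] at this
  rw [h.symm y hy (curvOp Γ y u v z) w]
  simp only [curvOp, add_apply, sub_apply, mul_apply_eq_comp, map_add, map_sub] at this ⊢
  linarith [h.symm y hy (Γ y v w) (Γ y u z)]

theorem curvOp_pair_symm (h : IsLeviCivita U g Γ) {y : E} (hy : y ∈ U) (u v w z : E) :
    g y (curvOp Γ y u v w) z = g y (curvOp Γ y z w v) u := by
  refine pair_symm_of_cyclic (Q := fun u v w z => g y (curvOp Γ y u v w) z) ?_ ?_ ?_ u v w z
  · intro u v w z; simp only [curvOp_swap y u v]; simp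
  · exact fun u v w z => h.curvOp_skew hy u v w z
  · intro u v w z
    have := congrArg (fun t => g y t z)
      (curvOp_cyclic h.isOpen h.smooth_connection h.torsionFree hy u v w)
    simpa using this

/-- Covariant differentiation preserves (skew-)symmetric endomorphisms. -/
theorem covEnd_adjoint (h : IsLeviCivita U g Γ) {T : E → E →L[ℝ] E} {y : E} (hy : y ∈ U)
    (hT : ContDiffAt ℝ ∞ T y) (c : ℝ) {v w : E}
    (hs : ∀ z ∈ U, ∀ v w, g z (T z v) w = c * g z (T z w) v) (u : E) :
    g y (covEnd Γ T y u v) w = c * g y (covEnd Γ T y u w) v := by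
  have hT1 := differentiableAt_of_smooth hT
  have key : ∀ v w, fderiv ℝ (fun z => g z (T z v) w) y u
      = g y (covEnd Γ T y u v) w + g y (T y (Γ y u v)) w + g y (T y v) (Γ y u w) := by
    intro v w
    rw [h.fderiv_metric hy (hT1.clm_apply (differentiableAt_const v)) (differentiableAt_const w),
      fderiv_apply_const hT1]
    simp [covEnd]
    ring
  have e := fderiv_eq_of_eqOn h.isOpen (fun z hz => hs z hz v w) hy
  have hd : DifferentiableAt ℝ (fun z => g z (T z w) v) y :=
    ((differentiableAt_of_smooth (h.smooth_metric y hy)).clm_apply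
      (hT1.clm_apply (differentiableAt_const w))).clm_apply (differentiableAt_const v)
  have e' := congrArg (fun L => L u) e
  simp only [fderiv_const_mul hd, smul_apply, smul_eq_mul, key] at e'
  rw [hs y hy (Γ y u v) w, hs y hy v (Γ y u w)] at e'
  linarith

theorem covCurv_swap (h : IsLeviCivita U g Γ) {y : E} (hy : y ∈ U) (m u v : E) :
    covCurv Γ y m u v = -covCurv Γ y m v u := by
  have hd := differentiableAt_of_smooth (smooth_curvOp (h.smooth_connection y hy) v u)
  have e : (fun z => curvOp Γ z u v) = fun z => -curvOp Γ z v u := by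
    funext z; exact curvOp_swap z u v
  unfold covCurv covEnd
  rw [e, fderiv_fun_neg, curvOp_swap y (Γ y m u) v, curvOp_swap y u (Γ y m v)]
  simp only [neg_apply, mul_neg, neg_mul]
  abel

theorem covCurv_add_left (h : IsLeviCivita U g Γ) {y : E} (hy : y ∈ U) (m u u' v : E) :
    covCurv Γ y m (u + u') v = covCurv Γ y m u v + covCurv Γ y m u' v := by
  have hd := fun u => differentiableAt_of_smooth (smooth_curvOp (h.smooth_connection y hy) u v)
  unfold covCurv covEnd
  simp only [curvOp_add_left, map_add]
  rw [fderiv_fun_add (hd u) (hd u')]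
  simp only [add_apply, mul_add, add_mul]
  abel

theorem covCurv_smul_left (h : IsLeviCivita U g Γ) {y : E} (hy : y ∈ U) (m : E) (c : ℝ)
    (u v : E) : covCurv Γ y m (c • u) v = c • covCurv Γ y m u v := by
  have hd := fun u => differentiableAt_of_smooth (smooth_curvOp (h.smooth_connection y hy) u v)
  unfold covCurv covEnd
  simp only [curvOp_smul_left, map_smul]
  rw [fderiv_fun_const_smul (hd u)]
  simp only [smul_apply, mul_smul_comm, smul_mul_assoc, smul_sub, smul_add]

theorem isLinearMap_covCurv (h : IsLeviCivita U g Γ) {y : E} (hy : y ∈ U) (m v w : E) :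
    IsLinearMap ℝ fun u => covCurv Γ y m u v w where
  map_add u u' := by simp [h.covCurv_add_left hy]
  map_smul c u := by simp [h.covCurv_smul_left hy]

theorem isLinearMap_covCurv_left (y u v w : E) : IsLinearMap ℝ fun m => covCurv Γ y m u v w where
  map_add m m' := by
    simp only [covCurv, covEnd_add, map_add, add_apply, curvOp_add_left, curvOp_add_right,
      sub_apply]
    abel
  map_smul c m := by
    simp only [covCurv, covEnd_smul, map_smul, smul_apply, curvOp_smul_left, curvOp_smul_right,
      sub_apply, smul_sub]

theorem covCurv_skew (h : IsLeviCivita U g Γ) {y : E} (hy : y ∈ U) (m u v w z : E) :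
    g y (covCurv Γ y m u v w) z = -g y (covCurv Γ y m u v z) w := by
  have := h.covEnd_adjoint hy (smooth_curvOp (h.smooth_connection y hy) u v) (-1) (v := w) (w := z)
    (fun x hx a b => by rw [h.curvOp_skew hx]; ring) m
  simp only [covCurv, sub_apply, map_sub]
  rw [this, h.curvOp_skew hy (Γ y m u) v w z, h.curvOp_skew hy u (Γ y m v) w z]
  ring

/-- The first Bianchi identity is differentiated in the direction m; each group of connection terms
that appears is again a cyclic sum and vanishes. -/
theorem covCurv_cyclic_args (h : IsLeviCivita U g Γ) {y : E} (hy : y ∈ U) (m u v w : E) :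
    covCurv Γ y m u v w + covCurv Γ y m v w u + covCurv Γ y m w u v = 0 := by
  have hΓ := h.smooth_connection y hy
  have hd : ∀ u v, DifferentiableAt ℝ (fun z => curvOp Γ z u v) y :=
    fun u v => differentiableAt_of_smooth (smooth_curvOp hΓ u v)
  have hd' : ∀ u v w, DifferentiableAt ℝ (fun z => curvOp Γ z u v w) y :=
    fun u v w => (hd u v).clm_apply (differentiableAt_const w)
  have e := fderiv_eq_of_eqOn h.isOpen (fun z hz =>
    curvOp_cyclic h.isOpen h.smooth_connection h.torsionFree hz u v w) hy
  have e' := congrArg (fun L => L m) e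
  simp only [fderiv_fun_add ((hd' u v w).fun_add (hd' v w u)) (hd' w u v),
    fderiv_fun_add (hd' u v w) (hd' v w u), add_apply, fderiv_apply_const (hd _ _),
    fderiv_fun_const, Pi.zero_apply, zero_apply] at e'
  have c := fun a b c => curvOp_cyclic h.isOpen h.smooth_connection h.torsionFree hy a b c
  have c0 : Γ y m (curvOp Γ y u v w) + Γ y m (curvOp Γ y v w u) + Γ y m (curvOp Γ y w u v) = 0 := by
    rw [← map_add, ← map_add, c, map_zero]
  have c1 := c (Γ y m u) v w
  have c2 := c u (Γ y m v) w
  have c3 := c u v (Γ y m w)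
  simp only [covCurv, covEnd, add_apply, sub_apply, mul_apply_eq_comp]
  linear_combination (norm := module) e' + c0 - c1 - c2 - c3

theorem covCurv_pair_symm (h : IsLeviCivita U g Γ) {y : E} (hy : y ∈ U) (m u v w z : E) :
    g y (covCurv Γ y m u v w) z = g y (covCurv Γ y m z w v) u := by
  refine pair_symm_of_cyclic (Q := fun u v w z => g y (covCurv Γ y m u v w) z) ?_ ?_ ?_ u v w z
  · intro u v w z; simp only [h.covCurv_swap hy m u v]; simp
  · exact fun u v w z => h.covCurv_skew hy m u v w z
  · intro u v w z
    have := congrArg (fun t => g y t z) (h.covCurv_cyclic_args hy m u v w)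
    simpa using this

end IsLeviCivita

end LeviCivita

/-! ### Consequences of the soliton equation with constant scalar curvature. -/

section Soliton

variable {E : Type*} [NormedAddCommGroup E] [NormedSpace ℝ E] [FiniteDimensional ℝ E]
  {U : Set E} {g : E → E →L[ℝ] E →L[ℝ] ℝ} {Γ : E → E →L[ℝ] E →L[ℝ] E} {f : E → ℝ} {V : E → E}

/-- The Ricci endomorphism `1/2 - ∇V` of a gradient shrinking soliton. -/
def ricEnd (Γ : E → E →L[ℝ] E →L[ℝ] E) (V : E → E) (y : E) : E →L[ℝ] E :=
  (1 / 2 : ℝ) • ContinuousLinearMap.id ℝ E - covVec Γ V y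

/-- A gradient shrinking soliton structure with potential `f`, gradient field `V = ∇f` and constant
scalar curvature `c` on an open subset of a vector space. -/
structure IsLocalShrinker (U : Set E) (g : E → E →L[ℝ] E →L[ℝ] ℝ)
    (Γ : E → E →L[ℝ] E →L[ℝ] E) (f : E → ℝ) (V : E → E) (c : ℝ) : Prop extends
    IsLeviCivita U g Γ where
  smooth_potential : ∀ y ∈ U, ContDiffAt ℝ ∞ f y
  smooth_gradient : ∀ y ∈ U, ContDiffAt ℝ ∞ V y
  gradient : ∀ y ∈ U, ∀ v, g y (V y) v = fderiv ℝ f y v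
  -- This is the soliton equation: the traced curvature is the form of 1/2 - ∇V.
  ricci_eq : ∀ y ∈ U, ∀ v w, coordTrace (fun u => curvOp Γ y u v w) = g y (ricEnd Γ V y v) w
  scal_eq : ∀ y ∈ U, coordTrace (fun v => ricEnd Γ V y v) = c

theorem coordTrace_clm_comm (L K : E →L[ℝ] E) :
    coordTrace (fun v => L (K v)) = coordTrace (fun v => K (L v)) :=
  coordTrace_comp_comm L.toLinearMap.isLinear K.toLinearMap.isLinear

theorem coordTrace_congr {L K : E → E} (h : ∀ v, L v = K v) : coordTrace L = coordTrace K :=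
  congrArg _ (funext h)

theorem coordTrace_neg (L : E → E) : coordTrace (fun v => -L v) = -coordTrace L := by
  simp [coordTrace]

theorem coordTrace_smul (c : ℝ) (L : E → E) : coordTrace (fun v => c • L v) = c * coordTrace L := by
  simp [coordTrace, Finset.mul_sum]

/-- The trace commutes with covariant differentiation. -/
theorem coordTrace_covEnd {T : E → E →L[ℝ] E} {y : E} (hT : DifferentiableAt ℝ T y) (u : E) :
    coordTrace (fun v => covEnd Γ T y u v) = fderiv ℝ (fun z => coordTrace (fun v => T z v)) y u := by
  rw [fderiv_coordTrace (fun v => hT.clm_apply (differentiableAt_const v))]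
  have e := coordTrace_clm_comm (Γ y u) (T y)
  simp only [covEnd, add_apply, sub_apply, mul_apply_eq_comp, coordTrace_add, coordTrace_sub, e,
    fderiv_apply_const hT]
  ring

theorem IsOrthoFrame.trace_comp_eq {ι : Type*} [Fintype ι] [DecidableEq ι]
    {q : E →L[ℝ] E →L[ℝ] ℝ} {b : ι → E} (hb : IsOrthoFrame q b) (L K : E →L[ℝ] E) :
    coordTrace (fun v => L (K v)) = ∑ i, q (L (K (b i))) (b i) :=
  hb.trace_eq (L := fun v => L (K v)) (L.comp K).toLinearMap.isLinear

theorem IsOrthoFrame.trace_clm_eq {ι : Type*} [Fintype ι] [DecidableEq ι]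
    {q : E →L[ℝ] E →L[ℝ] ℝ} {b : ι → E} (hb : IsOrthoFrame q b) (L : E →L[ℝ] E) :
    coordTrace (fun v => L v) = ∑ i, q (L (b i)) (b i) :=
  hb.trace_eq (L := fun v => L v) L.toLinearMap.isLinear

omit [FiniteDimensional ℝ E] in
theorem covEnd_apply (T : E → E →L[ℝ] E) (y u v : E) :
    covEnd Γ T y u v = fderiv ℝ T y u v + (Γ y u (T y v) - T y (Γ y u v)) := by
  simp [covEnd]

omit [FiniteDimensional ℝ E] in
theorem covEnd_mul {S T : E → E →L[ℝ] E} {y : E} (hS : DifferentiableAt ℝ S y)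
    (hT : DifferentiableAt ℝ T y) (u : E) :
    covEnd Γ (fun z => S z * T z) y u = covEnd Γ S y u * T y + S y * covEnd Γ T y u := by
  rw [covEnd, fderiv_end_mul hS hT, covEnd, covEnd]
  simp only [mul_add, add_mul, mul_sub, sub_mul, mul_assoc]
  abel

omit [FiniteDimensional ℝ E] in
theorem covEnd_fun_add {S T : E → E →L[ℝ] E} {y : E} (hS : DifferentiableAt ℝ S y)
    (hT : DifferentiableAt ℝ T y) (u : E) :
    covEnd Γ (fun z => S z + T z) y u = covEnd Γ S y u + covEnd Γ T y u := by
  rw [covEnd, fderiv_fun_add hS hT, covEnd, covEnd]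
  simp only [add_apply, mul_add, add_mul]
  abel

omit [FiniteDimensional ℝ E] in
theorem covEnd_fun_smul {T : E → E →L[ℝ] E} {y : E} (hT : DifferentiableAt ℝ T y) (c : ℝ) (u : E) :
    covEnd Γ (fun z => c • T z) y u = c • covEnd Γ T y u := by
  rw [covEnd, fderiv_fun_const_smul hT, covEnd]
  simp only [smul_apply, mul_smul_comm, smul_mul_assoc, smul_sub, smul_add]

omit [FiniteDimensional ℝ E] in
theorem isLinearMap_covEnd₂ {T : E → E →L[ℝ] E} {y : E} (hΓ : ContDiffAt ℝ ∞ Γ y)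
    (hT : ContDiffAt ℝ ∞ T y) (m w : E) : IsLinearMap ℝ fun u => covEnd₂ Γ T y m u w where
  map_add u v := by
    have hd := fun u => differentiableAt_of_smooth (smooth_covEnd hΓ hT u)
    simp only [covEnd₂, covEnd_add, map_add, covEnd_fun_add (hd u) (hd v), sub_apply, add_apply]
    abel
  map_smul c u := by
    have hd := fun u => differentiableAt_of_smooth (smooth_covEnd hΓ hT u)
    simp only [covEnd₂, covEnd_smul, map_smul, covEnd_fun_smul (hd u), sub_apply, smul_apply,
      smul_sub]

namespace IsLocalShrinker

variable {c : ℝ}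

theorem smooth_ricEnd (h : IsLocalShrinker U g Γ f V c) {y : E} (hy : y ∈ U) :
    ContDiffAt ℝ ∞ (ricEnd Γ V) y :=
  contDiffAt_const.sub (smooth_covVec (h.smooth_connection y hy) (h.smooth_gradient y hy))

omit [FiniteDimensional ℝ E] in
theorem covVec_eq (V : E → E) (y v : E) : covVec Γ V y v = (1 / 2 : ℝ) • v - ricEnd Γ V y v := by
  simp [ricEnd]

/-- Symmetry is read off the curvature side of the soliton equation, where it is the pair symmetry
of R. -/
theorem ricEnd_symm (h : IsLocalShrinker U g Γ f V c) {y : E} (hy : y ∈ U) (v w : E) :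
    g y (ricEnd Γ V y v) w = g y (ricEnd Γ V y w) v := by
  obtain ⟨b, hb⟩ := h.exists_orthoFrame hy
  rw [← h.ricci_eq y hy, ← h.ricci_eq y hy, hb.trace_eq (isLinearMap_curvOp_left y v w),
    hb.trace_eq (isLinearMap_curvOp_left y w v)]
  refine Finset.sum_congr rfl fun i _ => ?_
  rw [h.curvOp_pair_symm hy]

/-- The identity is parallel, so ∇Ric = -∇∇V, and second covariant derivatives of V commute up to
curvature. -/
theorem codazzi (h : IsLocalShrinker U g Γ f V c) {y : E} (hy : y ∈ U) (u v : E) :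
    covEnd Γ (ricEnd Γ V) y u v - covEnd Γ (ricEnd Γ V) y v u = curvOp Γ y v u (V y) := by
  have e : ∀ u, covEnd Γ (ricEnd Γ V) y u = -covEnd Γ (covVec Γ V) y u := by
    intro u
    have hd := differentiableAt_of_smooth
      (smooth_covVec (h.smooth_connection y hy) (h.smooth_gradient y hy))
    have : fderiv ℝ (ricEnd Γ V) y u = -fderiv ℝ (covVec Γ V) y u := by
      have : ricEnd Γ V = fun z => (1 / 2 : ℝ) • ContinuousLinearMap.id ℝ E - covVec Γ V z := rfl
      rw [this, fderiv_const_sub]; rfl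
    rw [covEnd, covEnd, this]
    ext w
    simp [ricEnd]
    abel
  rw [e, e, ← covEnd_covVec_comm (h.smooth_connection y hy) (h.torsionFree y hy)
    (h.smooth_gradient y hy)]
  simp only [neg_apply]
  abel

theorem covEnd_ricEnd_symm (h : IsLocalShrinker U g Γ f V c) {y : E} (hy : y ∈ U) (u v w : E) :
    g y (covEnd Γ (ricEnd Γ V) y u v) w = g y (covEnd Γ (ricEnd Γ V) y u w) v := by
  have := h.covEnd_adjoint hy (h.smooth_ricEnd hy) 1 (v := v) (w := w)
    (fun z hz v w => by rw [one_mul, h.ricEnd_symm hz]) u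
  simpa using this

theorem covEnd₂_ricEnd_symm (h : IsLocalShrinker U g Γ f V c) {y : E} (hy : y ∈ U)
    (m u v w : E) :
    g y (covEnd₂ Γ (ricEnd Γ V) y m u v) w = g y (covEnd₂ Γ (ricEnd Γ V) y m u w) v := by
  have := h.covEnd_adjoint hy (smooth_covEnd (h.smooth_connection y hy) (h.smooth_ricEnd hy) u) 1
    (v := v) (w := w) (fun z hz v w => by rw [one_mul, h.covEnd_ricEnd_symm hz]) m
  rw [covEnd₂, sub_apply, sub_apply, map_sub, map_sub, sub_apply, sub_apply, this,
    h.covEnd_ricEnd_symm hy, one_mul]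

theorem coordTrace_covEnd_ricEnd (h : IsLocalShrinker U g Γ f V c) {y : E} (hy : y ∈ U) (u : E) :
    coordTrace (fun v => covEnd Γ (ricEnd Γ V) y u v) = 0 := by
  rw [coordTrace_covEnd (differentiableAt_of_smooth (h.smooth_ricEnd hy)),
    fderiv_eq_of_eqOn h.isOpen h.scal_eq hy]
  simp

/-- The derivative of Ric = tr R. The term Γ(m, R(u, ·)·) and the term R(Γ(m, u), ·)· have the same
trace in u and cancel. -/
theorem coordTrace_covCurv (h : IsLocalShrinker U g Γ f V c) {y : E} (hy : y ∈ U) (m v w : E) :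
    coordTrace (fun u => covCurv Γ y m u v w) = g y (covEnd Γ (ricEnd Γ V) y m v) w := by
  have hd : ∀ u v, DifferentiableAt ℝ (fun z => curvOp Γ z u v) y :=
    fun u v => differentiableAt_of_smooth (smooth_curvOp (h.smooth_connection y hy) u v)
  have hP := differentiableAt_of_smooth (h.smooth_ricEnd hy)
  have e := congrArg (fun L => L m) (fderiv_eq_of_eqOn h.isOpen (fun z hz => h.ricci_eq z hz v w) hy)
  rw [fderiv_coordTrace (fun u => (hd u v).clm_apply (differentiableAt_const w)),
    h.fderiv_metric hy (hP.clm_apply (differentiableAt_const v)) (differentiableAt_const w),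
    fderiv_apply_const hP] at e
  have e1 : ∀ u, fderiv ℝ (fun z => curvOp Γ z u v w) y m = covCurv Γ y m u v w
      + curvOp Γ y (Γ y m u) v w + curvOp Γ y u (Γ y m v) w
      - Γ y m (curvOp Γ y u v w) + curvOp Γ y u v (Γ y m w) := by
    intro u
    rw [fderiv_apply_const (hd u v)]
    simp only [covCurv, covEnd, add_apply, sub_apply, mul_apply_eq_comp]
    abel
  have e2 := coordTrace_comp_comm (Γ y m).toLinearMap.isLinear (isLinearMap_curvOp_left (Γ := Γ) y v w)
  simp only [ContinuousLinearMap.coe_coe] at e2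
  simp only [e1, coordTrace_add, coordTrace_sub, e2, h.ricci_eq y hy] at e
  simp only [covEnd, add_apply, sub_apply, mul_apply_eq_comp, map_add, map_sub, fderiv_fun_const,
    Pi.zero_apply, zero_apply, zero_add] at e ⊢
  linarith

/-- The contracted second Bianchi identity. -/
theorem coordTrace_covCurv_left (h : IsLocalShrinker U g Γ f V c) {y : E} (hy : y ∈ U)
    (v w z : E) : coordTrace (fun u => covCurv Γ y u v w z)
      = g y (covEnd Γ (ricEnd Γ V) y v w) z - g y (covEnd Γ (ricEnd Γ V) y w v) z := by
  have e : ∀ u, covCurv Γ y u v w z = covCurv Γ y v u w z - covCurv Γ y w u v z := by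
    intro u
    have := congrArg (fun L => L z)
      (covCurv_cyclic (h.smooth_connection y hy) (h.torsionFree y hy) u v w)
    rw [h.covCurv_swap hy v w u] at this
    simp only [add_apply, neg_apply, zero_apply] at this
    linear_combination (norm := module) this
  rw [coordTrace_congr e, coordTrace_sub, h.coordTrace_covCurv hy, h.coordTrace_covCurv hy]

/-- The double trace of ∇R, evaluated in the two orders of summation, gives 2 div Ric = dR, and R is
constant. -/
theorem divergence_ricEnd (h : IsLocalShrinker U g Γ f V c) {y : E} (hy : y ∈ U) (v : E) :
    coordTrace (fun u => covEnd Γ (ricEnd Γ V) y u v) = 0 := by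
  obtain ⟨b, hb⟩ := h.exists_orthoFrame hy
  set D := covEnd Γ (ricEnd Γ V) y
  have e0 : coordTrace (fun u => D u v) = ∑ k, g y (D (b k) (b k)) v := by
    rw [hb.trace_eq (isLinearMap_covEnd _ y v)]
    exact Finset.sum_congr rfl fun k _ => h.covEnd_ricEnd_symm hy _ _ _
  have e1 : ∀ j, ∑ k, g y (covCurv Γ y (b k) v (b j) (b j)) (b k)
      = g y (D v (b j)) (b j) - g y (D (b j) v) (b j) := by
    intro j
    rw [← h.coordTrace_covCurv_left hy,
      hb.trace_eq (IsLeviCivita.isLinearMap_covCurv_left y v (b j) (b j))]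
  have e2 : ∀ k, ∑ j, g y (covCurv Γ y (b k) v (b j) (b j)) (b k) = g y (D (b k) (b k)) v := by
    intro k
    rw [← h.coordTrace_covCurv hy, hb.trace_eq (h.isLinearMap_covCurv hy (b k) (b k) v)]
    refine Finset.sum_congr rfl fun j _ => ?_
    rw [h.covCurv_pair_symm hy, h.covCurv_skew hy, h.covCurv_swap hy (b k) (b k) (b j)]
    simp
  have e3 : ∑ j, g y (D v (b j)) (b j) = 0 := by
    rw [← hb.trace_clm_eq (D v)]
    exact h.coordTrace_covEnd_ricEnd hy v
  have e4 : ∑ j, g y (D (b j) v) (b j) = coordTrace (fun u => D u v) := by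
    rw [hb.trace_eq (isLinearMap_covEnd _ y v)]
  have e5 := Finset.sum_comm (s := Finset.univ) (t := Finset.univ)
    (f := fun j k => g y (covCurv Γ y (b k) v (b j) (b j)) (b k))
  simp only [e1, e2, Finset.sum_sub_distrib, e3, e4, ← e0] at e5
  linarith

/-- The gradient of the potential is in the kernel of the Ricci tensor. -/
theorem ricEnd_gradient (h : IsLocalShrinker U g Γ f V c) {y : E} (hy : y ∈ U) :
    ricEnd Γ V y (V y) = 0 := by
  obtain ⟨b, hb⟩ := h.exists_orthoFrame hy
  refine hb.ext fun v => ?_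
  -- Tracing Codazzi over u expresses Ric(V, v) as the trace of ∇_v Ric minus div Ric, and both
  -- vanish.
  have e : ∀ u, curvOp Γ y u v (V y)
      = covEnd Γ (ricEnd Γ V) y v u - covEnd Γ (ricEnd Γ V) y u v := fun u =>
    (h.codazzi hy v u).symm
  rw [h.ricEnd_symm hy, ← h.ricci_eq y hy, coordTrace_congr e, coordTrace_sub,
    h.coordTrace_covEnd_ricEnd hy, h.divergence_ricEnd hy]
  simp

/-- The derivative of Ric(V) = 0. -/
theorem covEnd_ricEnd_gradient (h : IsLocalShrinker U g Γ f V c) {y : E} (hy : y ∈ U) (u : E) :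
    covEnd Γ (ricEnd Γ V) y u (V y) = -ricEnd Γ V y (covVec Γ V y u) := by
  have hP := differentiableAt_of_smooth (h.smooth_ricEnd hy)
  have hV := differentiableAt_of_smooth (h.smooth_gradient y hy)
  have e := congrArg (fun L => L u) (fderiv_eq_of_eqOn h.isOpen (fun z hz => h.ricEnd_gradient hz) hy)
  simp only [fderiv_apply_map hP hV, fderiv_fun_const, Pi.zero_apply, zero_apply] at e
  simp only [covEnd, covVec_apply, add_apply, sub_apply, mul_apply_eq_comp, h.ricEnd_gradient hy,
    map_zero, map_add]
  linear_combination (norm := module) e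

/-- By the previous identity (∇_u Ric)V = -Ric(u)/2 + Ric²(u). Its trace in u is (div Ric)(V) = 0,
whence |Ric|² = R/2. -/
theorem coordTrace_ricEnd_sq (h : IsLocalShrinker U g Γ f V c) {y : E} (hy : y ∈ U) :
    coordTrace (fun v => ricEnd Γ V y (ricEnd Γ V y v)) = c / 2 := by
  have e2 := h.divergence_ricEnd hy (V y)
  rw [coordTrace_congr (fun u => h.covEnd_ricEnd_gradient hy u), coordTrace_neg] at e2
  simp only [covVec_eq, map_sub, map_smul, coordTrace_sub, coordTrace_smul, h.scal_eq y hy] at e2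
  linarith

/-- Since ∇V = 1/2 - Ric and Ric(V) = 0, the derivative of |V|² along u is 2 g(∇_u V, V) = g(u, V) =
df(u). -/
theorem fderiv_gradient_sq (h : IsLocalShrinker U g Γ f V c) {y : E} (hy : y ∈ U) :
    fderiv ℝ (fun z => g z (V z) (V z) - f z) y = 0 := by
  have hV := differentiableAt_of_smooth (h.smooth_gradient y hy)
  have hg := differentiableAt_of_smooth (h.smooth_metric y hy)
  ext u
  rw [fderiv_fun_sub ((hg.clm_apply hV).clm_apply hV)
    (differentiableAt_of_smooth (h.smooth_potential y hy)), sub_apply, h.fderiv_metric hy hV hV,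
    ← covVec_apply, h.symm y hy (V y), ← h.gradient y hy, covVec_eq]
  have := h.ricEnd_symm hy u (V y)
  rw [h.ricEnd_gradient hy] at this
  simp only [map_sub, map_smul, sub_apply, smul_apply, smul_eq_mul, this, h.symm y hy u (V y),
    map_zero, zero_apply]
  ring

theorem trace_ricEnd_covEnd (h : IsLocalShrinker U g Γ f V c) {y : E} (hy : y ∈ U) (u : E) :
    coordTrace (fun v => ricEnd Γ V y (covEnd Γ (ricEnd Γ V) y u v)) = 0 := by
  have hP := differentiableAt_of_smooth (h.smooth_ricEnd hy)
  have e := coordTrace_covEnd (Γ := Γ) (T := fun z => ricEnd Γ V z * ricEnd Γ V z) (hP.fun_mul hP) u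
  simp only [covEnd_mul hP hP, mul_apply_eq_comp, add_apply] at e
  rw [fderiv_eq_of_eqOn h.isOpen (T := fun _ => c / 2) (fun z hz => h.coordTrace_ricEnd_sq hz) hy] at e
  have e2 := coordTrace_clm_comm (ricEnd Γ V y) (covEnd Γ (ricEnd Γ V) y u)
  simp only [coordTrace_add, ← e2, fderiv_fun_const, Pi.zero_apply,
    zero_apply] at e
  linarith

/-- One more derivative of tr(Ric ∘ ∇_v Ric) = 0: it trades a product of first derivatives for a
second derivative of Ric. -/
theorem trace_covEnd_sq (h : IsLocalShrinker U g Γ f V c) {y : E} (hy : y ∈ U) (u v : E) :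
    coordTrace (fun w => covEnd Γ (ricEnd Γ V) y u (covEnd Γ (ricEnd Γ V) y v w))
      = -coordTrace (fun w => ricEnd Γ V y (covEnd₂ Γ (ricEnd Γ V) y u v w)) := by
  have hP := differentiableAt_of_smooth (h.smooth_ricEnd hy)
  have hD := differentiableAt_of_smooth
    (smooth_covEnd (h.smooth_connection y hy) (h.smooth_ricEnd hy) v)
  have e := coordTrace_covEnd (Γ := Γ)
    (T := fun z => ricEnd Γ V z * covEnd Γ (ricEnd Γ V) z v) (hP.fun_mul hD) u
  simp only [covEnd_mul hP hD, mul_apply_eq_comp, add_apply] at e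
  rw [fderiv_eq_of_eqOn h.isOpen (T := fun _ => (0 : ℝ))
    (fun z hz => h.trace_ricEnd_covEnd hz v) hy] at e
  have e3 : covEnd Γ (fun z => covEnd Γ (ricEnd Γ V) z v) y u
      = covEnd₂ Γ (ricEnd Γ V) y u v + covEnd Γ (ricEnd Γ V) y (Γ y u v) := by
    simp [covEnd₂]
  simp only [e3, add_apply, map_add, coordTrace_add, fderiv_fun_const,
    Pi.zero_apply, zero_apply, h.trace_ricEnd_covEnd hy] at e
  linarith

/-- The covariant derivative of the Codazzi equation; the term with ∇V is linear in Ric and will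
contribute to the reaction term. -/
theorem codazzi_covEnd₂ (h : IsLocalShrinker U g Γ f V c) {y : E} (hy : y ∈ U) (m u v : E) :
    covEnd₂ Γ (ricEnd Γ V) y m u v - covEnd₂ Γ (ricEnd Γ V) y m v u
      = covCurv Γ y m v u (V y) + curvOp Γ y v u (covVec Γ V y m) := by
  have hΓ := h.smooth_connection y hy
  have hV := differentiableAt_of_smooth (h.smooth_gradient y hy)
  have hD : ∀ v, DifferentiableAt ℝ (fun z => covEnd Γ (ricEnd Γ V) z v) y := fun v =>
    differentiableAt_of_smooth (smooth_covEnd hΓ (h.smooth_ricEnd hy) v)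
  have hR := differentiableAt_of_smooth (smooth_curvOp hΓ v u)
  have e := congrArg (fun L => L m) (fderiv_eq_of_eqOn h.isOpen (fun z hz => h.codazzi hz u v) hy)
  simp only [fderiv_fun_sub ((hD u).clm_apply (differentiableAt_const v))
    ((hD v).clm_apply (differentiableAt_const u)), sub_apply, fderiv_apply_const (hD _),
    fderiv_apply_map hR hV] at e
  have c0 := congrArg (fun t => Γ y m t) (h.codazzi hy u v)
  simp only [map_sub] at c0
  have c1 := h.codazzi hy u (Γ y m v)
  have c2 := h.codazzi hy (Γ y m u) v
  simp only [covEnd₂, covCurv, covVec_apply, sub_apply, map_add]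
  rw [covEnd_apply (fun z => covEnd Γ (ricEnd Γ V) z u),
    covEnd_apply (fun z => covEnd Γ (ricEnd Γ V) z v), covEnd_apply (fun z => curvOp Γ z v u),
    h.torsionFree y hy m v]
  rw [h.torsionFree y hy m v] at c1
  linear_combination (norm := module) e + c0 - c1 - c2

theorem coordTrace_covEnd₂ (h : IsLocalShrinker U g Γ f V c) {y : E} (hy : y ∈ U) (m v : E) :
    coordTrace (fun u => covEnd₂ Γ (ricEnd Γ V) y m u v) = 0 := by
  have hD : ∀ v, DifferentiableAt ℝ (fun z => covEnd Γ (ricEnd Γ V) z v) y := fun v =>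
    differentiableAt_of_smooth (smooth_covEnd (h.smooth_connection y hy) (h.smooth_ricEnd hy) v)
  have e := congrArg (fun L => L m)
    (fderiv_eq_of_eqOn h.isOpen (fun z hz => h.divergence_ricEnd hz v) hy)
  rw [fderiv_coordTrace (fun u => (hD u).clm_apply (differentiableAt_const v))] at e
  have e1 : ∀ u, fderiv ℝ (fun z => covEnd Γ (ricEnd Γ V) z u v) y m
      = covEnd₂ Γ (ricEnd Γ V) y m u v + covEnd Γ (ricEnd Γ V) y (Γ y m u) v
        - Γ y m (covEnd Γ (ricEnd Γ V) y u v) + covEnd Γ (ricEnd Γ V) y u (Γ y m v) := by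
    intro u
    rw [fderiv_apply_const (hD u), covEnd₂, covEnd]
    simp only [add_apply, sub_apply, mul_apply_eq_comp]
    abel
  have e2 := coordTrace_comp_comm (Γ y m).toLinearMap.isLinear
    (isLinearMap_covEnd (Γ := Γ) (ricEnd Γ V) y v)
  simp only [ContinuousLinearMap.coe_coe] at e2
  simp only [e1, coordTrace_add, coordTrace_sub, e2, h.divergence_ricEnd hy, fderiv_fun_const,
    Pi.zero_apply, zero_apply] at e
  linarith

/-- The norm of the covariant derivative of the Ricci tensor is an algebraic expression in the
curvature. -/
theorem norm_covEnd_sq (h : IsLocalShrinker U g Γ f V c) {y : E} (hy : y ∈ U)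
    {ι : Type*} [Fintype ι] [DecidableEq ι] {b : ι → E} (hb : IsOrthoFrame (g y) b) :
    ∑ k, coordTrace
        (fun w => covEnd Γ (ricEnd Γ V) y (b k) (covEnd Γ (ricEnd Γ V) y (b k) w))
      = -2 * ∑ k, ∑ i, g y (curvOp Γ y (b k) (b i) (ricEnd Γ V y (b k))) (ricEnd Γ V y (b i))
        - c / 2 := by
  set P := ricEnd Γ V y with hP
  set D := covEnd Γ (ricEnd Γ V) y with hD
  set D2 := covEnd₂ Γ (ricEnd Γ V) y with hD2
  set R := curvOp Γ y with hR
  have hτ : ∑ i, g y (P (b i)) (P (b i)) = c / 2 := by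
    rw [← h.coordTrace_ricEnd_sq hy, ← hP, hb.trace_comp_eq]
    exact Finset.sum_congr rfl fun i _ => by rw [hP, h.ricEnd_symm hy (ricEnd Γ V y (b i))]
  have hric : ∀ v w, ∑ k, g y (R (b k) v (b k)) w = -g y (P v) w := by
    intro v w
    rw [← h.ricci_eq y hy, hb.trace_eq (isLinearMap_curvOp_left y v w), ← Finset.sum_neg_distrib]
    exact Finset.sum_congr rfl fun k _ => h.curvOp_skew hy _ _ _ _
  have hdiv : ∀ i, ∑ k, g y (D2 (b i) (b k) (b k)) (P (b i)) = 0 := by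
    intro i
    rw [← h.coordTrace_covEnd₂ hy (b i) (P (b i)), hb.trace_eq
      (isLinearMap_covEnd₂ (h.smooth_connection y hy) (h.smooth_ricEnd hy) (b i) (P (b i)))]
    exact Finset.sum_congr rfl fun k _ => h.covEnd₂_ricEnd_symm hy _ _ _ _
  -- The divergence of R contracted with V, evaluated by the contracted Bianchi identity and the
  -- derivative of Ric(V) = 0.
  have hcov : ∀ i, ∑ k, g y (covCurv Γ y (b k) (b i) (b k) (V y)) (P (b i))
      = 1 / 2 * g y (P (b i)) (P (b i)) - g y (P (P (b i))) (P (b i))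
        + g y (D (V y) (P (b i))) (b i) := by
    intro i
    have e := h.coordTrace_covCurv_left hy (P (b i)) (V y) (b i)
    rw [hb.trace_eq (IsLeviCivita.isLinearMap_covCurv_left y (P (b i)) (V y) (b i)),
      h.covEnd_ricEnd_gradient hy, IsLocalShrinker.covVec_eq] at e
    have e2 : ∀ k, g y (covCurv Γ y (b k) (b i) (b k) (V y)) (P (b i))
        = -g y (covCurv Γ y (b k) (P (b i)) (V y) (b i)) (b k) := by
      intro k
      rw [h.covCurv_pair_symm hy, h.covCurv_skew hy]
    rw [Finset.sum_congr rfl fun k _ => e2 k, Finset.sum_neg_distrib, e, ← hP, ← hD]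
    have e3 : g y (P (P (b i))) (b i) = g y (P (b i)) (P (b i)) := by
      rw [hP, h.ricEnd_symm hy (ricEnd Γ V y (b i))]
    have e4 : g y (P (P (P (b i)))) (b i) = g y (P (P (b i))) (P (b i)) := by
      rw [hP, h.ricEnd_symm hy (ricEnd Γ V y (ricEnd Γ V y (b i))), h.symm y hy]
    simp only [map_neg, map_sub, map_smul, neg_apply, sub_apply, smul_apply, smul_eq_mul, e3, e4]
    ring
  have e0 : ∀ k, coordTrace (fun w => D (b k) (D (b k) w))
      = -∑ i, g y (D2 (b k) (b k) (b i)) (P (b i)) := by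
    intro k
    rw [h.trace_covEnd_sq hy, ← hP, ← hD2, hb.trace_comp_eq]
    exact congrArg _ (Finset.sum_congr rfl fun i _ => by
      rw [hP, h.ricEnd_symm hy, h.symm y hy])
  -- The indices k, k, i are moved to i, k, k, whose trace is a derivative of div Ric:
  -- differentiated Codazzi exchanges the last two, the Ricci identity the first two. Each of these
  -- moves contributes one copy of R(k, i)Ric(k), the former through ∇V = 1/2 - Ric, hence the
  -- factor 2.
  have e1 : ∀ i k, g y (D2 (b k) (b k) (b i)) (P (b i))
      = g y (D2 (b i) (b k) (b k)) (P (b i)) + 2 * g y (R (b k) (b i) (P (b k))) (P (b i))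
        - g y (R (b k) (b i) (b k)) (P (P (b i)))
        + g y (covCurv Γ y (b k) (b i) (b k) (V y)) (P (b i))
        - 1 / 2 * g y (R (b k) (b i) (b k)) (P (b i)) := by
    intro i k
    have a1 := congrArg (fun v => g y v (P (b i))) (h.codazzi_covEnd₂ hy (b k) (b k) (b i))
    have a2 := congrArg (fun L : E →L[ℝ] E => g y (L (b k)) (P (b i)))
      (covEnd₂_comm (h.smooth_connection y hy) (h.torsionFree y hy) (h.smooth_ricEnd hy)
        (b k) (b i))
    have a3 : g y (P (R (b k) (b i) (b k))) (P (b i)) = g y (R (b k) (b i) (b k)) (P (P (b i))) := by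
      rw [hP, h.ricEnd_symm hy, h.symm y hy]
    rw [curvOp_swap y (b i) (b k), IsLocalShrinker.covVec_eq] at a1
    simp only [← hP, ← hD2, ← hR, map_sub, map_add, map_smul, sub_apply, add_apply, neg_apply,
      mul_apply_eq_comp, map_neg, smul_apply, smul_eq_mul, a3] at a1 a2
    linarith
  have e2 : ∑ i, g y (D (V y) (P (b i))) (b i) = 0 := by
    rw [← hb.trace_comp_eq, coordTrace_clm_comm]
    exact h.trace_ricEnd_covEnd hy (V y)
  -- The cubic terms in Ric from `hric` and `hcov` cancel, and the two halves of |Ric|² add up.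
  have e3 : ∀ i, ∑ k, g y (D2 (b k) (b k) (b i)) (P (b i))
      = 2 * ∑ k, g y (R (b k) (b i) (P (b k))) (P (b i)) + g y (P (b i)) (P (b i))
        + g y (D (V y) (P (b i))) (b i) := by
    intro i
    simp only [e1, Finset.sum_add_distrib, Finset.sum_sub_distrib, ← Finset.mul_sum, hdiv, hric,
      hcov, h.symm y hy (P (P (b i)))]
    ring
  simp only [e0, Finset.sum_neg_distrib]
  rw [Finset.sum_comm]
  simp only [e3, Finset.sum_add_distrib, hτ, e2, ← Finset.mul_sum]
  rw [Finset.sum_comm]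
  ring

end IsLocalShrinker

end Soliton

/-! ### Isometric immersions and the Gauss equation of a level set. -/

section Gauss

variable {E F : Type*} [NormedAddCommGroup E] [NormedSpace ℝ E]
  [NormedAddCommGroup F] [NormedSpace ℝ F]
  {U : Set E} {g : E → E →L[ℝ] E →L[ℝ] ℝ} {Γ : E → E →L[ℝ] E →L[ℝ] E}
  {U' : Set F} {g' : F → F →L[ℝ] F →L[ℝ] ℝ} {Γ' : F → F →L[ℝ] F →L[ℝ] F} {γ : F → E}

/-- The covariant derivative of `∂_b γ` in the direction `∂_a γ`. -/
def covHess (Γ : E → E →L[ℝ] E →L[ℝ] E) (γ : F → E) (v a b : F) : E :=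
  fderiv ℝ (fun z => fderiv ℝ γ z b) v a + Γ (γ v) (fderiv ℝ γ v a) (fderiv ℝ γ v b)

/-- `γ` is a smooth isometric immersion of `(U', g')` in `(U, g)`. -/
structure IsIsometricImmersion (U : Set E) (g : E → E →L[ℝ] E →L[ℝ] ℝ) (U' : Set F)
    (g' : F → F →L[ℝ] F →L[ℝ] ℝ) (γ : F → E) : Prop where
  contDiff : ∀ v ∈ U', ContDiffAt ℝ 3 γ v
  mapsTo : ∀ v ∈ U', γ v ∈ U
  metric_eq : ∀ v ∈ U', ∀ a b, g' v a b = g (γ v) (fderiv ℝ γ v a) (fderiv ℝ γ v b)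

namespace IsIsometricImmersion

theorem differentiableAt (hγ : IsIsometricImmersion U g U' g' γ) {v : F} (hv : v ∈ U') :
    DifferentiableAt ℝ γ v :=
  (hγ.contDiff v hv).differentiableAt (by simp)

theorem fderiv_connection (h : IsLeviCivita U g Γ) (hγ : IsIsometricImmersion U g U' g' γ)
    {v : F} (hv : v ∈ U') {X Y : F → E} (hX : DifferentiableAt ℝ X v)
    (hY : DifferentiableAt ℝ Y v) (a : F) :
    fderiv ℝ (fun z => Γ (γ z) (X z) (Y z)) v a
      = fderiv ℝ Γ (γ v) (fderiv ℝ γ v a) (X v) (Y v) + Γ (γ v) (fderiv ℝ X v a) (Y v)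
        + Γ (γ v) (X v) (fderiv ℝ Y v a) := by
  have hΓ := differentiableAt_of_smooth (h.smooth_connection _ (hγ.mapsTo v hv))
  have hd := hγ.differentiableAt hv
  have hT : DifferentiableAt ℝ (fun z => Γ (γ z)) v := hΓ.comp v hd
  have e : fderiv ℝ (fun z => Γ (γ z)) v = (fderiv ℝ Γ (γ v)).comp (fderiv ℝ γ v) :=
    fderiv_fun_comp v hΓ hd
  rw [fderiv_apply_map (hT.clm_apply hX) hY, fderiv_apply_map hT hX, e]
  simp

theorem fderiv_metric (h : IsLeviCivita U g Γ) (hγ : IsIsometricImmersion U g U' g' γ)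
    {v : F} (hv : v ∈ U') {X Y : F → E} (hX : DifferentiableAt ℝ X v)
    (hY : DifferentiableAt ℝ Y v) (a : F) :
    fderiv ℝ (fun z => g (γ z) (X z) (Y z)) v a
      = g (γ v) (fderiv ℝ X v a + Γ (γ v) (fderiv ℝ γ v a) (X v)) (Y v)
        + g (γ v) (X v) (fderiv ℝ Y v a + Γ (γ v) (fderiv ℝ γ v a) (Y v)) := by
  have hg := differentiableAt_of_smooth (h.smooth_metric _ (hγ.mapsTo v hv))
  have hd := hγ.differentiableAt hv
  have hT : DifferentiableAt ℝ (fun z => g (γ z)) v := hg.comp v hd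
  have e : fderiv ℝ (fun z => g (γ z)) v = (fderiv ℝ g (γ v)).comp (fderiv ℝ γ v) :=
    fderiv_fun_comp v hg hd
  rw [fderiv_apply_map (hT.clm_apply hX) hY, fderiv_apply_map hT hX, e]
  simp only [add_apply, ContinuousLinearMap.comp_apply, h.compat _ (hγ.mapsTo v hv), map_add]
  ring

theorem contDiff_partial (hγ : IsIsometricImmersion U g U' g' γ) {v : F} (hv : v ∈ U') (a : F) :
    ContDiffAt ℝ 2 (fun z => fderiv ℝ γ z a) v :=
  ((hγ.contDiff v hv).fderiv_right (m := 2) (by norm_num)).clm_apply contDiffAt_const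

theorem differentiableAt_partial (hγ : IsIsometricImmersion U g U' g' γ) {v : F} (hv : v ∈ U')
    (a : F) : DifferentiableAt ℝ (fun z => fderiv ℝ γ z a) v :=
  (hγ.contDiff_partial hv a).differentiableAt (by simp)

theorem differentiableAt_partial₂ (hγ : IsIsometricImmersion U g U' g' γ) {v : F} (hv : v ∈ U')
    (a b : F) : DifferentiableAt ℝ (fun z => fderiv ℝ (fun z => fderiv ℝ γ z b) z a) v :=
  (((hγ.contDiff_partial hv b).fderiv_right (m := 1) (by norm_num)).clm_apply
    contDiffAt_const).differentiableAt (by simp)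

theorem fderiv_partial_comm (hγ : IsIsometricImmersion U g U' g' γ) {v : F} (hv : v ∈ U')
    (a b : F) :
    fderiv ℝ (fun z => fderiv ℝ γ z b) v a = fderiv ℝ (fun z => fderiv ℝ γ z a) v b :=
  fderiv_fderiv_comm_of_two ((hγ.contDiff v hv).of_le (by norm_num)) a b

theorem covHess_symm (h : IsLeviCivita U g Γ) (hγ : IsIsometricImmersion U g U' g' γ)
    {v : F} (hv : v ∈ U') (a b : F) : covHess Γ γ v a b = covHess Γ γ v b a := by
  rw [covHess, covHess, hγ.fderiv_partial_comm hv, h.torsionFree _ (hγ.mapsTo v hv)]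

theorem differentiableAt_connection_comp (h : IsLeviCivita U g Γ)
    (hγ : IsIsometricImmersion U g U' g' γ) {v : F} (hv : v ∈ U') (a b : F) :
    DifferentiableAt ℝ (fun z => Γ (γ z) (fderiv ℝ γ z a) (fderiv ℝ γ z b)) v := by
  have h1 : DifferentiableAt ℝ (fun z => Γ (γ z)) v :=
    (h.differentiable_connection _ (hγ.mapsTo v hv)).comp v (hγ.differentiableAt hv)
  exact (h1.clm_apply (hγ.differentiableAt_partial hv a)).clm_apply
    (hγ.differentiableAt_partial hv b)

theorem differentiableAt_covHess (h : IsLeviCivita U g Γ) (hγ : IsIsometricImmersion U g U' g' γ)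
    {v : F} (hv : v ∈ U') (a b : F) : DifferentiableAt ℝ (fun z => covHess Γ γ z a b) v :=
  (hγ.differentiableAt_partial₂ hv a b).add (hγ.differentiableAt_connection_comp h hv a b)

/-- The tangential part of the covariant Hessian of an isometric immersion is given by the
connection of the induced metric. -/
theorem metric_connection (h : IsLeviCivita U g Γ) (h' : IsMetricConnection U' g' Γ')
    (hγ : IsIsometricImmersion U g U' g' γ) {v : F} (hv : v ∈ U') (a b c : F) :
    g' v (Γ' v a b) c = g (γ v) (covHess Γ γ v a b) (fderiv ℝ γ v c) := by
  have key : ∀ a b c, g' v (Γ' v a b) c + g' v b (Γ' v a c)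
      = g (γ v) (covHess Γ γ v a b) (fderiv ℝ γ v c)
        + g (γ v) (fderiv ℝ γ v b) (covHess Γ γ v a c) := by
    intro a b c
    have e := congrArg (fun L => L a) (fderiv_eq_of_eqOn h'.isOpen
      (fun z hz => hγ.metric_eq z hz b c) hv)
    rw [h'.fderiv_metric hv (differentiableAt_const b) (differentiableAt_const c),
      hγ.fderiv_metric h hv (hγ.differentiableAt_partial hv b)
      (hγ.differentiableAt_partial hv c)] at e
    simpa [covHess] using e
  have s1 : ∀ x y, Γ' v x y = Γ' v y x := h'.torsionFree v hv
  have s2 := fun x y => hγ.covHess_symm h hv x y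
  have s3 := h'.symm v hv
  have s4 := h.symm _ (hγ.mapsTo v hv)
  -- Koszul's argument: three cyclic instances of metric compatibility determine a symmetric
  -- connection.
  have k1 := key a b c
  have k2 := key b c a
  have k3 := key c a b
  rw [s1 a c, s2 a c, s3 b, s4 (fderiv ℝ γ v b)] at k1
  rw [s1 b a, s2 b a, s3 c, s4 (fderiv ℝ γ v c)] at k2
  rw [s1 c b, s2 c b, s3 a, s4 (fderiv ℝ γ v a)] at k3
  linarith

/-- The third derivatives of γ are symmetric, so antisymmetrising the covariant derivative of ∂∂γ
leaves only the ambient curvature. -/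
theorem covHess_comm (h : IsLeviCivita U g Γ) (hγ : IsIsometricImmersion U g U' g' γ)
    {v : F} (hv : v ∈ U') (a b c : F) :
    (fderiv ℝ (fun z => covHess Γ γ z b c) v a + Γ (γ v) (fderiv ℝ γ v a) (covHess Γ γ v b c))
      - (fderiv ℝ (fun z => covHess Γ γ z a c) v b + Γ (γ v) (fderiv ℝ γ v b) (covHess Γ γ v a c))
      = curvOp Γ (γ v) (fderiv ℝ γ v a) (fderiv ℝ γ v b) (fderiv ℝ γ v c) := by
  have hX := fun a => hγ.differentiableAt_partial hv a
  have key : ∀ a b, fderiv ℝ (fun z => covHess Γ γ z b c) v a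
      = fderiv ℝ (fun z => fderiv ℝ (fun z => fderiv ℝ γ z c) z b) v a
        + (fderiv ℝ Γ (γ v) (fderiv ℝ γ v a) (fderiv ℝ γ v b) (fderiv ℝ γ v c)
          + Γ (γ v) (fderiv ℝ (fun z => fderiv ℝ γ z b) v a) (fderiv ℝ γ v c)
          + Γ (γ v) (fderiv ℝ γ v b) (fderiv ℝ (fun z => fderiv ℝ γ z c) v a)) := by
    intro a b
    have h2 := hγ.differentiableAt_connection_comp h hv b c
    have h3 := hγ.differentiableAt_partial₂ hv b c
    unfold covHess
    rw [fderiv_fun_add h3 h2, add_apply, hγ.fderiv_connection h hv (hX b) (hX c)]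
  rw [key, key, fderiv_fderiv_comm_of_two (hγ.contDiff_partial hv c) a b,
    hγ.fderiv_partial_comm hv a b]
  simp only [covHess, curvOp, add_apply, sub_apply, mul_apply_eq_comp, map_add]
  abel

/-- The Gauss equation, in terms of the covariant Hessian of the immersion. -/
theorem gauss (h : IsLeviCivita U g Γ) (h' : IsMetricConnection U' g' Γ')
    (hγ : IsIsometricImmersion U g U' g' γ) {v : F} (hv : v ∈ U') (a b c d : F) :
    g' v (curvOp Γ' v a b c) d
        + (g' v (Γ' v b c) (Γ' v a d) - g' v (Γ' v a c) (Γ' v b d))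
      = g (γ v) (curvOp Γ (γ v) (fderiv ℝ γ v a) (fderiv ℝ γ v b) (fderiv ℝ γ v c)) (fderiv ℝ γ v d)
        + (g (γ v) (covHess Γ γ v b c) (covHess Γ γ v a d)
          - g (γ v) (covHess Γ γ v a c) (covHess Γ γ v b d)) := by
  have hΓ' := h'.differentiable_connection v hv
  -- `metric_connection` is differentiated along a; the statement then follows on antisymmetrising
  -- in a and b. Keeping the products of Γ' on the left avoids splitting into tangential and normal
  -- parts at this stage.
  have key : ∀ a b, g' v (fderiv ℝ Γ' v a b c + Γ' v a (Γ' v b c)) d + g' v (Γ' v b c) (Γ' v a d)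
      = g (γ v) (fderiv ℝ (fun z => covHess Γ γ z b c) v a
          + Γ (γ v) (fderiv ℝ γ v a) (covHess Γ γ v b c)) (fderiv ℝ γ v d)
        + g (γ v) (covHess Γ γ v b c) (covHess Γ γ v a d) := by
    intro a b
    have e := congrArg (fun L => L a) (fderiv_eq_of_eqOn h'.isOpen
      (fun z hz => hγ.metric_connection h h' hz b c d) hv)
    have hb : DifferentiableAt ℝ (fun z => Γ' z b) v := hΓ'.clm_apply (differentiableAt_const b)
    rw [h'.fderiv_metric hv (hb.clm_apply (differentiableAt_const c)) (differentiableAt_const d),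
      hγ.fderiv_metric h hv (hγ.differentiableAt_covHess h hv b c)
      (hγ.differentiableAt_partial hv d), fderiv_apply_const hb,
      fderiv_apply_const hΓ'] at e
    simpa [covHess] using e
  have k1 := key a b
  have k2 := key b a
  have k3 := congrArg (fun t => g (γ v) t (fderiv ℝ γ v d)) (hγ.covHess_comm h hv a b c)
  simp only [curvOp, add_apply, sub_apply, mul_apply_eq_comp, map_add, map_sub] at k1 k2 k3 ⊢
  linarith

end IsIsometricImmersion

variable [FiniteDimensional ℝ E] [FiniteDimensional ℝ F] {f : E → ℝ} {V : E → E} {c : ℝ}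

namespace IsLocalShrinker

omit [FiniteDimensional ℝ F] in
/-- An orthonormal frame of a level set, completed by the unit normal. -/
theorem completed_frame (h : IsLocalShrinker U g Γ f V c)
    (hγ : IsIsometricImmersion U g U' g' γ) {v : F} (hv : v ∈ U')
    (hf : ∀ a, fderiv ℝ f (γ v) (fderiv ℝ γ v a) = 0) (hV : V (γ v) ≠ 0)
    (hdim : Module.finrank ℝ E = Module.finrank ℝ F + 1)
    {ι : Type*} [Fintype ι] [DecidableEq ι] {b : ι → F} (hb : IsOrthoFrame (g' v) b) :
    IsOrthoFrame (g (γ v)) (fun o : Option ι =>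
      o.elim ((Real.sqrt (g (γ v) (V (γ v)) (V (γ v))))⁻¹ • V (γ v))
        (fun i => fderiv ℝ γ v (b i))) := by
  have hy := hγ.mapsTo v hv
  have h0 := h.pos _ hy _ hV
  have h1 := Real.mul_self_sqrt h0.le
  have h2 := (Real.sqrt_pos.2 h0).ne'
  refine ⟨by simp [hdim, hb.card], ?_⟩
  rintro (_ | i) (_ | j)
  · simp only [Option.elim, map_smul, smul_apply, smul_eq_mul, if_true]
    field_simp
    rw [sq, h1]
  · simp [h.gradient _ hy, hf]
  · simp [h.symm _ hy _ (V (γ v)), h.gradient _ hy, hf]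
  · simp [← hγ.metric_eq v hv, hb.apply]

/-- The Gauss equation for the level sets of the potential. -/
theorem gauss_levelSet (h : IsLocalShrinker U g Γ f V c) (h' : IsMetricConnection U' g' Γ')
    (hγ : IsIsometricImmersion U g U' g' γ) {v : F} (hv : v ∈ U')
    (hf : ∀ z ∈ U', f (γ z) = f (γ v)) (hV : V (γ v) ≠ 0) (hdim : Module.finrank ℝ E = Module.finrank ℝ F + 1)
    (a b c d : F) :
    g' v (curvOp Γ' v a b c) d
      = g (γ v) (curvOp Γ (γ v) (fderiv ℝ γ v a) (fderiv ℝ γ v b) (fderiv ℝ γ v c)) (fderiv ℝ γ v d)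
        + (g (γ v) (covVec Γ V (γ v) (fderiv ℝ γ v b)) (fderiv ℝ γ v c)
            * g (γ v) (covVec Γ V (γ v) (fderiv ℝ γ v a)) (fderiv ℝ γ v d)
          - g (γ v) (covVec Γ V (γ v) (fderiv ℝ γ v a)) (fderiv ℝ γ v c)
            * g (γ v) (covVec Γ V (γ v) (fderiv ℝ γ v b)) (fderiv ℝ γ v d))
          / g (γ v) (V (γ v)) (V (γ v)) := by
  have hX := fun z hz a => hγ.differentiableAt_partial (v := z) hz a
  have hd : ∀ z ∈ U', DifferentiableAt ℝ γ z := fun z hz => hγ.differentiableAt hz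
  have hf' : ∀ z ∈ U', ∀ a, fderiv ℝ f (γ z) (fderiv ℝ γ z a) = 0 := by
    intro z hz a
    have e := congrArg (fun L => L a) (fderiv_eq_of_eqOn h'.isOpen hf hz)
    rw [fderiv_fun_comp z (differentiableAt_of_smooth (h.smooth_potential _ (hγ.mapsTo z hz)))
      (hd z hz)] at e
    simpa using e
  -- V is orthogonal to the level set; differentiating g(V, ∂_b γ) = 0 identifies the second
  -- fundamental form, up to |V|, with -∇²f.
  have hα : ∀ a b, g (γ v) (V (γ v)) (covHess Γ γ v a b)
      = -g (γ v) (covVec Γ V (γ v) (fderiv ℝ γ v a)) (fderiv ℝ γ v b) := by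
    intro a b
    have hVd := differentiableAt_of_smooth (h.smooth_gradient _ (hγ.mapsTo v hv))
    have hVγ : DifferentiableAt ℝ (fun z => V (γ z)) v := hVd.comp v (hd v hv)
    have e := congrArg (fun L => L a) (fderiv_eq_of_eqOn h'.isOpen
      (S := fun z => g (γ z) (V (γ z)) (fderiv ℝ γ z b)) (T := fun _ => (0 : ℝ))
      (fun z hz => by rw [h.gradient _ (hγ.mapsTo z hz), hf' z hz]) hv)
    rw [hγ.fderiv_metric h.toIsLeviCivita hv hVγ (hX v hv b), fderiv_fun_comp v hVd (hd v hv)] at e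
    simp only [ContinuousLinearMap.comp_apply, ← covVec_apply, fderiv_fun_const, Pi.zero_apply,
      zero_apply] at e
    rw [covHess]
    linarith
  obtain ⟨b', hb'⟩ := h'.exists_orthoFrame hv
  have hfr := h.completed_frame hγ hv (hf' v hv) hV hdim hb'
  have h0 := h.pos _ (hγ.mapsTo v hv) _ hV
  have h1 := Real.mul_self_sqrt h0.le
  have h2 := (Real.sqrt_pos.2 h0).ne'
  have hs := h.symm _ (hγ.mapsTo v hv)
  -- Parseval in the completed frame: the normal component gives the product of Hessians over |V|²,
  -- and the tangential ones reproduce the products of Γ', which cancel against `gauss`.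
  have key : ∀ a b c d, g (γ v) (covHess Γ γ v a b) (covHess Γ γ v c d)
      = g (γ v) (covVec Γ V (γ v) (fderiv ℝ γ v a)) (fderiv ℝ γ v b)
          * g (γ v) (covVec Γ V (γ v) (fderiv ℝ γ v c)) (fderiv ℝ γ v d)
          / g (γ v) (V (γ v)) (V (γ v)) + g' v (Γ' v a b) (Γ' v c d) := by
    intro a b c d
    rw [hfr.inner_eq_sum, hb'.inner_eq_sum, Fintype.sum_option]
    congr 1
    · simp only [Option.elim, map_smul, smul_apply, smul_eq_mul, hα,
        hs (covHess Γ γ v a b) (V (γ v))]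
      have : (Real.sqrt (g (γ v) (V (γ v)) (V (γ v))))⁻¹ * (Real.sqrt (g (γ v) (V (γ v)) (V (γ v))))⁻¹
          = (g (γ v) (V (γ v)) (V (γ v)))⁻¹ := by rw [← mul_inv, h1]
      rw [div_eq_mul_inv, ← this]
      ring
    · refine Finset.sum_congr rfl fun i _ => ?_
      simp only [Option.elim]
      rw [hγ.metric_connection h.toIsLeviCivita h' hv, h'.symm v hv (b' i),
        hγ.metric_connection h.toIsLeviCivita h' hv, hs (fderiv ℝ γ v (b' i))]
  have e := hγ.gauss h.toIsLeviCivita h' hv a b c d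
  rw [key, key] at e
  rw [sub_div]
  linarith

end IsLocalShrinker

end Gauss

/-! ### Coordinate tensors as invariant objects on ℝⁿ. -/

section Coordinates

variable {n : ℕ}

theorem coordVec_apply (i j : Fin n) : (coordVec i : Coord n) j = if j = i then 1 else 0 := by
  simp [coordVec]

theorem sum_coordVec (v : Coord n) : ∑ i, v i • coordVec i = v := by
  ext j
  simp [coordVec_apply]

theorem _root_.IsLinearMap.eq_sum_coordVec {F : Type*} [AddCommGroup F] [Module ℝ F]
    {φ : Coord n → F} (h : IsLinearMap ℝ φ) (v : Coord n) : φ v = ∑ i, v i • φ (coordVec i) := by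
  conv_lhs => rw [← sum_coordVec v]
  have := map_sum (h.mk' φ) (fun i => v i • coordVec i) Finset.univ
  simp only [IsLinearMap.mk'_apply, h.map_smul] at this
  exact this

theorem coord_ext {F : Type*} [NormedAddCommGroup F] [NormedSpace ℝ F] {T S : Coord n →L[ℝ] F}
    (h : ∀ i, T (coordVec i) = S (coordVec i)) : T = S := by
  ext v
  rw [T.toLinearMap.isLinear.eq_sum_coordVec v (φ := fun v => T v),
    S.toLinearMap.isLinear.eq_sum_coordVec v (φ := fun v => S v)]
  simp [h]

theorem coordTrace_eq_sum {L : Coord n → Coord n} (hL : IsLinearMap ℝ L) :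
    coordTrace L = ∑ i, L (coordVec i) i := by
  rw [coordTrace_eq_trace hL,
    LinearMap.trace_eq_matrix_trace ℝ (EuclideanSpace.basisFun (Fin n) ℝ).toBasis]
  simp [Matrix.trace, LinearMap.toMatrix_apply, coordVec]

theorem contDiffAt_smul_const {E F : Type*} [NormedAddCommGroup E] [NormedSpace ℝ E]
    [NormedAddCommGroup F] [NormedSpace ℝ F] {m : ℕ∞ω} {c : E → ℝ} {y : E} (h : ContDiffAt ℝ m c y) (T : F) :
    ContDiffAt ℝ m (fun z => c z • T) y :=
  h.smul contDiffAt_const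

theorem contDiffAt_det {E : Type*} [NormedAddCommGroup E] [NormedSpace ℝ E]
    {A : E → Matrix (Fin n) (Fin n) ℝ} {y : E} {m : ℕ∞ω}
    (h : ∀ i j, ContDiffAt ℝ m (fun z => A z i j) y) : ContDiffAt ℝ m (fun z => (A z).det) y := by
  simp only [Matrix.det_apply]
  exact ContDiffAt.sum fun σ _ => (contDiffAt_prod fun i _ => h _ _).const_smul _

theorem contDiffAt_inv {E : Type*} [NormedAddCommGroup E] [NormedSpace ℝ E]
    {A : E → Matrix (Fin n) (Fin n) ℝ} {y : E} {m : ℕ∞ω}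
    (h : ∀ i j, ContDiffAt ℝ m (fun z => A z i j) y) (hd : (A y).det ≠ 0) (i j : Fin n) :
    ContDiffAt ℝ m (fun z => (A z)⁻¹ i j) y := by
  simp only [Matrix.inv_def, Ring.inverse_eq_inv', Matrix.smul_apply, Matrix.adjugate_apply,
    smul_eq_mul]
  refine ((contDiffAt_det h).inv hd).mul (contDiffAt_det fun k l => ?_)
  by_cases hk : k = j
  · subst hk
    simpa using contDiffAt_const
  · simpa [Matrix.updateRow_ne hk] using h k l

/-- `G` is the matrix of a Riemannian metric of class `C^k`, with `k ≥ 2`, on the open set `U`. -/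
structure IsMetricOn (k : ℕ∞ω) (U : Set (Coord n)) (G : Coord n → Matrix (Fin n) (Fin n) ℝ) :
    Prop where
  two_le : 2 ≤ k
  isOpen : IsOpen U
  contDiff : ∀ y ∈ U, ∀ i j, ContDiffAt ℝ k (fun z => G z i j) y
  symm : ∀ y ∈ U, ∀ i j, G y i j = G y j i
  pos : ∀ y ∈ U, ∀ v, v ≠ 0 → 0 < metricForm G y v v

variable (G : Coord n → Matrix (Fin n) (Fin n) ℝ)

/-- The metric with matrix `G`, as a bilinear form. -/
def metricCLM (y : Coord n) : Coord n →L[ℝ] Coord n →L[ℝ] ℝ :=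
  ∑ i, ∑ j, G y i j • (EuclideanSpace.proj i : Coord n →L[ℝ] ℝ).smulRight
    (EuclideanSpace.proj j : Coord n →L[ℝ] ℝ)

/-- The Levi-Civita connection of the metric with matrix `G`. -/
def connCLM (y : Coord n) : Coord n →L[ℝ] Coord n →L[ℝ] Coord n :=
  ∑ k, ∑ i, ∑ j, christoffel G y k i j • (EuclideanSpace.proj i : Coord n →L[ℝ] ℝ).smulRight
    ((EuclideanSpace.proj j : Coord n →L[ℝ] ℝ).smulRight (coordVec k : Coord n))

/-- The gradient of `f`. -/
def gradVec (f : Coord n → ℝ) (y : Coord n) : Coord n :=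
  ∑ k, (∑ l, (G y)⁻¹ k l * pd l f y) • (coordVec k : Coord n)

variable {G}

theorem metricCLM_apply (y v w : Coord n) : metricCLM G y v w = metricForm G y v w := by
  simp [metricCLM, metricForm, mul_assoc]

theorem metricCLM_coordVec (y : Coord n) (i j : Fin n) :
    metricCLM G y (coordVec i) (coordVec j) = G y i j := by
  simp [metricCLM_apply, metricForm, coordVec_apply]

theorem connCLM_coordVec (y : Coord n) (i j k : Fin n) :
    connCLM G y (coordVec i) (coordVec j) k = christoffel G y k i j := by
  simp [connCLM, coordVec_apply]

theorem gradVec_apply (f : Coord n → ℝ) (y : Coord n) (k : Fin n) :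
    gradVec G f y k = ∑ l, (G y)⁻¹ k l * pd l f y := by
  simp [gradVec, coordVec_apply]

theorem contDiffAt_pd {u : Coord n → ℝ} {y : Coord n} {m k : ℕ∞ω} (h : ContDiffAt ℝ k u y)
    (hm : m + 1 ≤ k) (i : Fin n) : ContDiffAt ℝ m (pd i u) y :=
  (h.fderiv_right hm).clm_apply contDiffAt_const

namespace IsMetricOn

variable {U : Set (Coord n)} {k : ℕ∞ω}

theorem det_ne_zero (h : IsMetricOn k U G) {y : Coord n} (hy : y ∈ U) : (G y).det ≠ 0 := by
  intro h0
  obtain ⟨v, hv, hv0⟩ := Matrix.exists_mulVec_eq_zero_iff.2 h0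
  have hv' : (WithLp.toLp 2 v : Coord n) ≠ 0 := by
    intro h1
    apply hv
    funext i
    simpa using congrArg (fun w : Coord n => w i) h1
  have := h.pos y hy _ hv'
  have e : metricForm G y (WithLp.toLp 2 v) (WithLp.toLp 2 v) = ∑ i, v i * (G y).mulVec v i := by
    simp only [metricForm, Matrix.mulVec, dotProduct, Finset.mul_sum]
    exact Finset.sum_congr rfl fun i _ => Finset.sum_congr rfl fun j _ => by ring
  rw [e, hv0] at this
  simp at this

theorem mul_inv (h : IsMetricOn k U G) {y : Coord n} (hy : y ∈ U) : G y * (G y)⁻¹ = 1 :=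
  Matrix.mul_nonsing_inv _ (h.det_ne_zero hy).isUnit

theorem inv_mul (h : IsMetricOn k U G) {y : Coord n} (hy : y ∈ U) : (G y)⁻¹ * G y = 1 :=
  Matrix.nonsing_inv_mul _ (h.det_ne_zero hy).isUnit

theorem sum_mul_inv (h : IsMetricOn k U G) {y : Coord n} (hy : y ∈ U) (i : Fin n) (t : Fin n → ℝ) :
    ∑ k, G y i k * ∑ l, (G y)⁻¹ k l * t l = t i := by
  have : (G y * (G y)⁻¹).mulVec t i = (1 : Matrix (Fin n) (Fin n) ℝ).mulVec t i := by
    rw [h.mul_inv hy]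
  rw [← Matrix.mulVec_mulVec, Matrix.one_mulVec] at this
  exact this

theorem sum_inv_mul (h : IsMetricOn k U G) {y : Coord n} (hy : y ∈ U) (i : Fin n) (t : Fin n → ℝ) :
    ∑ k, (G y)⁻¹ i k * ∑ l, G y k l * t l = t i := by
  have : ((G y)⁻¹ * G y).mulVec t i = (1 : Matrix (Fin n) (Fin n) ℝ).mulVec t i := by
    rw [h.inv_mul hy]
  rw [← Matrix.mulVec_mulVec, Matrix.one_mulVec] at this
  exact this

theorem contDiff_christoffel (h : IsMetricOn k U G) {y : Coord n} (hy : y ∈ U) {m : ℕ∞ω}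
    (hm : m + 1 ≤ k) (l i j : Fin n) : ContDiffAt ℝ m (fun z => christoffel G z l i j) y := by
  have h1 := fun i j => (h.contDiff y hy i j).of_le (le_self_add.trans hm)
  have h2 := fun i j l => contDiffAt_pd (h.contDiff y hy i j) hm l
  unfold christoffel
  exact contDiffAt_const.mul (ContDiffAt.sum fun p _ =>
    (contDiffAt_inv h1 (h.det_ne_zero hy) l p).mul (((h2 j p i).add (h2 i p j)).sub (h2 i j p)))

theorem contDiff_metricCLM (h : IsMetricOn k U G) {y : Coord n} (hy : y ∈ U) :
    ContDiffAt ℝ k (metricCLM G) y := by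
  unfold metricCLM
  exact ContDiffAt.sum fun i _ => ContDiffAt.sum fun j _ =>
    contDiffAt_smul_const (h.contDiff y hy i j) _

theorem contDiff_connCLM (h : IsMetricOn k U G) {y : Coord n} (hy : y ∈ U) {m : ℕ∞ω}
    (hm : m + 1 ≤ k) : ContDiffAt ℝ m (connCLM G) y := by
  unfold connCLM
  exact ContDiffAt.sum fun p _ => ContDiffAt.sum fun i _ => ContDiffAt.sum fun j _ =>
    contDiffAt_smul_const (h.contDiff_christoffel hy hm p i j) _

theorem differentiableAt_metricCLM (h : IsMetricOn k U G) {y : Coord n} (hy : y ∈ U) :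
    DifferentiableAt ℝ (metricCLM G) y :=
  ((h.contDiff_metricCLM hy).of_le h.two_le).differentiableAt (by simp)

theorem differentiableAt_connCLM (h : IsMetricOn k U G) {y : Coord n} (hy : y ∈ U) :
    DifferentiableAt ℝ (connCLM G) y :=
  (h.contDiff_connCLM hy (m := 1) (by rw [one_add_one_eq_two]; exact h.two_le)).differentiableAt
    (by simp)

theorem smooth_gradVec (h : IsMetricOn ∞ U G) {y : Coord n} (hy : y ∈ U) {f : Coord n → ℝ}
    (hf : ContDiffAt ℝ ∞ f y) : ContDiffAt ℝ ∞ (gradVec G f) y := by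
  unfold gradVec
  exact ContDiffAt.sum fun k _ => (ContDiffAt.sum fun l _ =>
    (contDiffAt_inv (h.contDiff y hy) (h.det_ne_zero hy) k l).mul
      (contDiffAt_pd hf (by simp) l)).smul contDiffAt_const

theorem pd_symm (h : IsMetricOn k U G) {y : Coord n} (hy : y ∈ U) (l i j : Fin n) :
    pd l (fun z => G z i j) y = pd l (fun z => G z j i) y := by
  unfold pd
  rw [fderiv_eq_of_eqOn h.isOpen (fun z hz => h.symm z hz i j) hy]

theorem christoffel_symm (h : IsMetricOn k U G) {y : Coord n} (hy : y ∈ U) (k i j : Fin n) :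
    christoffel G y k i j = christoffel G y k j i := by
  unfold christoffel
  simp only [h.pd_symm hy _ i j]
  congr 1
  exact Finset.sum_congr rfl fun l _ => by ring

theorem metric_christoffel (h : IsMetricOn k U G) {y : Coord n} (hy : y ∈ U) (i j m : Fin n) :
    ∑ k, G y m k * christoffel G y k i j = (1 / 2) * (pd i (fun z => G z j m) y
      + pd j (fun z => G z i m) y - pd m (fun z => G z i j) y) := by
  rw [← h.sum_mul_inv hy m (fun m => (1 / 2) * (pd i (fun z => G z j m) y
      + pd j (fun z => G z i m) y - pd m (fun z => G z i j) y))]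
  refine Finset.sum_congr rfl fun k _ => ?_
  rw [christoffel, Finset.mul_sum]
  congr 1
  exact Finset.sum_congr rfl fun l _ => by ring

theorem fderiv_metricCLM (h : IsMetricOn k U G) {y : Coord n} (hy : y ∈ U) (k i j : Fin n) :
    fderiv ℝ (metricCLM G) y (coordVec k) (coordVec i) (coordVec j)
      = pd k (fun z => G z i j) y := by
  have hg := h.differentiableAt_metricCLM hy
  rw [← fderiv_apply_const hg, ← fderiv_apply_const
    (hg.clm_apply (differentiableAt_const _))]
  simp only [metricCLM_coordVec, pd]

theorem metricCLM_connCLM (h : IsMetricOn k U G) {y : Coord n} (hy : y ∈ U) (i j m : Fin n) :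
    metricCLM G y (connCLM G y (coordVec i) (coordVec j)) (coordVec m)
      = (1 / 2) * (pd i (fun z => G z j m) y
      + pd j (fun z => G z i m) y - pd m (fun z => G z i j) y) := by
  rw [← h.metric_christoffel hy, metricCLM_apply, metricForm]
  simp [connCLM_coordVec, coordVec_apply, h.symm y hy m]

theorem isMetricConnection (h : IsMetricOn k U G) : IsMetricConnection U (metricCLM G) (connCLM G) where
  isOpen := h.isOpen
  differentiable_metric _ hy := h.differentiableAt_metricCLM hy
  differentiable_connection _ hy := h.differentiableAt_connCLM hy
  symm y hy v w := by
    rw [metricCLM_apply, metricCLM_apply, metricForm, metricForm, Finset.sum_comm]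
    exact Finset.sum_congr rfl fun i _ => Finset.sum_congr rfl fun j _ => by
      rw [h.symm y hy i j]; ring
  pos y hy v hv := by rw [metricCLM_apply]; exact h.pos y hy v hv
  torsionFree y hy v w := by
    have : connCLM G y = (connCLM G y).flip := by
      refine coord_ext fun i => coord_ext fun j => ?_
      ext k
      rw [ContinuousLinearMap.flip_apply, connCLM_coordVec, connCLM_coordVec,
        h.christoffel_symm hy]
    conv_lhs => rw [this]
    rfl
  compat y hy u v w := by
    set g := metricCLM G y
    set Γ := connCLM G y
    have hsymm : ∀ i m, g (coordVec i) (coordVec m) = g (coordVec m) (coordVec i) := by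
      intro i m; simp only [g, metricCLM_coordVec, h.symm y hy i]
    have hs : g = g.flip := coord_ext fun i => coord_ext fun j => hsymm i j
    -- The identity is checked on coordinate vectors and freed one slot at a time in `h3`, `h2`,
    -- `h1`; `flip` puts the slot to be extended last.
    have h3 : ∀ j m, (((fderiv ℝ (metricCLM G) y).flip (coordVec j)).flip (coordVec m)
        : Coord n →L[ℝ] ℝ)
        = (g.flip (coordVec m)).comp (Γ.flip (coordVec j))
          + (g (coordVec j)).comp (Γ.flip (coordVec m)) := by
      intro j m
      refine coord_ext fun i => ?_
      have e : g (coordVec j) (Γ (coordVec i) (coordVec m))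
          = g (Γ (coordVec i) (coordVec m)) (coordVec j) := by
        conv_lhs => rw [hs]
        rfl
      simp only [ContinuousLinearMap.flip_apply, add_apply, ContinuousLinearMap.comp_apply, e]
      rw [h.fderiv_metricCLM hy, h.metricCLM_connCLM hy, h.metricCLM_connCLM hy,
        h.pd_symm hy i m j]
      ring
    have h2 : ∀ m, ((fderiv ℝ (metricCLM G) y u).flip (coordVec m) : Coord n →L[ℝ] ℝ)
        = (g.flip (coordVec m)).comp (Γ u) + g.flip (Γ u (coordVec m)) := by
      intro m
      refine coord_ext fun j => ?_
      have := congrArg (fun L => L u) (h3 j m)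
      simpa using this
    have h1 : (fderiv ℝ (metricCLM G) y u v : Coord n →L[ℝ] ℝ)
        = g (Γ u v) + (g v).comp (Γ u) := by
      refine coord_ext fun m => ?_
      have := congrArg (fun L => L v) (h2 m)
      simpa using this
    have := congrArg (fun L => L w) h1
    simpa using this

theorem isLeviCivita (h : IsMetricOn ∞ U G) : IsLeviCivita U (metricCLM G) (connCLM G) :=
  { h.isMetricConnection with
    smooth_metric := fun _ hy => h.contDiff_metricCLM hy
    smooth_connection := fun _ hy => h.contDiff_connCLM hy (by simp) }

theorem fderiv_connCLM (h : IsMetricOn k U G) {y : Coord n} (hy : y ∈ U) (i j k l : Fin n) :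
    fderiv ℝ (connCLM G) y (coordVec i) (coordVec j) (coordVec k) l
      = pd i (fun z => christoffel G z l j k) y := by
  have hg := h.differentiableAt_connCLM hy
  have h1 := hg.clm_apply (differentiableAt_const (coordVec j))
  have h2 := h1.clm_apply (differentiableAt_const (coordVec k))
  rw [← fderiv_apply_const hg, ← fderiv_apply_const h1]
  have := ((EuclideanSpace.proj l : Coord n →L[ℝ] ℝ).hasFDerivAt.comp y h2.hasFDerivAt).fderiv
  have e : (⇑(EuclideanSpace.proj l : Coord n →L[ℝ] ℝ) ∘
      fun z => connCLM G z (coordVec j) (coordVec k)) = fun z => christoffel G z l j k := by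
    funext z
    simp [connCLM_coordVec]
  rw [e] at this
  rw [pd, this]
  simp

theorem curvOp_coordVec (h : IsMetricOn k U G) {y : Coord n} (hy : y ∈ U) (i j k l : Fin n) :
    curvOp (connCLM G) y (coordVec i) (coordVec j) (coordVec k) l = curvUp G y l k i j := by
  have e : ∀ (i : Fin n) (v : Coord n), connCLM G y (coordVec i) v l
      = ∑ m, v m * christoffel G y l i m := by
    intro i v
    have := (connCLM G y (coordVec i)).toLinearMap.isLinear.eq_sum_coordVec v
    have := congrArg (fun w : Coord n => w l) this
    simpa [connCLM_coordVec] using this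
  simp only [curvOp, add_apply, sub_apply, mul_apply_eq_comp, PiLp.add_apply, PiLp.sub_apply,
    h.fderiv_connCLM hy, e, connCLM_coordVec, curvUp, Finset.sum_sub_distrib]
  congr 2 <;> exact Finset.sum_congr rfl fun m _ => by ring

/-- The curvature tensor. -/
theorem riem_eq (h : IsMetricOn k U G) {y : Coord n} (hy : y ∈ U) (i j k l : Fin n) :
    riem G y i j k l = metricCLM G y
      (curvOp (connCLM G) y (coordVec i) (coordVec j) (coordVec l)) (coordVec k) := by
  rw [h.isMetricConnection.symm y hy, metricCLM_apply, metricForm, riem]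
  simp [coordVec_apply, h.curvOp_coordVec hy]

theorem ricci_eq (h : IsMetricOn k U G) {y : Coord n} (hy : y ∈ U) (j l : Fin n) :
    ricci G y j l = coordTrace fun u => curvOp (connCLM G) y u (coordVec j) (coordVec l) := by
  rw [coordTrace_eq_sum (isLinearMap_curvOp_left y _ _), ricci]
  refine Finset.sum_congr rfl fun i _ => ?_
  simp only [riem]
  rw [h.sum_inv_mul hy i (fun m => curvUp G y m l i j), h.curvOp_coordVec hy]

theorem gradVec_spec (h : IsMetricOn k U G) {y : Coord n} (hy : y ∈ U) (f : Coord n → ℝ)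
    (v : Coord n) : metricCLM G y (gradVec G f y) v = fderiv ℝ f y v := by
  have : metricCLM G y (gradVec G f y) = fderiv ℝ f y := by
    refine coord_ext fun i => ?_
    rw [h.isMetricConnection.symm y hy, metricCLM_apply, metricForm]
    simp only [coordVec_apply, gradVec_apply]
    simp only [mul_ite, mul_one, mul_zero, ite_mul, zero_mul]
    rw [Finset.sum_comm]
    simp [h.sum_mul_inv hy, pd]
  rw [this]

theorem hess_eq (h : IsMetricOn ∞ U G) {y : Coord n} (hy : y ∈ U) {f : Coord n → ℝ}
    (hf : ∀ z ∈ U, ContDiffAt ℝ ∞ f z) (i j : Fin n) :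
    hess G f y i j = metricCLM G y (covVec (connCLM G) (gradVec G f) y (coordVec i))
      (coordVec j) := by
  have hV := differentiableAt_of_smooth (h.smooth_gradVec hy (hf y hy))
  have e := congrArg (fun L => L (coordVec i)) (fderiv_eq_of_eqOn h.isOpen
    (fun z hz => h.gradVec_spec hz f (coordVec j)) hy)
  rw [h.isMetricConnection.fderiv_metric hy hV (differentiableAt_const _), ← covVec_apply] at e
  simp only [fderiv_fun_const, Pi.zero_apply, zero_apply, zero_add, h.gradVec_spec hy] at e
  have e2 : fderiv ℝ f y (connCLM G y (coordVec i) (coordVec j))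
      = ∑ k, christoffel G y k i j * pd k f y := by
    rw [(fderiv ℝ f y).toLinearMap.isLinear.eq_sum_coordVec (φ := fun v => fderiv ℝ f y v)]
    simp [connCLM_coordVec, pd]
  rw [e2] at e
  have e3 : pd i (fun z => pd j f z) y = fderiv ℝ (fun z => fderiv ℝ f z (coordVec j)) y (coordVec i) :=
    rfl
  rw [hess, e3]
  linarith

end IsMetricOn

end Coordinates

/-! ### Contractions with the inverse metric as sums over an orthonormal frame. -/

section Contraction

variable {n : ℕ}

theorem bilinear_ext {φ ψ : Coord n → Coord n → ℝ} (h1 : ∀ w, IsLinearMap ℝ fun v => φ v w)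
    (h2 : ∀ v, IsLinearMap ℝ (φ v)) (k1 : ∀ w, IsLinearMap ℝ fun v => ψ v w)
    (k2 : ∀ v, IsLinearMap ℝ (ψ v)) (h : ∀ i j, φ (coordVec i) (coordVec j)
      = ψ (coordVec i) (coordVec j)) (v w : Coord n) : φ v w = ψ v w := by
  rw [(h1 w).eq_sum_coordVec v, (k1 w).eq_sum_coordVec v]
  refine Finset.sum_congr rfl fun i _ => ?_
  rw [(h2 _).eq_sum_coordVec w, (k2 _).eq_sum_coordVec w]
  simp [h]

theorem trilinear_eq_sum {φ : Coord n → Coord n → Coord n → ℝ}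
    (h1 : ∀ b c, IsLinearMap ℝ fun a => φ a b c) (h2 : ∀ a c, IsLinearMap ℝ fun b => φ a b c)
    (h3 : ∀ a b, IsLinearMap ℝ fun c => φ a b c) (a b c : Coord n) :
    φ a b c = ∑ i, ∑ j, ∑ k, φ (coordVec i) (coordVec j) (coordVec k) * (a i * (b j * c k)) := by
  rw [(h1 b c).eq_sum_coordVec a]
  refine Finset.sum_congr rfl fun i _ => ?_
  rw [(h2 _ c).eq_sum_coordVec b, Finset.smul_sum]
  refine Finset.sum_congr rfl fun j _ => ?_
  rw [(h3 _ _).eq_sum_coordVec c, Finset.smul_sum, Finset.smul_sum]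
  refine Finset.sum_congr rfl fun k _ => ?_
  simp only [smul_eq_mul]
  ring

theorem quadrilinear_eq_sum {φ : Coord n → Coord n → Coord n → Coord n → ℝ}
    (h1 : ∀ b c d, IsLinearMap ℝ fun a => φ a b c d)
    (h2 : ∀ a c d, IsLinearMap ℝ fun b => φ a b c d)
    (h3 : ∀ a b d, IsLinearMap ℝ fun c => φ a b c d)
    (h4 : ∀ a b c, IsLinearMap ℝ fun d => φ a b c d) (a b c d : Coord n) :
    φ a b c d = ∑ i, ∑ j, ∑ k, ∑ l, φ (coordVec i) (coordVec j) (coordVec k) (coordVec l)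
      * (a i * (b j * (c k * d l))) := by
  rw [(h1 b c d).eq_sum_coordVec a]
  refine Finset.sum_congr rfl fun i _ => ?_
  rw [trilinear_eq_sum (h2 _) (h3 _) (h4 _) b c d]
  simp only [smul_eq_mul, Finset.mul_sum]
  refine Finset.sum_congr rfl fun j _ => Finset.sum_congr rfl fun k _ =>
    Finset.sum_congr rfl fun l _ => ?_
  ring

/-- Contracting two copies of a tensor with a matrix of the form `K Kᵀ` gives the sum of the squares
of the contractions with `K`. -/
theorem sum_contract_sq {I J : Type*} [Fintype I] [Fintype J] {H : I → I → ℝ} {K : I → J → ℝ}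
    (hH : ∀ i a, H i a = ∑ p, K i p * K a p) (T : I → ℝ) :
    ∑ i, ∑ a, H i a * T i * T a = ∑ p, (∑ i, T i * K i p) ^ 2 := by
  have e : ∀ i a, H i a * T i * T a = ∑ p, T i * K i p * (T a * K a p) := by
    intro i a
    rw [hH, Finset.sum_mul, Finset.sum_mul]
    exact Finset.sum_congr rfl fun p _ => by ring
  simp only [e, sq, Finset.sum_mul_sum]
  exact (Finset.sum_congr rfl fun i _ => Finset.sum_comm).trans Finset.sum_comm

/-- Gram factorisations multiply, so tensor powers of the inverse metric factor and
`sum_contract_sq` applies to tensors of any rank. -/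
theorem gram_prod {I J I' J' : Type*} [Fintype J] [Fintype J'] {H : I → I → ℝ} {K : I → J → ℝ}
    {H' : I' → I' → ℝ} {K' : I' → J' → ℝ} (hH : ∀ i a, H i a = ∑ p, K i p * K a p)
    (hH' : ∀ i a, H' i a = ∑ p, K' i p * K' a p) (i a : I × I') :
    H i.1 a.1 * H' i.2 a.2
      = ∑ p : J × J', (K i.1 p.1 * K' i.2 p.2) * (K a.1 p.1 * K' a.2 p.2) := by
  rw [hH, hH', Finset.sum_mul_sum, Fintype.sum_prod_type]
  exact Finset.sum_congr rfl fun p _ => Finset.sum_congr rfl fun q _ => by ring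

variable {U : Set (Coord n)} {k : ℕ∞ω} {G : Coord n → Matrix (Fin n) (Fin n) ℝ} {ι : Type*} [Fintype ι]
  [DecidableEq ι] {b : ι → Coord n} {y : Coord n}

/-- The Ricci tensor of a connection. -/
def ricForm {E : Type*} [NormedAddCommGroup E] [NormedSpace ℝ E] [FiniteDimensional ℝ E]
    (Γ : E → E →L[ℝ] E →L[ℝ] E) (y v w : E) : ℝ :=
  coordTrace fun u => curvOp Γ y u v w

theorem isLinearMap_ricForm_left (Γ : Coord n → Coord n →L[ℝ] Coord n →L[ℝ] Coord n)
    (y w : Coord n) : IsLinearMap ℝ fun v => ricForm Γ y v w where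
  map_add v v' := by simp [ricForm, curvOp_add_right, coordTrace_add]
  map_smul c v := by simp [ricForm, curvOp_smul_right, coordTrace_smul]

theorem isLinearMap_ricForm_right (Γ : Coord n → Coord n →L[ℝ] Coord n →L[ℝ] Coord n)
    (y v : Coord n) : IsLinearMap ℝ fun w => ricForm Γ y v w where
  map_add w w' := by simp [ricForm, coordTrace_add]
  map_smul c w := by simp [ricForm, coordTrace_smul]

namespace IsMetricOn

/-- The completeness relation: expanding each coordinate vector in the frame shows that Σ bₐ bₐᵀ is
a right inverse of G. -/
theorem inv_eq_sum (hb : IsOrthoFrame (metricCLM G y) b)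
    (i j : Fin n) : (G y)⁻¹ i j = ∑ a, b a i * b a j := by
  have key : G y * Matrix.of (fun i j => ∑ a, b a i * b a j) = 1 := by
    ext i l
    have e := congrArg (fun v : Coord n => v l) (hb.expand (coordVec i))
    have e2 : ∀ v, metricCLM G y (coordVec i) v = ∑ j, G y i j * v j := by
      intro v
      have := (metricCLM G y (coordVec i)).toLinearMap.isLinear.eq_sum_coordVec v
      simpa [metricCLM_coordVec, mul_comm] using this
    simp only [WithLp.ofLp_sum, Finset.sum_apply, PiLp.smul_apply, smul_eq_mul, coordVec_apply,
      e2] at e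
    simp only [Matrix.mul_apply, Matrix.of_apply, Matrix.one_apply, Finset.mul_sum]
    rw [Finset.sum_comm, eq_comm]
    simp only [eq_comm (a := i) (b := l)]
    rw [e]
    exact Finset.sum_congr rfl fun a _ => by simp [Finset.sum_mul, mul_assoc]
  rw [Matrix.inv_eq_right_inv key, Matrix.of_apply]

theorem sum_inv_bilinear (hb : IsOrthoFrame (metricCLM G y) b)
    {φ : Coord n → Coord n → ℝ} (h1 : ∀ w, IsLinearMap ℝ fun v => φ v w)
    (h2 : ∀ v, IsLinearMap ℝ (φ v)) :
    ∑ i, ∑ j, (G y)⁻¹ i j * φ (coordVec i) (coordVec j) = ∑ a, φ (b a) (b a) := by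
  have e : ∀ a, φ (b a) (b a) = ∑ i, ∑ j, b a i * b a j * φ (coordVec i) (coordVec j) := by
    intro a
    rw [(h1 _).eq_sum_coordVec (b a)]
    refine Finset.sum_congr rfl fun i _ => ?_
    rw [(h2 _).eq_sum_coordVec (b a), Finset.smul_sum]
    exact Finset.sum_congr rfl fun j _ => by simp [mul_assoc]
  simp only [e, inv_eq_sum hb, Finset.sum_mul]
  rw [Finset.sum_comm (s := (Finset.univ : Finset ι))]
  exact Finset.sum_congr rfl fun i _ => Finset.sum_comm

theorem scal_eq (h : IsMetricOn k U G) (hy : y ∈ U) (hb : IsOrthoFrame (metricCLM G y) b) :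
    scal G y = ∑ a, ricForm (connCLM G) y (b a) (b a) := by
  rw [← sum_inv_bilinear hb (isLinearMap_ricForm_left _ y) (isLinearMap_ricForm_right _ y)]
  simp only [scal, h.ricci_eq hy, ricForm]

theorem isLocalShrinker (h : IsMetricOn ∞ U G) {f : Coord n → ℝ} {c : ℝ}
    (hf : ∀ y ∈ U, ContDiffAt ℝ ∞ f y)
    (hs : ∀ y ∈ U, ∀ i j, ricci G y i j + hess G f y i j = (1 / 2) * G y i j)
    (hR : ∀ y ∈ U, scal G y = c) :
    IsLocalShrinker U (metricCLM G) (connCLM G) f (gradVec G f) c := by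
  have hric : ∀ y ∈ U, ∀ v w, ricForm (connCLM G) y v w
      = metricCLM G y (ricEnd (connCLM G) (gradVec G f) y v) w := by
    intro y hy
    refine bilinear_ext (isLinearMap_ricForm_left _ y) (isLinearMap_ricForm_right _ y)
      (fun w => ⟨by simp, by simp⟩) (fun v => ⟨by simp, by simp⟩) fun i j => ?_
    have := hs y hy i j
    rw [h.hess_eq hy hf, h.ricci_eq hy] at this
    simp only [ricForm, ricEnd, sub_apply, smul_apply, ContinuousLinearMap.id_apply, map_sub,
      map_smul, smul_eq_mul, metricCLM_coordVec]
    linarith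
  exact
    { h.isLeviCivita with
      smooth_potential := hf
      smooth_gradient := fun y hy => h.smooth_gradVec hy (hf y hy)
      gradient := fun y hy v => h.gradVec_spec hy f v
      ricci_eq := hric
      scal_eq := fun y hy => by
        obtain ⟨b, hb⟩ := h.isLeviCivita.exists_orthoFrame hy
        rw [hb.trace_clm_eq, ← hR y hy, h.scal_eq hy hb]
        exact Finset.sum_congr rfl fun a _ => (hric y hy _ _).symm }

theorem ricci_eq_ricEnd (h : IsMetricOn ∞ U G) {f : Coord n → ℝ} {c : ℝ}
    (hs : IsLocalShrinker U (metricCLM G) (connCLM G) f (gradVec G f) c) (hy : y ∈ U)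
    (i j : Fin n) : ricci G y i j
      = metricCLM G y (ricEnd (connCLM G) (gradVec G f) y (coordVec i)) (coordVec j) := by
  rw [h.ricci_eq hy, hs.ricci_eq y hy]

theorem covRicci_eq (h : IsMetricOn ∞ U G) {f : Coord n → ℝ} {c : ℝ}
    (hs : IsLocalShrinker U (metricCLM G) (connCLM G) f (gradVec G f) c) (hy : y ∈ U)
    (k i j : Fin n) : covRicci G y k i j
      = metricCLM G y (covEnd (connCLM G) (ricEnd (connCLM G) (gradVec G f)) y (coordVec k)
        (coordVec i)) (coordVec j) := by
  set P := ricEnd (connCLM G) (gradVec G f)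
  have hP := differentiableAt_of_smooth (hs.smooth_ricEnd hy)
  have e := congrArg (fun L => L (coordVec k)) (fderiv_eq_of_eqOn h.isOpen
    (fun z hz => h.ricci_eq_ricEnd hs hz i j) hy)
  rw [h.isLeviCivita.fderiv_metric hy (hP.clm_apply (differentiableAt_const _))
    (differentiableAt_const _), fderiv_apply_const hP] at e
  have hG : connCLM G y (coordVec k) (coordVec i) = ∑ m, christoffel G y m k i • coordVec m := by
    rw [← sum_coordVec (connCLM G y (coordVec k) (coordVec i))]
    simp [connCLM_coordVec]
  have hG' : connCLM G y (coordVec k) (coordVec j) = ∑ m, christoffel G y m k j • coordVec m := by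
    rw [← sum_coordVec (connCLM G y (coordVec k) (coordVec j))]
    simp [connCLM_coordVec]
  have e1 : metricCLM G y (P y (connCLM G y (coordVec k) (coordVec i))) (coordVec j)
      = ∑ m, christoffel G y m k i * ricci G y m j := by
    rw [hG]
    simp [h.ricci_eq_ricEnd hs hy, P]
  have e2 : metricCLM G y (P y (coordVec i)) (connCLM G y (coordVec k) (coordVec j))
      = ∑ m, christoffel G y m k j * ricci G y i m := by
    rw [hG']
    simp [h.ricci_eq_ricEnd hs hy, P]
  rw [covRicci, pd, Finset.sum_add_distrib, ← e1, ← e2, covEnd_apply]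
  simp only [fderiv_fun_const, Pi.zero_apply, zero_apply, zero_add, map_add, map_sub, add_apply,
    sub_apply] at e ⊢
  linarith

/-- `|∇Ric|²` as a sum over an orthonormal frame. -/
theorem covRicciNormSq_eq (h : IsMetricOn ∞ U G) {f : Coord n → ℝ} {c : ℝ}
    (hs : IsLocalShrinker U (metricCLM G) (connCLM G) f (gradVec G f) c) (hy : y ∈ U)
    (hb : IsOrthoFrame (metricCLM G y) b) : covRicciNormSq G y
      = ∑ p, ∑ q, ∑ r, (metricCLM G y (covEnd (connCLM G) (ricEnd (connCLM G) (gradVec G f)) y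
        (b p) (b q)) (b r)) ^ 2 := by
  have hi := inv_eq_sum hb
  have e := sum_contract_sq (gram_prod hi (gram_prod hi hi))
    (fun k : Fin n × Fin n × Fin n => covRicci G y k.1 k.2.1 k.2.2)
  simp only [Fintype.sum_prod_type] at e
  have e1 : covRicciNormSq G y = _ := Eq.trans (by
    unfold covRicciNormSq
    refine Finset.sum_congr rfl fun k _ => Finset.sum_congr rfl fun i _ =>
      Finset.sum_congr rfl fun j _ => Finset.sum_congr rfl fun k' _ =>
      Finset.sum_congr rfl fun i' _ => Finset.sum_congr rfl fun j' _ => ?_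
    rw [← mul_assoc ((G y)⁻¹ k k')]) e
  rw [e1]
  refine Finset.sum_congr rfl fun p _ => Finset.sum_congr rfl fun q _ =>
    Finset.sum_congr rfl fun r _ => ?_
  congr 1
  rw [trilinear_eq_sum (φ := fun u v w => metricCLM G y (covEnd (connCLM G)
    (ricEnd (connCLM G) (gradVec G f)) y u v) w)
    (fun v w => ⟨by simp [covEnd_add], by simp [covEnd_smul]⟩) (fun u w => ⟨by simp, by simp⟩)
    (fun u v => ⟨by simp, by simp⟩)]
  simp only [h.covRicci_eq hs hy]

/-- The Weyl tensor as a multilinear form. -/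
def _root_.ShrinkerEstimate.weylForm (G : Coord n → Matrix (Fin n) (Fin n) ℝ)
    (y a b c d : Coord n) : ℝ :=
  metricCLM G y (curvOp (connCLM G) y a b d) c
    - 1 / ((n : ℝ) - 2) *
      (metricCLM G y a c * ricForm (connCLM G) y b d - metricCLM G y a d * ricForm (connCLM G) y b c
        - metricCLM G y b c * ricForm (connCLM G) y a d
        + metricCLM G y b d * ricForm (connCLM G) y a c)
    + scal G y / (((n : ℝ) - 1) * ((n : ℝ) - 2)) *
      (metricCLM G y a c * metricCLM G y b d - metricCLM G y a d * metricCLM G y b c)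

theorem weylForm_eq_sum (a b c d : Coord n) : weylForm G y a b c d
    = ∑ i, ∑ j, ∑ k, ∑ l, weylForm G y (coordVec i) (coordVec j) (coordVec k) (coordVec l)
      * (a i * (b j * (c k * d l))) := by
  have r1 := fun w => (isLinearMap_ricForm_left (connCLM G) y w).map_add
  have r2 := fun w => (isLinearMap_ricForm_left (connCLM G) y w).map_smul
  have r3 := fun w => (isLinearMap_ricForm_right (connCLM G) y w).map_add
  have r4 := fun w => (isLinearMap_ricForm_right (connCLM G) y w).map_smul
  refine quadrilinear_eq_sum (φ := fun a b c d => weylForm G y a b c d) ?_ ?_ ?_ ?_ a b c d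
  all_goals
    intro x y z
    refine ⟨fun v w => ?_, fun t v => ?_⟩
    · simp only [weylForm, curvOp_add_left, curvOp_add_right, map_add, add_apply, r1, r3]
      ring
    · simp only [weylForm, curvOp_smul_left, curvOp_smul_right, map_smul, smul_apply, r2, r4,
        smul_eq_mul]
      ring

/-- `|W|²` as a sum over an orthonormal frame. -/
theorem weylNormSq_eq (h : IsMetricOn k U G) (hy : y ∈ U) (hb : IsOrthoFrame (metricCLM G y) b) :
    weylNormSq G y = ∑ p, ∑ q, ∑ r, ∑ s, weylForm G y (b p) (b q) (b r) (b s) ^ 2 := by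
  have hi := inv_eq_sum hb
  have e := sum_contract_sq (gram_prod hi (gram_prod hi (gram_prod hi hi)))
    (fun k : Fin n × Fin n × Fin n × Fin n => weyl G y k.1 k.2.1 k.2.2.1 k.2.2.2)
  simp only [Fintype.sum_prod_type] at e
  have e1 : weylNormSq G y = _ := Eq.trans (by
    unfold weylNormSq
    refine Finset.sum_congr rfl fun k _ => Finset.sum_congr rfl fun i _ =>
      Finset.sum_congr rfl fun j _ => Finset.sum_congr rfl fun l _ =>
      Finset.sum_congr rfl fun k' _ => Finset.sum_congr rfl fun i' _ =>
      Finset.sum_congr rfl fun j' _ => Finset.sum_congr rfl fun l' _ => ?_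
    rw [← mul_assoc ((G y)⁻¹ i i'), ← mul_assoc ((G y)⁻¹ k k'), ← mul_assoc ((G y)⁻¹ k k')]) e
  rw [e1]
  refine Finset.sum_congr rfl fun p _ => Finset.sum_congr rfl fun q _ =>
    Finset.sum_congr rfl fun r _ => Finset.sum_congr rfl fun s _ => ?_
  congr 1
  rw [weylForm_eq_sum]
  simp only [weylForm, weyl, h.riem_eq hy, h.ricci_eq hy, ricForm, metricCLM_coordVec]

theorem sectional_eq (h : IsMetricOn k U G) (hy : y ∈ U) (v w : Coord n) :
    sectional G y v w = metricCLM G y (curvOp (connCLM G) y v w w) v /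
      (metricCLM G y v v * metricCLM G y w w - metricCLM G y v w ^ 2) := by
  rw [sectional, ← metricCLM_apply, ← metricCLM_apply, ← metricCLM_apply]
  congr 1
  rw [quadrilinear_eq_sum (φ := fun a b c d => metricCLM G y (curvOp (connCLM G) y a b d) c)
    (fun _ _ _ => ⟨by simp [curvOp_add_left], by simp [curvOp_smul_left]⟩)
    (fun _ _ _ => ⟨by simp [curvOp_add_right], by simp [curvOp_smul_right]⟩)
    (fun _ _ _ => ⟨by simp, by simp⟩) (fun _ _ _ => ⟨by simp, by simp⟩) v w v w]
  refine Finset.sum_congr rfl fun i _ => Finset.sum_congr rfl fun j _ =>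
    Finset.sum_congr rfl fun k _ => Finset.sum_congr rfl fun l _ => ?_
  rw [h.riem_eq hy]
  ring

end IsMetricOn

end Contraction

/-! ### Passage from the manifold to charts; the gradient of the potential. -/

section Manifold

theorem sum_inner_coordVec {n : ℕ} {T : Type*} [NormedAddCommGroup T] [InnerProductSpace ℝ T]
    {L : Coord n → T} (hL : IsLinearMap ℝ L) (v w : Coord n) :
    ∑ i, ∑ j, inner ℝ (L (coordVec i)) (L (coordVec j)) * v i * w j = inner ℝ (L v) (L w) := by
  rw [hL.eq_sum_coordVec v, hL.eq_sum_coordVec w]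
  simp only [sum_inner, inner_sum, real_inner_smul_left, real_inner_smul_right]
  rw [Finset.sum_comm]
  exact Finset.sum_congr rfl fun i _ => Finset.sum_congr rfl fun j _ => by
    rw [real_inner_comm]; ring

variable {M : Type*} [TopologicalSpace M] [ChartedSpace (Coord 5) M]

section Chart

variable [IsManifold (𝓡 5) ∞ M]

theorem contMDiffAt_chart_symm {φ : OpenPartialHomeomorph M (Coord 5)} (hφ : φ ∈ atlas (Coord 5) M)
    {y : Coord 5} (hy : y ∈ φ.target) : ContMDiffAt (𝓡 5) (𝓡 5) ∞ φ.symm y :=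
  (contMDiffOn_symm_of_mem_maximalAtlas (IsManifold.subset_maximalAtlas hφ)).contMDiffAt
    (φ.open_target.mem_nhds hy)

theorem contMDiffAt_chart {φ : OpenPartialHomeomorph M (Coord 5)} (hφ : φ ∈ atlas (Coord 5) M)
    {x : M} (hx : x ∈ φ.source) : ContMDiffAt (𝓡 5) (𝓡 5) ∞ φ x :=
  (contMDiffOn_of_mem_maximalAtlas (IsManifold.subset_maximalAtlas hφ)).contMDiffAt
    (φ.open_source.mem_nhds hx)

theorem chart_mdifferentiable {φ : OpenPartialHomeomorph M (Coord 5)}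
    (hφ : φ ∈ atlas (Coord 5) M) : φ.MDifferentiable (𝓡 5) (𝓡 5) := by
  have : IsManifold (𝓡 5) 1 M := IsManifold.of_le (n := ∞) (by simp)
  exact mdifferentiable_of_mem_atlas hφ

end Chart

variable [RiemannianBundle (fun x : M => TangentSpace (𝓡 5) x)] {n : ℕ}

theorem metricForm_pullbackMetric (Φ : Coord n → M) (u v w : Coord n) :
    metricForm (pullbackMetric Φ) u v w
      = inner ℝ (mfderiv (𝓡 n) (𝓡 5) Φ u v : TangentSpace (𝓡 5) (Φ u))
          (mfderiv (𝓡 n) (𝓡 5) Φ u w : TangentSpace (𝓡 5) (Φ u)) :=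
  sum_inner_coordVec (T := TangentSpace (𝓡 5) (Φ u))
    (L := fun v => (mfderiv (𝓡 n) (𝓡 5) Φ u v : TangentSpace (𝓡 5) (Φ u)))
    ⟨fun v w => (mfderiv (𝓡 n) (𝓡 5) Φ u).map_add v w,
      fun c v => (mfderiv (𝓡 n) (𝓡 5) Φ u).map_smul c v⟩ v w

variable [IsManifold (𝓡 5) ∞ M]
  [IsContMDiffRiemannianBundle (𝓡 5) ∞ (Coord 5) (fun x : M => TangentSpace (𝓡 5) x)]

/-- One derivative is lost in forming the sections dΦ(∂_a) along Φ; the fibrewise inner product is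
smooth. -/
theorem contDiffAt_pullbackMetric {Φ : Coord n → M} {u : Coord n}
    {m k : ℕ∞ω} (hm : m ≤ ∞) (hmk : m + 1 ≤ k) (hΦ : ContMDiffAt (𝓡 n) (𝓡 5) k Φ u)
    (a b : Fin n) : ContDiffAt ℝ m (fun z => pullbackMetric Φ z a b) u := by
  have : IsManifold (𝓡 5) 1 M := IsManifold.of_le (n := ∞) (by simp)
  have hsec : ∀ a : Fin n, ContMDiffAt (𝓡 n) ((𝓡 5).prod 𝓘(ℝ, Coord 5)) m
      (fun z => (TotalSpace.mk' (Coord 5) (Φ z) (mfderiv (𝓡 n) (𝓡 5) Φ z (coordVec a)) :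
        TangentBundle (𝓡 5) M)) u := by
    intro a
    exact ContMDiffAt.clm_apply_of_inCoordinates (hΦ.mfderiv_const hmk)
      (contMDiffAt_vectorSpace_iff_contDiffAt.2 contDiffAt_const) (hΦ.of_le (le_self_add.trans hmk))
  have : IsContMDiffRiemannianBundle (𝓡 5) m (Coord 5) (fun x : M => TangentSpace (𝓡 5) x) :=
    IsContMDiffRiemannianBundle.of_le hm
  exact ((hsec a).inner_bundle (hsec b)).contDiffAt

theorem isMetricOn_pullbackMetric {Φ : Coord n → M} {U : Set (Coord n)} (hU : IsOpen U)
    {m k : ℕ∞ω} (h2 : 2 ≤ m) (hm : m ≤ ∞) (hmk : m + 1 ≤ k)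
    (hΦ : ∀ u ∈ U, ContMDiffAt (𝓡 n) (𝓡 5) k Φ u)
    (hi : ∀ u ∈ U, Function.Injective (mfderiv (𝓡 n) (𝓡 5) Φ u)) :
    IsMetricOn m U (pullbackMetric Φ) where
  two_le := h2
  isOpen := hU
  contDiff u hu i j := contDiffAt_pullbackMetric hm hmk (hΦ u hu) i j
  symm u _ i j := by
    simp only [pullbackMetric, Matrix.of_apply]
    exact real_inner_comm _ _
  pos u hu v hv := by
    rw [metricForm_pullbackMetric]
    refine real_inner_self_pos.2 fun h0 => hv (hi u hu ?_)
    rw [h0]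
    exact ((mfderiv (𝓡 n) (𝓡 5) Φ u).map_zero).symm

theorem isMetricOn_chartMetric {φ : OpenPartialHomeomorph M (Coord 5)}
    (hφ : φ ∈ atlas (Coord 5) M) : IsMetricOn ∞ φ.target (chartMetric φ) :=
  isMetricOn_pullbackMetric φ.open_target (WithTop.coe_le_coe.2 le_top) le_rfl (by simp)
    (fun _ hy => contMDiffAt_chart_symm hφ hy)
    (fun _ hy => (chart_mdifferentiable hφ).symm.mfderiv_injective hy)

/-- The soliton structure in a chart. -/
theorem isLocalShrinker_chart {f : M → ℝ} {c : ℝ} (hf : IsShrinkerPotential f)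
    (hR : HasConstantScalarCurvature M c) {φ : OpenPartialHomeomorph M (Coord 5)}
    (hφ : φ ∈ atlas (Coord 5) M) :
    IsLocalShrinker φ.target (metricCLM (chartMetric φ)) (connCLM (chartMetric φ)) (f ∘ φ.symm)
      (gradVec (chartMetric φ) (f ∘ φ.symm)) c :=
  (isMetricOn_chartMetric hφ).isLocalShrinker
    (fun y hy => ((hf.1.contMDiffAt).comp y (contMDiffAt_chart_symm hφ hy)).contDiffAt)
    (hf.2 φ hφ) (hR φ hφ)

/-- In a chart, the gradient represents the differential on the tangent spaces of `M`. -/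
theorem inner_mfderiv_gradVec {f : M → ℝ} (hf : ContMDiff (𝓡 5) 𝓘(ℝ, ℝ) ∞ f)
    {φ : OpenPartialHomeomorph M (Coord 5)} (hφ : φ ∈ atlas (Coord 5) M) {y : Coord 5}
    (hy : y ∈ φ.target) (w : TangentSpace (𝓡 5) (φ.symm y)) :
    inner ℝ (mfderiv (𝓡 5) (𝓡 5) φ.symm y (gradVec (chartMetric φ) (f ∘ φ.symm) y) :
      TangentSpace (𝓡 5) (φ.symm y)) w = mfderiv (𝓡 5) 𝓘(ℝ, ℝ) f (φ.symm y) w := by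
  obtain ⟨v, rfl⟩ := (chart_mdifferentiable hφ).symm.mfderiv_surjective hy w
  have e := (isMetricOn_chartMetric hφ).gradVec_spec hy (f ∘ φ.symm) v
  have e' := (metricCLM_apply y _ (v : Coord 5)).symm.trans e
  refine ((metricForm_pullbackMetric φ.symm y _ v).symm.trans e').trans ?_
  rw [← mfderiv_eq_fderiv, mfderiv_comp y (hf.mdifferentiableAt (by simp))
    ((contMDiffAt_chart_symm hφ hy).mdifferentiableAt (by simp))]
  rfl

/-- The squared norm of the gradient of `f` at `x`. -/
def gradNormSq (f : M → ℝ) (x : M) : ℝ :=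
  metricForm (chartMetric (chartAt (Coord 5) x)) (chartAt (Coord 5) x x)
    (gradVec (chartMetric (chartAt (Coord 5) x)) (f ∘ (chartAt (Coord 5) x).symm)
      (chartAt (Coord 5) x x))
    (gradVec (chartMetric (chartAt (Coord 5) x)) (f ∘ (chartAt (Coord 5) x).symm)
      (chartAt (Coord 5) x x))

theorem inner_eq_of_represents {T : Type*} [NormedAddCommGroup T] [InnerProductSpace ℝ T]
    {Z Z' : T} (h : ∀ w, inner ℝ Z w = inner ℝ Z' w) : inner ℝ Z Z = inner ℝ Z' Z' := by
  have : Z = Z' := ext_inner_right ℝ h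
  rw [this]

/-- In every chart the gradient represents df on the tangent space of M, and a representing vector
is unique, so its length is independent of the chart. -/
theorem gradNormSq_eq {f : M → ℝ} (hf : ContMDiff (𝓡 5) 𝓘(ℝ, ℝ) ∞ f)
    {φ : OpenPartialHomeomorph M (Coord 5)} (hφ : φ ∈ atlas (Coord 5) M) {x : M}
    (hx : x ∈ φ.source) : gradNormSq f x = metricCLM (chartMetric φ) (φ x)
      (gradVec (chartMetric φ) (f ∘ φ.symm) (φ x)) (gradVec (chartMetric φ) (f ∘ φ.symm) (φ x)) := by
  have key : ∀ φ ∈ atlas (Coord 5) M, x ∈ φ.source → ∃ Z : TangentSpace (𝓡 5) x,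
      (∀ w : TangentSpace (𝓡 5) x, inner ℝ Z w = mfderiv (𝓡 5) 𝓘(ℝ, ℝ) f x w) ∧
      inner ℝ Z Z = metricForm (chartMetric φ) (φ x)
        (gradVec (chartMetric φ) (f ∘ φ.symm) (φ x))
        (gradVec (chartMetric φ) (f ∘ φ.symm) (φ x)) := by
    intro φ hφ hx
    obtain ⟨y, hy, rfl⟩ : ∃ y ∈ φ.target, φ.symm y = x := ⟨φ x, φ.map_source hx, φ.left_inv hx⟩
    rw [φ.right_inv hy]
    exact ⟨_, inner_mfderiv_gradVec hf hφ hy, (metricForm_pullbackMetric φ.symm y _ _).symm⟩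
  obtain ⟨Z, hZ, e⟩ := key φ hφ hx
  obtain ⟨Z', hZ', e'⟩ := key _ (chart_mem_atlas (Coord 5) x) (mem_chart_source _ x)
  rw [metricCLM_apply, ← e, gradNormSq, ← e']
  exact inner_eq_of_represents fun w => by rw [hZ, hZ']

/-- On a connected shrinker with constant scalar curvature, `|∇f|² - f` is constant. -/
theorem exists_gradNormSq_eq [PreconnectedSpace M] [Nonempty M] {f : M → ℝ} {c : ℝ}
    (hf : IsShrinkerPotential f) (hR : HasConstantScalarCurvature M c) :
    ∃ a : ℝ, ∀ x, gradNormSq f x = f x + a := by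
  have hloc : IsLocallyConstant fun x => gradNormSq f x - f x := by
    rw [IsLocallyConstant.iff_exists_open]
    intro x
    set φ := chartAt (Coord 5) x
    have hφ : φ ∈ atlas (Coord 5) M := chart_mem_atlas _ x
    have hx : x ∈ φ.source := mem_chart_source _ x
    have h := isLocalShrinker_chart hf hR hφ
    obtain ⟨r, hr, hball⟩ := Metric.isOpen_iff.1 φ.open_target (φ x) (φ.map_source hx)
    refine ⟨φ.source ∩ φ ⁻¹' Metric.ball (φ x) r, φ.isOpen_inter_preimage Metric.isOpen_ball,
      ⟨hx, Metric.mem_ball_self hr⟩, fun z hz => ?_⟩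
    set q := fun y => metricCLM (chartMetric φ) y (gradVec (chartMetric φ) (f ∘ φ.symm) y)
      (gradVec (chartMetric φ) (f ∘ φ.symm) y) - (f ∘ φ.symm) y
    have hq : ∀ y ∈ Metric.ball (φ x) r, HasFDerivAt q (0 : Coord 5 →L[ℝ] ℝ) y := by
      intro y hy
      have hV := differentiableAt_of_smooth (h.smooth_gradient y (hball hy))
      rw [← h.fderiv_gradient_sq (hball hy)]
      exact ((((h.differentiable_metric y (hball hy)).clm_apply hV).clm_apply hV).fun_sub
        (differentiableAt_of_smooth (h.smooth_potential y (hball hy)))).hasFDerivAt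
    -- By `fderiv_gradient_sq` the derivative of |∇f|² - f vanishes; a ball in the chart is convex,
    -- so the function is constant on it, and connectedness of M does the rest.
    have e := (convex_ball (φ x) r).is_const_of_fderivWithin_eq_zero (𝕜 := ℝ) (f := q)
      (fun y hy => (hq y hy).differentiableAt.differentiableWithinAt)
      (fun y hy => ((hq y hy).hasFDerivWithinAt).fderivWithin
        (Metric.isOpen_ball.uniqueDiffWithinAt hy)) hz.2 (Metric.mem_ball_self hr)
    have e2 : ∀ z ∈ φ.source, gradNormSq f z - f z = q (φ z) := by
      intro z hz
      rw [gradNormSq_eq hf.1 hφ hz]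
      simp [q, φ.left_inv hz]
    rw [e2 z hz.1, e2 x hx, e]
  obtain ⟨x₀⟩ := ‹Nonempty M›
  refine ⟨gradNormSq f x₀ - f x₀, fun x => ?_⟩
  have := hloc.apply_eq_of_isPreconnected isPreconnected_univ (Set.mem_univ x) (Set.mem_univ x₀)
  linarith

end Manifold

/-! ### Parametrized level sets read in a chart. -/

section Hypersurface

variable {M : Type*} [TopologicalSpace M] [ChartedSpace (Coord 5) M] [IsManifold (𝓡 5) ∞ M]

/-- Around the base point, a parametrization of a hypersurface is an immersion. -/
theorem IsHypersurfaceParam.exists_immersion {S : Set M} {x : M} {ψ : Coord 4 → M} {u : Coord 4}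
    (h : IsHypersurfaceParam S x ψ u) {φ : OpenPartialHomeomorph M (Coord 5)}
    (hφ : φ ∈ atlas (Coord 5) M) (hx : x ∈ φ.source) :
    ∃ U' : Set (Coord 4), IsOpen U' ∧ u ∈ U' ∧ ∀ v ∈ U', ContMDiffAt (𝓡 4) (𝓡 5) 3 ψ v ∧
      Function.Injective (mfderiv (𝓡 4) (𝓡 5) ψ v) ∧ ψ v ∈ φ.source ∧ ψ v ∈ S := by
  have i3 : IsManifold (𝓡 5) 3 M := IsManifold.of_le (n := ∞) (WithTop.coe_le_coe.2 le_top)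
  -- Smoothness at the single point u yields each finite order of differentiability on some
  -- neighbourhood, possibly depending on the order. Order 3 is enough: the induced metric is then
  -- C² and its connection C¹, as the Gauss equation requires.
  have h3 : ContMDiffAt (𝓡 4) (𝓡 5) 3 ψ u := h.smooth.of_le (WithTop.coe_le_coe.2 le_top)
  have e3 := (contMDiffAt_iff_contMDiffAt_nhds (by simp)).1 h3
  have hs : ∀ᶠ v in 𝓝 u, ψ v ∈ φ.source :=
    h3.continuousAt.eventually (φ.open_source.mem_nhds (by rwa [h.base]))
  have hx' : ψ u ∈ φ.source := by rwa [h.base]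
  have hd : ∀ {v}, ContMDiffAt (𝓡 4) (𝓡 5) 3 ψ v → ψ v ∈ φ.source →
      (fderiv ℝ (φ ∘ ψ) v : Coord 4 → Coord 5)
        = mfderiv (𝓡 5) (𝓡 5) φ (ψ v) ∘ mfderiv (𝓡 4) (𝓡 5) ψ v := by
    intro v h1 h2
    rw [← mfderiv_eq_fderiv, mfderiv_comp v
      ((contMDiffAt_chart hφ h2).mdifferentiableAt (by simp)) (h1.mdifferentiableAt (by simp))]
    rfl
  have hinj : Function.Injective (fderiv ℝ (φ ∘ ψ) u : Coord 4 → Coord 5) := by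
    rw [hd h3 hx']
    exact ((chart_mdifferentiable hφ).mfderiv_injective hx').comp h.immersion
  have hγ : ContDiffAt ℝ 3 (φ ∘ ψ) u :=
    (((contMDiffAt_chart hφ hx').of_le (WithTop.coe_le_coe.2 le_top)).comp u h3).contDiffAt
  have hc : ContinuousAt (fderiv ℝ (φ ∘ ψ)) u :=
    (hγ.fderiv_right (m := 2) (by norm_num)).continuousAt
  -- Injectivity is an open condition on linear maps, so the immersion property spreads from u to
  -- nearby points.
  have e4 := hc.eventually (ContinuousLinearMap.isOpen_injective.mem_nhds hinj)
  obtain ⟨U', hU', ho, hu⟩ := eventually_nhds_iff.1 (e3.and (hs.and (e4.and h.mem)))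
  refine ⟨U', ho, hu, fun v hv => ?_⟩
  obtain ⟨h1, h2, h4, h5⟩ := hU' v hv
  refine ⟨h1, ?_, h2, h5⟩
  have h4' : Function.Injective (fderiv ℝ (φ ∘ ψ) v : Coord 4 → Coord 5) := h4
  rw [hd h1 h2] at h4'
  exact h4'.of_comp

variable [RiemannianBundle (fun x : M => TangentSpace (𝓡 5) x)]

/-- A parametrized hypersurface is isometrically immersed in a chart. -/
theorem isIsometricImmersion_chart {φ : OpenPartialHomeomorph M (Coord 5)}
    (hφ : φ ∈ atlas (Coord 5) M) {ψ : Coord 4 → M} {U' : Set (Coord 4)}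
    (h : ∀ v ∈ U', ContMDiffAt (𝓡 4) (𝓡 5) 3 ψ v ∧ ψ v ∈ φ.source) :
    IsIsometricImmersion φ.target (metricCLM (chartMetric φ)) U' (metricCLM (pullbackMetric ψ))
      (φ ∘ ψ) where
  contDiff v hv := (((contMDiffAt_chart hφ (h v hv).2).of_le
    (WithTop.coe_le_coe.2 le_top)).comp v (h v hv).1).contDiffAt
  mapsTo v hv := φ.map_source (h v hv).2
  metric_eq v hv a b := by
    have hs := (h v hv).2
    have h1 : MDifferentiableAt (𝓡 4) (𝓡 5) ψ v := (h v hv).1.mdifferentiableAt (by simp)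
    have hγ : ∀ a : Coord 4, fderiv ℝ (φ ∘ ψ) v a
        = mfderiv (𝓡 5) (𝓡 5) φ (ψ v) (mfderiv (𝓡 4) (𝓡 5) ψ v a) := by
      intro a
      rw [← mfderiv_eq_fderiv, mfderiv_comp v
        ((contMDiffAt_chart hφ hs).mdifferentiableAt (by simp)) h1]
      rfl
    rw [metricCLM_apply, metricCLM_apply, metricForm_pullbackMetric, chartMetric,
      metricForm_pullbackMetric, hγ, hγ]
    have key : ∀ w : TangentSpace (𝓡 5) (ψ v), mfderiv (𝓡 5) (𝓡 5) φ.symm (φ (ψ v))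
        (mfderiv (𝓡 5) (𝓡 5) φ (ψ v) w) = w := fun w =>
      congrArg (fun L => L w) ((chart_mdifferentiable hφ).symm_comp_deriv hs)
    -- The base points φ⁻¹(φ(ψ v)) and ψ v are only propositionally equal; comparing vectors in the
    -- common model space lets the inner product be transported.
    have hb : ∀ (z : M) (_ : z = ψ v) (p q : TangentSpace (𝓡 5) z)
        (p' q' : TangentSpace (𝓡 5) (ψ v)), @Eq (Coord 5) p p' → @Eq (Coord 5) q q' →
        (inner ℝ p q : ℝ) = inner ℝ p' q' := by
      rintro z rfl p q p' q' hp hq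
      have hp' : p = p' := hp
      have hq' : q = q' := hq
      rw [hp', hq']
    exact (hb _ (φ.left_inv hs) _ _ _ _ (key _) (key _)).symm

end Hypersurface

/-! ### The algebraic estimate at a point. -/

section Estimate

/-- The contribution of one of the three large eigenvalues `1 / 2 + x`. -/
theorem eigenvalue_term_le {d x s r a q : ℝ} (hd' : d ≤ 3 / 8) (hx : x ^ 2 ≤ d) (hs : 0 ≤ s)
    (hs' : s ≤ 1) (hr : r = s ^ 2) (hq : |x * a| ≤ q) :
    -4 * r * (x * (1 / 2 + x) ^ 2 * (1 / 2 - x)) - (x - 2 * x ^ 2) * (r * ((1 / 2 + x) * -x) + s * a)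
      - 2 * x ^ 3 ≤ -(r * x) / 2 + 5 * d + 3 * q := by
  have hr0 : 0 ≤ r := hr ▸ sq_nonneg s
  have hr1 : r ≤ 1 := by rw [hr]; nlinarith
  -- Here x² ≤ d ≤ 3/8 < (5/8)².
  obtain ⟨hx1, hx2⟩ : -(5 / 8) ≤ x ∧ x ≤ 5 / 8 :=
    abs_le.1 (abs_le_of_sq_le_sq (by linarith) (by norm_num))
  -- The part of the term that contains ∇Ric. Of the rest, -(r x)/2 is the only part linear in x and
  -- is kept exact, since x alone is merely O(√d).
  have e1 : -(s * (1 - 2 * x) * (x * a)) ≤ 3 * q := by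
    have h1 : |s * (1 - 2 * x)| ≤ 3 := by
      rw [abs_le]; constructor <;> nlinarith
    calc -(s * (1 - 2 * x) * (x * a)) ≤ |s * (1 - 2 * x) * (x * a)| := neg_le_abs _
      _ = |s * (1 - 2 * x)| * |x * a| := abs_mul _ _
      _ ≤ 3 * q := mul_le_mul h1 hq (abs_nonneg _) (by norm_num)
  have e2 : (r * (-1 / 2 + 2 * x + 2 * x ^ 2) - 2 * x) * x ^ 2 ≤ 5 * x ^ 2 := by
    refine mul_le_mul_of_nonneg_right ?_ (sq_nonneg x)
    have : -1 / 2 + 2 * x + 2 * x ^ 2 ≤ 2 := by nlinarith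
    nlinarith
  nlinarith

theorem small_eigenvalue_term_nonneg {d : ℝ} (hd' : d ≤ 3 / 8) :
    0 ≤ d ^ 2 * (1 / 2 - d) * (1 - d) :=
  mul_nonneg (mul_nonneg (sq_nonneg d) (by linarith)) (by linarith)

theorem small_eigenvalue_term_le {d : ℝ} (hd : 0 ≤ d) (hd' : d ≤ 3 / 8) :
    d ^ 2 * (1 / 2 - d) * (1 - d) ≤ d := by
  have h1 : (1 / 2 - d) * (1 - d) ≤ 1 := by nlinarith
  have h2 : d * ((1 / 2 - d) * (1 - d)) ≤ 1 :=
    mul_le_one₀ (by linarith) (mul_nonneg (by linarith) (by linarith)) h1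
  nlinarith

theorem cubic_le {d : ℝ} (hd : 0 ≤ d) (hd' : d ≤ 3 / 8) :
    -2 * d ^ 3 - 3 / 2 * d + 3 * d ^ 2 ≤ d := by
  have := pow_nonneg hd 3
  nlinarith

/-- The relation `ha` controls a₀ by the products xᵢaᵢ; dividing by 1/2 - d ≥ 1/8 turns the bound 3q
into 24q. -/
theorem abs_normal_curvature_le {d x y z s r k₀ a₀ a₁ a₂ a₃ q : ℝ} (hd : 0 ≤ d) (hd' : d ≤ 3 / 8)
    (hs : 0 ≤ s) (hs' : s ≤ 1) (hr : r = s ^ 2) (hk₀ : k₀ = r * (d * (1 / 2 - d)) + s * a₀)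
    (ha : (1 / 2 - d) * a₀ = x * a₁ + y * a₂ + z * a₃)
    (h1 : |x * a₁| ≤ q) (h2 : |y * a₂| ≤ q) (h3 : |z * a₃| ≤ q) : |k₀| ≤ d / 2 + 24 * q := by
  have hr0 : 0 ≤ r := hr ▸ sq_nonneg s
  have hr1 : r ≤ 1 := hr ▸ pow_le_one₀ hs hs'
  have e : |(1 / 2 - d) * a₀| ≤ q + q + q := by
    rw [ha]
    exact (abs_add_three _ _ _).trans (by linarith)
  rw [abs_mul, abs_of_nonneg (by linarith : (0 : ℝ) ≤ 1 / 2 - d)] at e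
  have e0 : |a₀| ≤ 24 * q := by nlinarith [abs_nonneg a₀]
  have e1 : |s * a₀| ≤ 24 * q := by
    rw [abs_mul, abs_of_nonneg hs]
    exact (mul_le_of_le_one_left (abs_nonneg _) hs').trans e0
  have e2 : |r * (d * (1 / 2 - d))| ≤ d / 2 := by
    rw [abs_of_nonneg (mul_nonneg hr0 (mul_nonneg hd (by linarith)))]
    exact (mul_le_of_le_one_left (mul_nonneg hd (by linarith)) hr1).trans
      (by linarith [sq_nonneg d])
  rw [hk₀]
  exact (abs_add_le _ _).trans (by linarith)

/-- The factor (v - w) is O(√d), so X Y ≤ X² + Y²/4 with Y² ≤ 8d. -/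
theorem weyl_term_le {d ε X p v w : ℝ} (hd : 0 ≤ d) (hd' : d ≤ 3 / 8) (hX : X ^ 2 ≤ ε)
    (hp : p ^ 2 ≤ d) (hv : v ^ 2 ≤ d) (hw : w ^ 2 ≤ d) :
    X * ((d - 1 / 2 - p) * (v - w)) ≤ ε + 2 * d := by
  have h1 : (d - 1 / 2 - p) ^ 2 ≤ 2 := by
    obtain ⟨h1, h2⟩ := abs_le.1 (abs_le_of_sq_le_sq (a := p) (b := 5 / 8) (by linarith)
      (by norm_num))
    have := sq_le_sq' (a := d - 1 / 2 - p) (b := 9 / 8) (by linarith) (by linarith)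
    linarith
  have h2 : (v - w) ^ 2 ≤ 4 * d := by
    linarith [sq_nonneg (v + w), show (v + w) ^ 2 + (v - w) ^ 2 = 2 * v ^ 2 + 2 * w ^ 2 by ring]
  have h3 : ((d - 1 / 2 - p) * (v - w)) ^ 2 ≤ 2 * (4 * d) := by
    rw [mul_pow]
    exact mul_le_mul h1 h2 (sq_nonneg _) (by norm_num)
  generalize (d - 1 / 2 - p) * (v - w) = Y at h3 ⊢
  linarith [sq_nonneg (2 * X - Y), show (2 * X - Y) ^ 2 = 4 * X ^ 2 - 4 * (X * Y) + Y ^ 2 by ring]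

/-- Absorption in two rounds, since k must keep coefficient one. With k estimated as well, q ≤ √(dN)
gives N = O(d + ε). This makes q itself O(d + ε), and it is inserted in the bound where k was left
untouched. -/
theorem estimate_of_terms {d q ε N k T₁ T₂ D₁ D₂ D₃ E₁ E₂ E₃ p₁ p₂ p₃ : ℝ} (hd : 0 ≤ d)
    (hN₀ : 0 ≤ N) (hq : 0 ≤ q) (hqN : q ^ 2 ≤ d * N) (hk : |k| ≤ d / 2 + 24 * q)
    (t1 : T₁ ≤ ε + 2 * d) (t2 : T₂ ≤ ε + 2 * d) (t3 : D₁ ≤ d) (t4 : |D₂| ≤ 2)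
    (t5 : E₁ ≤ -p₁ / 2 + 5 * d + 3 * q) (t6 : E₂ ≤ -p₂ / 2 + 5 * d + 3 * q)
    (t7 : E₃ ≤ -p₃ / 2 + 5 * d + 3 * q) (t8 : -p₁ - p₂ - p₃ ≤ d) (t9 : D₃ ≤ d) (hε : 0 ≤ ε)
    (hN : N = k + 4 * (T₁ + T₂) + 4 * D₁ - D₂ * k + E₁ + E₂ + E₃ + D₃) :
    N ≤ k + 300000 * (d + ε) := by
  have t4' : -(D₂ * k) ≤ 2 * |k| := by
    refine (neg_le_abs _).trans ?_
    rw [abs_mul]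
    exact mul_le_mul_of_nonneg_right t4 (abs_nonneg _)
  have m1 : N ≤ k + 8 * ε + 60 * d + 60 * q := by linarith
  have m2 : N ≤ 8 * ε + 61 * d + 84 * q := by linarith [le_abs_self k]
  -- The arithmetic-geometric mean inequality: 84² = 4 · (1/2) · 3528.
  have m3 : 84 * q ≤ N / 2 + 3528 * d := by
    refine le_of_abs_le (abs_le_of_sq_le_sq ?_ (by linarith))
    linarith [sq_nonneg (N / 2 - 3528 * d)]
  have m4 : q ≤ (N + d) / 2 := by
    refine le_of_abs_le (abs_le_of_sq_le_sq ?_ (by linarith))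
    linarith [sq_nonneg (N - d)]
  linarith

theorem estimate_of_parts {d x y z s r k₀ a₀ a₁ a₂ a₃ A B q ε N : ℝ} (hd : 0 ≤ d) (hd' : d ≤ 3 / 8)
    (hsum : x + y + z = -d) (hsq : x ^ 2 + y ^ 2 + z ^ 2 = d - d ^ 2) (hs : 0 ≤ s) (hs' : s ≤ 1)
    (hr : r = s ^ 2) (hk₀ : k₀ = r * (d * (1 / 2 - d)) + s * a₀)
    (ha : (1 / 2 - d) * a₀ = x * a₁ + y * a₂ + z * a₃)
    (h1 : |x * a₁| ≤ q) (h2 : |y * a₂| ≤ q) (h3 : |z * a₃| ≤ q) (hA : A ^ 2 ≤ ε) (hB : B ^ 2 ≤ ε)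
    (hqN : q ^ 2 ≤ d * N) (hN₀ : 0 ≤ N)
    (hN : N = k₀ + 4 * (A * ((d - 1 / 2 - y) * (x - z)) + B * ((d - 1 / 2 - x) * (y - z)))
      + 4 * (r * (d ^ 2 * (1 / 2 - d) * (1 - d))) - 2 * d * (3 / 2 - d) * k₀
      + (-4 * r * (x * (1 / 2 + x) ^ 2 * (1 / 2 - x))
        - (x - 2 * x ^ 2) * (r * ((1 / 2 + x) * -x) + s * a₁) - 2 * x ^ 3)
      + (-4 * r * (y * (1 / 2 + y) ^ 2 * (1 / 2 - y))
        - (y - 2 * y ^ 2) * (r * ((1 / 2 + y) * -y) + s * a₂) - 2 * y ^ 3)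
      + (-4 * r * (z * (1 / 2 + z) ^ 2 * (1 / 2 - z))
        - (z - 2 * z ^ 2) * (r * ((1 / 2 + z) * -z) + s * a₃) - 2 * z ^ 3)
      + (-2 * d ^ 3 - 3 / 2 * d + 3 * d ^ 2)) :
    N ≤ k₀ + 300000 * (d + ε) := by
  have hx : x ^ 2 ≤ d := by linarith [sq_nonneg y, sq_nonneg z, sq_nonneg d]
  have hy : y ^ 2 ≤ d := by linarith [sq_nonneg x, sq_nonneg z, sq_nonneg d]
  have hz : z ^ 2 ≤ d := by linarith [sq_nonneg x, sq_nonneg y, sq_nonneg d]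
  refine estimate_of_terms hd hN₀ ((abs_nonneg _).trans h1) hqN
    (abs_normal_curvature_le hd hd' hs hs' hr hk₀ ha h1 h2 h3)
    (weyl_term_le hd hd' hA hy hx hz) (weyl_term_le hd hd' hB hx hy hz)
    ((mul_le_of_le_one_left (small_eigenvalue_term_nonneg hd') (hr ▸ pow_le_one₀ hs hs')).trans
      (small_eigenvalue_term_le hd hd')) ?_
    (eigenvalue_term_le hd' hx hs hs' hr h1) (eigenvalue_term_le hd' hy hs hs' hr h2)
    (eigenvalue_term_le hd' hz hs hs' hr h3) ?_ (cubic_le hd hd') ((sq_nonneg A).trans hA) hN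
  · rw [abs_of_nonneg (mul_nonneg (by linarith) (by linarith))]
    linarith [sq_nonneg d]
  · have e : -(r * x) - r * y - r * z = r * d := by linear_combination -r * hsum
    rw [e]
    exact mul_le_of_le_one_left hd (hr ▸ pow_le_one₀ hs hs')

/-- The estimate, in terms of the sectional curvatures `K i j` of the planes tangent to the level
set, `k i` of the planes that contain the gradient, and the components `a i` of `∇Ric`. -/
theorem frame_estimate {l k a ρ : Fin 4 → ℝ} {K W : Fin 4 → Fin 4 → ℝ} {N s ε : ℝ}
    (hl₀ : 0 ≤ l 0) (hl : ∀ i, l 0 ≤ l i) (hsum : ∑ i, l i = 3 / 2) (hsq : ∑ i, l i ^ 2 = 3 / 4)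
    (hs : 0 < s) (hs' : s ≤ 1) (hK : ∀ i j, K i j = K j i) (hK' : ∀ i, K i i = 0)
    (hric : ∀ i, ∑ j, K i j + k i = l i) (hk : ∑ i, k i = 0)
    (hka : ∀ i, k i = s ^ 2 * (l i * (1 / 2 - l i)) + s * a i) (hla : ∑ i, l i * a i = 0)
    (haN : ∀ i, a i ^ 2 ≤ N) (hN : N = 2 * ∑ i, ∑ j, K i j * l i * l j - 3 / 4)
    (hρ : ∀ i, ρ i = ∑ j, if i = j then 0 else K i j + s ^ 2 * ((1 / 2 - l i) * (1 / 2 - l j)))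
    (hW : ∀ i j, i ≠ j → W i j = K i j + s ^ 2 * ((1 / 2 - l i) * (1 / 2 - l j))
      - (ρ i + ρ j) / 2 + (∑ i, ρ i) / 6) (hε : ∀ i j, W i j ^ 2 ≤ ε) :
    N ≤ k 0 + 300000 * (l 0 + ε) := by
  have hN₀ : 0 ≤ N := (sq_nonneg _).trans (haN 0)
  have l1 := hl 1
  have l2 := hl 2
  have l3 := hl 3
  have k0 := hka 0
  have k1 := hka 1
  have k2 := hka 2
  have k3 := hka 3
  have e0 := hρ 0
  have e1 := hρ 1
  have e2 := hρ 2
  have e3 := hρ 3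
  have c0 := hric 0
  have c1 := hric 1
  have c2 := hric 2
  have c3 := hric 3
  simp [Fin.sum_univ_four, hK 1 0, hK 2 0, hK 3 0, hK 2 1, hK 3 1, hK 3 2] at e0 e1 e2 e3
  simp only [Fin.sum_univ_four, hK', hK 1 0, hK 2 0, hK 3 0, hK 2 1, hK 3 1, hK 3 2]
    at hsum hsq hk hla hN hW c0 c1 c2 c3
  -- The sum of 1/2 - lⱼ over j ≠ i equals lᵢ because Σ lⱼ = 3/2; this yields the Ricci curvature of
  -- the level set.
  have r0 : ρ 0 = l 0 - k 0 + s ^ 2 * (l 0 * (1 / 2 - l 0)) := by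
    linear_combination e0 + c0 - s ^ 2 * (1 / 2 - l 0) * hsum
  have r1 : ρ 1 = l 1 - k 1 + s ^ 2 * (l 1 * (1 / 2 - l 1)) := by
    linear_combination e1 + c1 - s ^ 2 * (1 / 2 - l 1) * hsum
  have r2 : ρ 2 = l 2 - k 2 + s ^ 2 * (l 2 * (1 / 2 - l 2)) := by
    linear_combination e2 + c2 - s ^ 2 * (1 / 2 - l 2) * hsum
  have r3 : ρ 3 = l 3 - k 3 + s ^ 2 * (l 3 * (1 / 2 - l 3)) := by
    linear_combination e3 + c3 - s ^ 2 * (1 / 2 - l 3) * hsum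
  have hσ : ρ 0 + ρ 1 + ρ 2 + ρ 3 = 3 / 2 := by
    linear_combination r0 + r1 + r2 + r3 + hsum - hk + s ^ 2 * (hsum / 2 - hsq)
  -- The least of four numbers with sum 3/2.
  have hd' : l 0 ≤ 3 / 8 := by linarith
  have w01 := hW 0 1 (by decide)
  have w02 := hW 0 2 (by decide)
  have w03 := hW 0 3 (by decide)
  have w12 := hW 1 2 (by decide)
  have w13 := hW 1 3 (by decide)
  have w23 := hW 2 3 (by decide)
  obtain ⟨x, hx⟩ : ∃ x, l 1 = 1 / 2 + x := ⟨l 1 - 1 / 2, by ring⟩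
  obtain ⟨y, hy⟩ : ∃ y, l 2 = 1 / 2 + y := ⟨l 2 - 1 / 2, by ring⟩
  obtain ⟨z, hz⟩ : ∃ z, l 3 = 1 / 2 + z := ⟨l 3 - 1 / 2, by ring⟩
  have hxyz : x + y + z = -l 0 := by rw [hx, hy, hz] at hsum; linarith
  have hxyz2 : x ^ 2 + y ^ 2 + z ^ 2 = l 0 - l 0 ^ 2 := by
    rw [hx, hy, hz] at hsq
    linear_combination hsq - hxyz
  have hμ : ∀ x i, x ^ 2 ≤ l 0 → |x * a i| ≤ Real.sqrt (l 0 * N) := fun x i h =>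
    Real.abs_le_sqrt (by rw [mul_pow]; exact mul_le_mul h (haN i) (sq_nonneg _) hl₀)
  have hsa : a 0 + a 1 + a 2 + a 3 = 0 := by
    refine (mul_eq_zero.1 ?_).resolve_left hs.ne'
    linear_combination hk - k0 - k1 - k2 - k3 - s ^ 2 * (hsum / 2 - hsq)
  -- In dimension four the trace-free conditions Σⱼ Wᵢⱼ = 0 equate complementary planes and leave
  -- two free components, W₀₁ and W₀₂.
  have v23 : W 2 3 = W 0 1 := by
    linear_combination (-w01 - w02 - w03 + e0 - w01 - w12 - w13 + e1 + w02 + w12 + w23 - e2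
      + w03 + w13 + w23 - e3) / 2
  have v13 : W 1 3 = W 0 2 := by
    linear_combination (-w01 - w02 - w03 + e0 - w02 - w12 - w23 + e2 + w01 + w12 + w13 - e1
      + w03 + w13 + w23 - e3) / 2
  have v03 : W 0 3 = -W 0 1 - W 0 2 := by
    linear_combination w01 + w02 + w03 - e0
  have v12 : W 1 2 = -W 0 1 - W 0 2 := by
    linear_combination w01 + w12 + w13 - e1 - v13
  have hlt : l 0 * (1 / 2 - l 0) + l 1 * (1 / 2 - l 1) + l 2 * (1 / 2 - l 2)
      + l 3 * (1 / 2 - l 3) = 0 := by linear_combination hsum / 2 - hsq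
  -- Each Kᵢⱼ is replaced by Weyl, Ricci and scalar parts minus the Gauss correction. The constant
  -- is 3/16 = (3/2)/6 · Σ_{i<j} lᵢlⱼ with the last sum 3/4, and Σ lᵢ(1/2 - lᵢ) = 0 turns the Gauss
  -- corrections into a sum of squares.
  have hKW : K 0 1 * l 0 * l 1 + K 0 2 * l 0 * l 2 + K 0 3 * l 0 * l 3 + K 1 2 * l 1 * l 2
      + K 1 3 * l 1 * l 3 + K 2 3 * l 2 * l 3
      = W 0 1 * ((l 0 - l 2) * (l 1 - l 3)) + W 0 2 * ((l 0 - l 1) * (l 2 - l 3))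
        + (l 0 * (3 / 2 - l 0) * ρ 0 + l 1 * (3 / 2 - l 1) * ρ 1 + l 2 * (3 / 2 - l 2) * ρ 2
          + l 3 * (3 / 2 - l 3) * ρ 3) / 2 - 3 / 16
        + s ^ 2 / 2 * ((l 0 * (1 / 2 - l 0)) ^ 2 + (l 1 * (1 / 2 - l 1)) ^ 2
          + (l 2 * (1 / 2 - l 2)) ^ 2 + (l 3 * (1 / 2 - l 3)) ^ 2) := by
    linear_combination -(l 0 * l 1) * w01 - l 0 * l 2 * w02 - l 0 * l 3 * w03 - l 1 * l 2 * w12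
      - l 1 * l 3 * w13 - l 2 * l 3 * w23 + l 2 * l 3 * v23 + l 1 * l 3 * v13 + l 0 * l 3 * v03
      + l 1 * l 2 * v12 - (l 0 * l 1 + l 0 * l 2 + l 0 * l 3 + l 1 * l 2 + l 1 * l 3 + l 2 * l 3)
        / 6 * hσ - 1 / 4 * ((l 0 + l 1 + l 2 + l 3 + 3 / 2) / 2 * hsum - hsq / 2)
      + (l 0 * ρ 0 + l 1 * ρ 1 + l 2 * ρ 2 + l 3 * ρ 3) / 2 * hsum
      - s ^ 2 / 2 * (l 0 * (1 / 2 - l 0) + l 1 * (1 / 2 - l 1) + l 2 * (1 / 2 - l 2)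
      + l 3 * (1 / 2 - l 3)) * hlt
  refine estimate_of_parts (d := l 0) (x := x) (y := y) (z := z) (s := s) (r := s ^ 2)
    (a₀ := a 0) (a₁ := a 1) (a₂ := a 2) (a₃ := a 3) (A := W 0 1) (B := W 0 2)
    (q := Real.sqrt (l 0 * N)) hl₀ hd' hxyz hxyz2 hs.le hs' rfl (hka 0) ?_
    (hμ x 1 ?_) (hμ y 2 ?_) (hμ z 3 ?_) (hε 0 1) (hε 0 2)
    (Real.sq_sqrt (mul_nonneg hl₀ hN₀)).le hN₀ ?_
  · rw [hx, hy, hz] at hla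
    linear_combination hsa / 2 - hla
  · linarith [sq_nonneg y, sq_nonneg z, sq_nonneg (l 0)]
  · linarith [sq_nonneg x, sq_nonneg z, sq_nonneg (l 0)]
  · linarith [sq_nonneg y, sq_nonneg x, sq_nonneg (l 0)]
  · rw [hx, hy, hz] at hKW hN
    rw [hx] at k1 r1
    rw [hy] at k2 r2
    rw [hz] at k3 r3
    -- For i ≥ 1 the weight 2lᵢ(3/2 - lᵢ) of the i-th Ricci curvature is 1 + x - 2x². The part 1
    -- sums to -(k₁ + k₂ + k₃) = k₀; in the remainder kᵢ is expanded by `hka`.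
    linear_combination hN + 4 * hKW + 2 * l 0 * (3 / 2 - l 0) * r0
      + 2 * (1 / 2 + x) * (1 - x) * r1 + 2 * (1 / 2 + y) * (1 - y) * r2
      + 2 * (1 / 2 + z) * (1 - z) * r3 - hk - (x - 2 * x ^ 2) * k1 - (y - 2 * y ^ 2) * k2
      - (z - 2 * z ^ 2) * k3 + 3 / 2 * hxyz

end Estimate

/-! ### A component is bounded by the tensor norm. -/

section SumSq

variable {α β γ δ : Type*} [Fintype α] [Fintype β] [Fintype γ] [Fintype δ]

theorem sq_le_sum_sq₃ (T : α → β → γ → ℝ) (p : α) (q : β) (r : γ) :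
    T p q r ^ 2 ≤ ∑ p, ∑ q, ∑ r, T p q r ^ 2 := by
  have e := Finset.single_le_sum (f := fun a : α × β × γ => T a.1 a.2.1 a.2.2 ^ 2)
    (fun a _ => sq_nonneg _) (Finset.mem_univ (p, q, r))
  simpa only [Fintype.sum_prod_type] using e

theorem sq_le_sum_sq₄ (T : α → β → γ → δ → ℝ) (p : α) (q : β) (r : γ) (s : δ) :
    T p q r s ^ 2 ≤ ∑ p, ∑ q, ∑ r, ∑ s, T p q r s ^ 2 := by
  have e := Finset.single_le_sum (f := fun a : α × β × γ × δ => T a.1 a.2.1 a.2.2.1 a.2.2.2 ^ 2)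
    (fun a _ => sq_nonneg _) (Finset.mem_univ (p, q, r, s))
  simpa only [Fintype.sum_prod_type] using e

end SumSq

/-! ### Frames adapted to the level sets. -/

section Adapted

variable {E : Type*} [NormedAddCommGroup E] [NormedSpace ℝ E] [FiniteDimensional ℝ E]
  {U : Set E} {g : E → E →L[ℝ] E →L[ℝ] ℝ} {Γ : E → E →L[ℝ] E →L[ℝ] E} {f : E → ℝ} {V : E → E}
  {c : ℝ} {y : E} {ι : Type*} [Fintype ι] [DecidableEq ι] {X : Option ι → E} {l : ι → ℝ}

omit [FiniteDimensional ℝ E] in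
theorem IsLeviCivita.sectional_symm (h : IsLeviCivita U g Γ) (hy : y ∈ U) (u v : E) :
    g y (curvOp Γ y u v v) u = g y (curvOp Γ y v u u) v := by
  rw [h.curvOp_skew hy, curvOp_swap]; simp

omit [FiniteDimensional ℝ E] in
theorem curvOp_self (u : E) : curvOp Γ y u u = 0 := by
  simp [curvOp]

/-- An orthonormal frame of eigenvectors of the Ricci tensor, whose first member is the unit normal
of the level set of the potential. -/
structure IsAdaptedFrame (g : E → E →L[ℝ] E →L[ℝ] ℝ) (Γ : E → E →L[ℝ] E →L[ℝ] E) (V : E → E)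
    (y : E) (X : Option ι → E) (l : ι → ℝ) : Prop extends IsOrthoFrame (g y) X where
  normal : X none = (Real.sqrt (g y (V y) (V y)))⁻¹ • V y
  eigen : ∀ i, ricEnd Γ V y (X (some i)) = l i • X (some i)

namespace IsAdaptedFrame

variable (hX : IsAdaptedFrame g Γ V y X l) (h : IsLocalShrinker U g Γ f V c) (hy : y ∈ U)
include hX h hy

theorem ricEnd_normal : ricEnd Γ V y (X none) = 0 := by
  rw [hX.normal, map_smul, h.ricEnd_gradient hy, smul_zero]

theorem sum_eigenvalues : ∑ i, l i = c := by
  have e := hX.trace_clm_eq (ricEnd Γ V y)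
  rw [h.scal_eq y hy, Fintype.sum_option] at e
  simpa [hX.ricEnd_normal h hy, hX.eigen, hX.apply] using e.symm

theorem sum_sq_eigenvalues : ∑ i, l i ^ 2 = c / 2 := by
  have e := hX.trace_comp_eq (ricEnd Γ V y) (ricEnd Γ V y)
  rw [h.coordTrace_ricEnd_sq hy, Fintype.sum_option] at e
  simpa [hX.ricEnd_normal h hy, hX.eigen, hX.apply, sq] using e.symm

theorem sum_sectional (i : ι) : ∑ j, g y (curvOp Γ y (X (some i)) (X (some j)) (X (some j))) (X (some i))
      + g y (curvOp Γ y (X none) (X (some i)) (X (some i))) (X none) = l i := by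
  have e := h.ricci_eq y hy (X (some i)) (X (some i))
  rw [hX.trace_eq (isLinearMap_curvOp_left y _ _), Fintype.sum_option, hX.eigen] at e
  simp only [map_smul, smul_apply, hX.apply, if_true, smul_eq_mul, mul_one] at e
  rw [← e, add_comm]
  congr 1
  exact Finset.sum_congr rfl fun j _ => h.sectional_symm hy _ _

theorem sum_normal_sectional :
    ∑ i, g y (curvOp Γ y (X none) (X (some i)) (X (some i))) (X none) = 0 := by
  have e := h.ricci_eq y hy (X none) (X none)
  rw [hX.trace_eq (isLinearMap_curvOp_left y _ _), Fintype.sum_option, hX.ricEnd_normal h hy] at e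
  simp only [curvOp_self, map_zero, zero_apply, zero_add] at e
  rw [← e]
  exact Finset.sum_congr rfl fun j _ => h.sectional_symm hy _ _

/-- Codazzi gives R(eᵢ, ν)∇f = (∇_ν Ric)eᵢ - (∇_{eᵢ} Ric)ν, and the last term is explicit from the
derivative of Ric(∇f) = 0. -/
theorem normal_sectional (i : ι) :
    g y (curvOp Γ y (X none) (X (some i)) (X (some i))) (X none)
      = (Real.sqrt (g y (V y) (V y)))⁻¹ ^ 2 * (l i * (1 / 2 - l i))
        + (Real.sqrt (g y (V y) (V y)))⁻¹
          * g y (covEnd Γ (ricEnd Γ V) y (X none) (X (some i))) (X (some i)) := by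
  set s := (Real.sqrt (g y (V y) (V y)))⁻¹
  rw [h.sectional_symm hy]
  have e1 : covEnd Γ (ricEnd Γ V) y (X (some i)) (X none)
      = -(s * (l i * (1 / 2 - l i))) • X (some i) := by
    rw [hX.normal, map_smul, h.covEnd_ricEnd_gradient hy, IsLocalShrinker.covVec_eq]
    simp only [map_sub, map_smul, hX.eigen]
    module
  have e2 : curvOp Γ y (X (some i)) (X none) (X none)
      = s • curvOp Γ y (X (some i)) (X none) (V y) := by
    conv_lhs => rw [hX.normal]
    rw [map_smul]
    rw [← hX.normal]
  rw [e2, ← h.codazzi hy, e1]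
  simp only [map_smul, map_sub, smul_apply, sub_apply, hX.apply, smul_eq_mul, if_true]
  ring

/-- This is tr(Ric ∘ ∇_ν Ric) = 0, that is, |Ric|² has no derivative along ν. -/
theorem sum_eigenvalue_mul :
    ∑ i, l i * g y (covEnd Γ (ricEnd Γ V) y (X none) (X (some i))) (X (some i)) = 0 := by
  have e := hX.trace_comp_eq (ricEnd Γ V y) (covEnd Γ (ricEnd Γ V) y (X none))
  rw [h.trace_ricEnd_covEnd hy, Fintype.sum_option, h.ricEnd_symm hy,
    hX.ricEnd_normal h hy] at e
  simp only [map_zero, zero_apply, zero_add] at e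
  rw [e]
  refine Finset.sum_congr rfl fun i _ => ?_
  rw [h.ricEnd_symm hy, hX.eigen]
  simp [h.symm y hy (X (some i))]

/-- Ric(ν) = 0 removes ν from the curvature sum of `IsLocalShrinker.norm_covEnd_sq`; on the left,
symmetry of ∇_p Ric turns the trace of its square into a sum of squares. -/
theorem norm_covEnd_sq :
    ∑ p, ∑ q, ∑ r, (g y (covEnd Γ (ricEnd Γ V) y (X p) (X q)) (X r)) ^ 2
      = 2 * ∑ i, ∑ j, g y (curvOp Γ y (X (some i)) (X (some j)) (X (some j))) (X (some i))
          * l i * l j - c / 2 := by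
  have e := h.norm_covEnd_sq hy hX.toIsOrthoFrame
  have e1 : ∀ p, coordTrace (fun w => covEnd Γ (ricEnd Γ V) y (X p)
      (covEnd Γ (ricEnd Γ V) y (X p) w))
      = ∑ q, ∑ r, (g y (covEnd Γ (ricEnd Γ V) y (X p) (X q)) (X r)) ^ 2 := by
    intro p
    rw [hX.trace_comp_eq]
    refine Finset.sum_congr rfl fun q _ => ?_
    rw [h.covEnd_ricEnd_symm hy, hX.inner_eq_sum]
    refine Finset.sum_congr rfl fun r _ => ?_
    rw [h.symm y hy (X r), sq]
  simp only [e1] at e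
  rw [e]
  simp only [Fintype.sum_option, hX.ricEnd_normal h hy, hX.eigen, map_zero, zero_apply,
    mul_zero, Finset.sum_const_zero, zero_add, map_smul, smul_apply, smul_eq_mul]
  congr 1
  rw [neg_mul, ← mul_neg, ← Finset.sum_neg_distrib]
  congr 1
  refine Finset.sum_congr rfl fun i _ => ?_
  rw [← Finset.sum_neg_distrib]
  refine Finset.sum_congr rfl fun j _ => ?_
  rw [h.curvOp_skew hy _ _ (X (some i))]
  ring

end IsAdaptedFrame

variable {F : Type*} [NormedAddCommGroup F] [NormedSpace ℝ F] [FiniteDimensional ℝ F]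
  {U' : Set F} {g' : F → F →L[ℝ] F →L[ℝ] ℝ} {Γ' : F → F →L[ℝ] F →L[ℝ] F} {γ : F → E} {v : F}

/-- The tangential part of an adapted frame comes from an orthonormal frame of the level set. -/
theorem IsAdaptedFrame.exists_tangent_frame (hX : IsAdaptedFrame g Γ V (γ v) X l)
    (h : IsLocalShrinker U g Γ f V c) (h' : IsMetricConnection U' g' Γ')
    (hγ : IsIsometricImmersion U g U' g' γ) (hv : v ∈ U')
    (hf : ∀ a, fderiv ℝ f (γ v) (fderiv ℝ γ v a) = 0) (hV : V (γ v) ≠ 0)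
    (hdim : Module.finrank ℝ E = Module.finrank ℝ F + 1) :
    ∃ b : ι → F, IsOrthoFrame (g' v) b ∧ ∀ i, fderiv ℝ γ v (b i) = X (some i) := by
  obtain ⟨b', hb'⟩ := h'.exists_orthoFrame hv
  have hfr := h.completed_frame hγ hv hf hV hdim hb'
  refine ⟨fun i => ∑ j, g (γ v) (X (some i)) (fderiv ℝ γ v (b' j)) • b' j, ?_⟩
  have e : ∀ i, fderiv ℝ γ v (∑ j, g (γ v) (X (some i)) (fderiv ℝ γ v (b' j)) • b' j)
      = X (some i) := by
    intro i
    conv_rhs => rw [hfr.expand (X (some i))]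
    rw [Fintype.sum_option]
    simp [← hX.normal, hX.apply]
  refine ⟨⟨?_, fun i j => ?_⟩, e⟩
  · have := hX.card
    simp at this
    omega
  · rw [hγ.metric_eq v hv, e, e, hX.apply]
    simp

/-- The sectional curvatures of a level set. -/
theorem IsAdaptedFrame.sectional_levelSet (hX : IsAdaptedFrame g Γ V (γ v) X l)
    (h : IsLocalShrinker U g Γ f V c) (h' : IsMetricConnection U' g' Γ')
    (hγ : IsIsometricImmersion U g U' g' γ) (hv : v ∈ U')
    (hf : ∀ z ∈ U', f (γ z) = f (γ v)) (hV : V (γ v) ≠ 0)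
    (hdim : Module.finrank ℝ E = Module.finrank ℝ F + 1) {b : ι → F}
    (hb : ∀ i, fderiv ℝ γ v (b i) = X (some i)) (i j : ι) :
    g' v (curvOp Γ' v (b i) (b j) (b j)) (b i) = if i = j then 0 else
      g (γ v) (curvOp Γ (γ v) (X (some i)) (X (some j)) (X (some j))) (X (some i))
        + (Real.sqrt (g (γ v) (V (γ v)) (V (γ v))))⁻¹ ^ 2 * ((1 / 2 - l i) * (1 / 2 - l j)) := by
  split_ifs with hij
  · rw [hij, curvOp_self]; simp
  · have h0 := h.pos _ (hγ.mapsTo v hv) _ hV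
    -- As ∇²f = 1/2 - Ric, the second fundamental form is diagonal in the same frame.
    have e : ∀ i, covVec Γ V (γ v) (X (some i)) = (1 / 2 - l i) • X (some i) := by
      intro i
      rw [IsLocalShrinker.covVec_eq, hX.eigen]
      module
    rw [h.gauss_levelSet h' hγ hv hf hV hdim, hb, hb, e, e, inv_pow, Real.sq_sqrt h0.le]
    simp only [map_smul, smul_apply, hX.apply, smul_eq_mul, if_true, Option.some.injEq, hij,
      if_false]
    field_simp
    ring
end Adapted

/-! ### From a Ricci eigenframe to an adapted frame. -/

section Eigenframe

/-- If one of five numbers with sum `3/2` and sum of squares `3/4` vanishes, the others are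
nonnegative. -/
theorem nonneg_of_sum_of_sum_sq {lam : Fin 5 → ℝ} (h1 : ∑ i, lam i = 3 / 2)
    (h2 : ∑ i, lam i ^ 2 = 3 / 4) {a : Fin 5} (ha : lam a = 0) (b : Fin 5) : 0 ≤ lam b := by
  rcases eq_or_ne b a with rfl | hab
  · exact ha.ge
  have hb : b ∈ Finset.univ.erase a := Finset.mem_erase.2 ⟨hab, Finset.mem_univ b⟩
  rw [← Finset.add_sum_erase _ _ (Finset.mem_univ a), ← Finset.add_sum_erase _ _ hb, ha] at h1 h2
  -- Cauchy–Schwarz for the other three numbers: (3/2 - t)² ≤ 3(3/4 - t²), that is 4t² ≤ 3t, with t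
  -- = `lam b`.
  have e := sq_sum_le_card_mul_sum_sq (s := (Finset.univ.erase a).erase b) (f := lam)
  rw [Finset.card_erase_of_mem hb, Finset.card_erase_of_mem (Finset.mem_univ a)] at e
  simp at e
  have e1 : ∑ x ∈ (Finset.univ.erase a).erase b, lam x = 3 / 2 - lam b := by linarith
  have e2 : ∑ x ∈ (Finset.univ.erase a).erase b, lam x ^ 2 = 3 / 4 - lam b ^ 2 := by linarith
  rw [e1, e2] at e
  nlinarith

variable {E : Type*} [NormedAddCommGroup E] [NormedSpace ℝ E] [FiniteDimensional ℝ E]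
  {U : Set E} {g : E → E →L[ℝ] E →L[ℝ] ℝ} {Γ : E → E →L[ℝ] E →L[ℝ] E} {f : E → ℝ} {V : E → E}
  {y : E}

/-- A Ricci eigenframe can be rotated, in the plane of its first two members, to an adapted
frame. -/
theorem IsLocalShrinker.exists_adaptedFrame (h : IsLocalShrinker U g Γ f V (3 / 2)) (hy : y ∈ U)
    (hV : V y ≠ 0) {lam : Fin 5 → ℝ} {e : Fin 5 → E} (he : IsOrthoFrame (g y) e)
    (hm : Monotone lam) (hP : ∀ a, ricEnd Γ V y (e a) = lam a • e a) :
    ∃ (X : Option (Fin 4) → E) (l : Fin 4 → ℝ), IsAdaptedFrame g Γ V y X l ∧ lam 0 = 0 ∧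
      l 0 = lam 1 ∧ 0 ≤ l 0 ∧ (∀ i, l 0 ≤ l i) ∧
      g y (curvOp Γ y (X none) (X (some 0)) (X (some 0))) (X none)
        = g y (curvOp Γ y (e 0) (e 1) (e 1)) (e 0) := by
  have hv : ∀ a, lam a * g y (V y) (e a) = 0 := by
    intro a
    have := h.ricEnd_symm hy (V y) (e a)
    rw [h.ricEnd_gradient hy, hP] at this
    simpa [h.symm y hy (e a), eq_comm] using this
  have hs1 : ∑ i, lam i = 3 / 2 := by
    have := he.trace_clm_eq (ricEnd Γ V y)
    rw [h.scal_eq y hy] at this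
    simpa [hP, he.apply] using this.symm
  have hs2 : ∑ i, lam i ^ 2 = 3 / 4 := by
    have := he.trace_comp_eq (ricEnd Γ V y) (ricEnd Γ V y)
    rw [h.coordTrace_ricEnd_sq hy] at this
    simp only [hP, map_smul, smul_apply, he.apply, if_true, smul_eq_mul, mul_one, ← sq] at this
    rw [← this]; norm_num
  -- The nonzero vector V has a component along some eigenvector, and there the eigenvalue must
  -- vanish.
  obtain ⟨a, ha⟩ : ∃ a, g y (V y) (e a) ≠ 0 := by
    by_contra! hcon
    exact hV ((he.expand (V y)).trans (by simp [hcon]))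
  have hnn := nonneg_of_sum_of_sum_sq hs1 hs2 ((mul_eq_zero.1 (hv a)).resolve_right ha)
  have h0 : lam 0 = 0 := le_antisymm
    ((hm (Fin.zero_le a)).trans ((mul_eq_zero.1 (hv a)).resolve_right ha).le) (hnn 0)
  -- Three vanishing eigenvalues would leave two with sum 3/2 and sum of squares 3/4, below the
  -- minimum 9/8. Hence V lies in the plane of the first two members.
  have h2 : 0 < lam 2 := by
    refine (hnn 2).lt_of_ne fun h2 => ?_
    have h1 : lam 1 = 0 := le_antisymm (h2 ▸ hm (by decide)) (hnn 1)
    rw [Fin.sum_univ_five, h0, h1, ← h2] at hs1 hs2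
    nlinarith [sq_nonneg (lam 3 - lam 4)]
  have hv' : ∀ a, 2 ≤ a → g y (V y) (e a) = 0 := fun a ha =>
    (mul_eq_zero.1 (hv a)).resolve_left (h2.trans_le (hm ha)).ne'
  have hVe := he.expand (V y)
  rw [Fin.sum_univ_five, hv' 2 le_rfl, hv' 3 (by decide), hv' 4 (by decide)] at hVe
  simp only [zero_smul, add_zero] at hVe
  set v0 := g y (V y) (e 0)
  set v1 := g y (V y) (e 1)
  have hF : g y (V y) (V y) = v0 ^ 2 + v1 ^ 2 := by
    rw [hVe]
    simp [he.apply, sq]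
  have hFpos := h.pos y hy _ hV
  set s := (Real.sqrt (g y (V y) (V y)))⁻¹ with hs
  have hss : s ^ 2 * (v0 ^ 2 + v1 ^ 2) = 1 := by
    rw [hs, inv_pow, Real.sq_sqrt hFpos.le, ← hF, inv_mul_cancel₀ hFpos.ne']
  refine ⟨fun o => o.elim (s • V y) (Fin.cons (s • (-v1 • e 0 + v0 • e 1))
    fun i => e i.succ.succ), fun i => lam i.succ, ⟨⟨?_, ?_⟩, rfl, ?_⟩, h0, rfl, hnn 1,
    fun i => hm (Fin.succ_le_succ_iff.2 (Fin.zero_le i)), ?_⟩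
  · simpa using he.card
  · have c1 : g y (s • V y) (s • V y) = 1 := by
      simp only [map_smul, smul_apply, smul_eq_mul, hF]; linarith
    have c2 : g y (s • (-v1 • e 0 + v0 • e 1)) (s • (-v1 • e 0 + v0 • e 1)) = 1 := by
      simp [he.apply]; linarith
    have c3 : g y (s • V y) (s • (-v1 • e 0 + v0 • e 1)) = 0 := by
      rw [hVe]; simp [he.apply]; ring_nf
    have c4 : ∀ i : Fin 3, g y (s • V y) (e i.succ.succ) = 0 := by
      intro i
      simp [hv' i.succ.succ (by fin_cases i <;> decide)]
    have c5 : ∀ i : Fin 3, g y (s • (-v1 • e 0 + v0 • e 1)) (e i.succ.succ) = 0 := by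
      intro i
      fin_cases i <;> simp [he.apply]
    rintro (_ | i) (_ | j)
    · simpa using c1
    · refine Fin.cases ?_ (fun j => ?_) j
      · simpa using c3
      · simpa using c4 j
    · refine Fin.cases ?_ (fun j => ?_) i
      · rw [h.symm y hy]; simpa using c3
      · rw [h.symm y hy]; simpa using c4 j
    · refine Fin.cases ?_ (fun i => ?_) i <;> refine Fin.cases ?_ (fun j => ?_) j
      · simpa using c2
      · simpa [eq_comm, Fin.succ_ne_zero] using c5 j
      · rw [h.symm y hy]; simpa [Fin.succ_ne_zero] using c5 i
      · simp [he.apply]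
  · intro i
    refine Fin.cases ?_ (fun i => ?_) i
    -- Either λ₂ = 0, and every vector of the plane is an eigenvector, or V is parallel to e₁ and
    -- the rotation is trivial up to sign.
    · have := hv 1
      simp only [Option.elim, Fin.cons_zero, map_smul, map_add, hP, h0, Fin.succ_zero_eq_one]
      have e1 : lam 1 • v1 • e 0 = 0 := by rw [smul_smul, this, zero_smul]
      linear_combination (norm := module) s • e1
    · simp [hP]
  · simp only [Option.elim, Fin.cons_zero]
    -- R(u, v) is alternating and the rotation has determinant one.
    have c1 : curvOp Γ y (s • V y) (s • (-v1 • e 0 + v0 • e 1)) = curvOp Γ y (e 0) (e 1) := by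
      rw [hVe]
      simp only [curvOp_smul_left, curvOp_smul_right, curvOp_add_left, curvOp_add_right, curvOp_self,
        curvOp_swap y (e 1) (e 0), smul_zero, zero_add, add_zero]
      exact Eq.trans (b := (s ^ 2 * (v0 ^ 2 + v1 ^ 2)) • curvOp Γ y (e 0) (e 1)) (by module)
        (by rw [hss, one_smul])
    rw [c1, hVe]
    have hsk := h.curvOp_skew hy (e 0) (e 1)
    have s0 : g y (curvOp Γ y (e 0) (e 1) (e 0)) (e 0) = 0 := by linarith [hsk (e 0) (e 0)]
    have s1 : g y (curvOp Γ y (e 0) (e 1) (e 1)) (e 1) = 0 := by linarith [hsk (e 1) (e 1)]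
    simp only [map_smul, map_add, smul_apply, add_apply, smul_eq_mul, s0, s1, hsk (e 0) (e 1)]
    linear_combination g y (curvOp Γ y (e 0) (e 1) (e 1)) (e 0) * hss

end Eigenframe

/-! ### The estimate in local coordinates. -/

section Final

/-- The sectional components of the Weyl tensor in dimension four. -/
theorem IsMetricOn.weylForm_sectional {k : ℕ∞ω} {U : Set (Coord 4)}
    {G : Coord 4 → Matrix (Fin 4) (Fin 4) ℝ} (h : IsMetricOn k U G) {y : Coord 4} (hy : y ∈ U)
    {b : Fin 4 → Coord 4} (hb : IsOrthoFrame (metricCLM G y) b) {S : Fin 4 → Fin 4 → ℝ}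
    (hS : ∀ i j, metricCLM G y (curvOp (connCLM G) y (b i) (b j) (b j)) (b i) = S i j)
    (hS' : ∀ i j, S i j = S j i) {i j : Fin 4} (hij : i ≠ j) :
    weylForm G y (b i) (b j) (b i) (b j)
      = S i j - ((∑ m, S i m) + ∑ m, S j m) / 2 + (∑ m, ∑ m', S m m') / 6 := by
  have hr : ∀ i, ricForm (connCLM G) y (b i) (b i) = ∑ m, S i m := by
    intro i
    rw [ricForm, hb.trace_eq (isLinearMap_curvOp_left y _ _)]
    exact Finset.sum_congr rfl fun m _ => by rw [hS, hS']
  rw [weylForm, h.scal_eq hy hb, hS]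
  simp only [hr, hb.apply, if_true, hij, hij.symm, if_false]
  push_cast
  ring

theorem IsRicciEigenframe.isOrthoFrame {n : ℕ} {G : Coord n → Matrix (Fin n) (Fin n) ℝ}
    {y : Coord n} {lam : Fin n → ℝ} {e : Fin n → Coord n} (h : IsRicciEigenframe G y lam e) :
    IsOrthoFrame (metricCLM G y) e where
  card := by simp
  apply i j := by rw [metricCLM_apply, h.orthonormal]

theorem IsRicciEigenframe.ricEnd_apply {n : ℕ} {G : Coord n → Matrix (Fin n) (Fin n) ℝ}
    {U : Set (Coord n)} {y : Coord n} {lam : Fin n → ℝ} {e : Fin n → Coord n}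
    (h : IsRicciEigenframe G y lam e) (hG : IsMetricOn ∞ U G) {f : Coord n → ℝ} {c : ℝ}
    (hs : IsLocalShrinker U (metricCLM G) (connCLM G) f (gradVec G f) c) (hy : y ∈ U)
    (a : Fin n) : ricEnd (connCLM G) (gradVec G f) y (e a) = lam a • e a := by
  refine h.isOrthoFrame.ext fun z => ?_
  have hz := fun L : Coord n →L[ℝ] ℝ => L.toLinearMap.isLinear.eq_sum_coordVec z
  have key : ∀ i, metricCLM G y (ricEnd (connCLM G) (gradVec G f) y (e a)) (coordVec i)
      = metricCLM G y (lam a • e a) (coordVec i) := by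
    intro i
    have e1 := h.eigen a i
    simp only [hG.ricci_eq_ricEnd hs hy, ← metricCLM_coordVec] at e1
    have e2 := ((metricCLM G y) (ricEnd (connCLM G) (gradVec G f) y
      (coordVec i))).toLinearMap.isLinear.eq_sum_coordVec (e a)
    have e3 := ((metricCLM G y) (coordVec i)).toLinearMap.isLinear.eq_sum_coordVec (e a)
    rw [hs.ricEnd_symm hy, map_smul, smul_apply, smul_eq_mul, hs.symm y hy (e a)]
    simp only [ContinuousLinearMap.coe_coe, smul_eq_mul] at e2 e3
    rw [e2, e3]
    simpa only [mul_comm] using e1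
  have h1 := hz (metricCLM G y (ricEnd (connCLM G) (gradVec G f) y (e a)))
  have h2 := hz (metricCLM G y (lam a • e a))
  simp only [ContinuousLinearMap.coe_coe] at h1 h2
  rw [h1, h2]
  simp only [key]

variable {U : Set (Coord 5)} {G : Coord 5 → Matrix (Fin 5) (Fin 5) ℝ} {f : Coord 5 → ℝ}
  {U' : Set (Coord 4)} {G' : Coord 4 → Matrix (Fin 4) (Fin 4) ℝ} {γ : Coord 4 → Coord 5}

/-- The estimate in local coordinates, where `|∇f| ≥ 1`. -/
theorem IsLocalShrinker.covRicciNormSq_le (hG : IsMetricOn ∞ U G)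
    (h : IsLocalShrinker U (metricCLM G) (connCLM G) f (gradVec G f) (3 / 2)) {k : ℕ∞ω}
    (hG' : IsMetricOn k U' G')
    (hγ : IsIsometricImmersion U (metricCLM G) U' (metricCLM G') γ) {v : Coord 4} (hv : v ∈ U')
    (hf : ∀ z ∈ U', f (γ z) = f (γ v))
    (hF : 1 ≤ metricCLM G (γ v) (gradVec G f (γ v)) (gradVec G f (γ v)))
    {lam : Fin 5 → ℝ} {e : Fin 5 → Coord 5} (he : IsRicciEigenframe G (γ v) lam e) :
    covRicciNormSq G (γ v) ≤ 300000 * (lam 0 + lam 1) + sectional G (γ v) (e 0) (e 1)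
      + 300000 * weylNormSq G' v := by
  have hy := hγ.mapsTo v hv
  have hV : gradVec G f (γ v) ≠ 0 := by
    intro h0
    rw [h0] at hF
    simp at hF
    linarith
  have hdim : Module.finrank ℝ (Coord 5) = Module.finrank ℝ (Coord 4) + 1 := by simp
  have hf' : ∀ a, fderiv ℝ f (γ v) (fderiv ℝ γ v a) = 0 := by
    intro a
    have e1 := fderiv_eq_of_eqOn hG'.isOpen hf hv
    have e2 := congrArg (fun L => L a) ((fderiv_comp v (differentiableAt_of_smooth
      (h.smooth_potential _ hy)) (hγ.differentiableAt hv)).symm.trans e1)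
    simpa using e2
  obtain ⟨X, l, hX, h0, hl1, hl0, hl, hsec⟩ := h.exists_adaptedFrame hy hV he.isOrthoFrame he.mono
    (he.ricEnd_apply hG h hy)
  obtain ⟨b, hb, hbX⟩ := hX.exists_tangent_frame h hG'.isMetricConnection hγ hv hf' hV hdim
  have hS := hX.sectional_levelSet h hG'.isMetricConnection hγ hv hf hV hdim hbX
  set F := metricCLM G (γ v) (gradVec G f (γ v)) (gradVec G f (γ v))
  have hs1 : (Real.sqrt F)⁻¹ ≤ 1 := inv_le_one_of_one_le₀ (Real.one_le_sqrt.2 hF)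
  have hs0 : 0 < (Real.sqrt F)⁻¹ := inv_pos.2 (Real.sqrt_pos.2 (by linarith))
  have hN := hG.covRicciNormSq_eq h hy hX.toIsOrthoFrame
  have hW := hG'.weylNormSq_eq hv hb
  have hsec' : sectional G (γ v) (e 0) (e 1)
      = metricCLM G (γ v) (curvOp (connCLM G) (γ v) (X none) (X (some 0)) (X (some 0))) (X none) := by
    rw [hG.sectional_eq hy, hsec]
    simp [he.isOrthoFrame.apply]
  -- With λ₁ = 0 the sum λ₁ + λ₂ is the least tangential eigenvalue.
  rw [hsec', h0, zero_add, ← hl1]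
  have key := frame_estimate (l := l) (s := (Real.sqrt F)⁻¹)
    (k := fun i => metricCLM G (γ v)
      (curvOp (connCLM G) (γ v) (X none) (X (some i)) (X (some i))) (X none))
    (a := fun i => metricCLM G (γ v) (covEnd (connCLM G) (ricEnd (connCLM G) (gradVec G f)) (γ v)
      (X none) (X (some i))) (X (some i)))
    (K := fun i j => metricCLM G (γ v)
      (curvOp (connCLM G) (γ v) (X (some i)) (X (some j)) (X (some j))) (X (some i)))
    (W := fun i j => weylForm G' v (b i) (b j) (b i) (b j))
    (N := covRicciNormSq G (γ v)) (ε := weylNormSq G' v) (ρ := _)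
    hl0 hl (hX.sum_eigenvalues h hy) ((hX.sum_sq_eigenvalues h hy).trans (by norm_num)) hs0 hs1
    (fun i j => h.sectional_symm hy _ _) (fun i => by simp [curvOp_self])
    (hX.sum_sectional h hy) (hX.sum_normal_sectional h hy) (hX.normal_sectional h hy)
    (hX.sum_eigenvalue_mul h hy) (fun i => hN ▸ sq_le_sum_sq₃ (fun p q r => metricCLM G (γ v)
      (covEnd (connCLM G) (ricEnd (connCLM G) (gradVec G f)) (γ v) (X p) (X q)) (X r))
      none (some i) (some i))
    (hN.trans ((hX.norm_covEnd_sq h hy).trans (by norm_num))) (fun i => rfl) ?_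
    (fun i j => hW ▸ sq_le_sum_sq₄ (fun p q r s => weylForm G' v (b p) (b q) (b r) (b s)) i j i j)
  · linarith
  · intro i j hij
    rw [hG'.weylForm_sectional hv hb hS ?_ hij, if_neg hij]
    intro i j
    by_cases hij : i = j
    · rw [hij]
    · rw [if_neg hij, if_neg (Ne.symm hij), h.sectional_symm hy (X (some i)),
        mul_comm (1 / 2 - l i)]

end Final

/-! ### Regular points, and the estimate on the manifold. -/

section Regular

variable {M : Type*} [TopologicalSpace M] [ChartedSpace (Coord 5) M] [IsManifold (𝓡 5) ∞ M]
  [RiemannianBundle (fun x : M => TangentSpace (𝓡 5) x)]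
  [IsContMDiffRiemannianBundle (𝓡 5) ∞ (Coord 5) (fun x : M => TangentSpace (𝓡 5) x)]

/-- The points where the gradient does not vanish are regular. -/
theorem mfderiv_ne_zero_of_gradNormSq {f : M → ℝ} (hf : ContMDiff (𝓡 5) 𝓘(ℝ, ℝ) ∞ f) {x : M}
    (hx : gradNormSq f x ≠ 0) : mfderiv (𝓡 5) 𝓘(ℝ, ℝ) f x ≠ 0 := by
  obtain ⟨φ, hφ, hxs⟩ : ∃ φ ∈ atlas (Coord 5) M, x ∈ φ.source :=
    ⟨_, chart_mem_atlas _ x, mem_chart_source _ x⟩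
  rw [gradNormSq_eq hf hφ hxs] at hx
  obtain ⟨y, hy, rfl⟩ : ∃ y ∈ φ.target, φ.symm y = x := ⟨φ x, φ.map_source hxs, φ.left_inv hxs⟩
  rw [φ.right_inv hy, metricCLM_apply] at hx
  intro h0
  refine hx ((metricForm_pullbackMetric φ.symm y _ _).trans ((inner_mfderiv_gradVec hf hφ hy _).trans
    ?_))
  rw [h0]
  rfl

/-- The estimate at the points where `|∇f| ≥ 1`. -/
theorem covRicciNormSq_chart_le {f : M → ℝ} (hf : IsShrinkerPotential f)
    (hR : HasConstantScalarCurvature M (3 / 2)) {x : M} (hF : 1 ≤ gradNormSq f x)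
    {φ : OpenPartialHomeomorph M (Coord 5)} (hφ : φ ∈ atlas (Coord 5) M) (hx : x ∈ φ.source)
    {lam : Fin 5 → ℝ} {e : Fin 5 → Coord 5} (he : IsRicciEigenframe (chartMetric φ) (φ x) lam e)
    {ψ : Coord 4 → M} {u : Coord 4} (hψ : IsHypersurfaceParam (levelSet f (f x)) x ψ u) :
    covRicciNormSq (chartMetric φ) (φ x) ≤
      300000 * (lam 0 + lam 1) + sectional (chartMetric φ) (φ x) (e 0) (e 1)
        + 300000 * weylNormSq (pullbackMetric ψ) u := by
  obtain ⟨U', hU', hu, h⟩ := hψ.exists_immersion hφ hx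
  have hγ := isIsometricImmersion_chart hφ (ψ := ψ) (U' := U')
    fun v hv => ⟨(h v hv).1, (h v hv).2.2.1⟩
  have hG' : IsMetricOn 2 U' (pullbackMetric ψ) :=
    isMetricOn_pullbackMetric hU' le_rfl (WithTop.coe_le_coe.2 le_top) (k := 3) (by norm_num)
      (fun v hv => (h v hv).1) (fun v hv => (h v hv).2.1)
  have hb : (φ ∘ ψ) u = φ x := by simp [hψ.base]
  have hlev : ∀ z ∈ U', (f ∘ φ.symm) ((φ ∘ ψ) z) = (f ∘ φ.symm) ((φ ∘ ψ) u) := by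
    intro z hz
    have e1 := (h z hz).2.2.2
    have e2 := (h u hu).2.2.2
    simp only [levelSet, Set.mem_ofPred_eq] at e1 e2
    simp [φ.left_inv (h z hz).2.2.1, φ.left_inv (h u hu).2.2.1, e1, e2]
  rw [gradNormSq_eq hf.1 hφ hx, ← hb] at hF
  rw [← hb] at he ⊢
  exact IsLocalShrinker.covRicciNormSq_le (isMetricOn_chartMetric hφ)
    (isLocalShrinker_chart hf hR hφ) hG' hγ hu hlev hF he

end Regular

end ShrinkerEstimate

end

theorem mainTheorem4 {M : Type*} [MetricSpace M] [ChartedSpace (Coord 5) M]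
    [IsManifold (𝓡 5) ∞ M]
    [RiemannianBundle (fun x : M => TangentSpace (𝓡 5) x)]
    [IsContMDiffRiemannianBundle (𝓡 5) ∞ (Coord 5) (fun x : M => TangentSpace (𝓡 5) x)]
    [IsRiemannianManifold (𝓡 5) M] [CompleteSpace M] [ConnectedSpace M]
    (f : M → ℝ) (hf : IsShrinkerPotential f) (hR : HasConstantScalarCurvature M (3 / 2)) :
    ∃ C : ℝ, 0 < C ∧ ∃ a : ℝ, 0 < a ∧
      ∀ x : M, x ∉ sublevelSet f a →
        (∃ (ψ : Coord 4 → M) (u : Coord 4), IsHypersurfaceParam (levelSet f (f x)) x ψ u) ∧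
        ∀ φ ∈ atlas (Coord 5) M, x ∈ φ.source →
          ∀ (lam : Fin 5 → ℝ) (e : Fin 5 → Coord 5),
            IsRicciEigenframe (chartMetric φ) (φ x) lam e →
          ∀ (ψ : Coord 4 → M) (u : Coord 4),
            IsHypersurfaceParam (levelSet f (f x)) x ψ u →
            covRicciNormSq (chartMetric φ) (φ x) ≤
              C * (lam 0 + lam 1) + sectional (chartMetric φ) (φ x) (e 0) (e 1)
                + C * weylNormSq (pullbackMetric ψ) u := by
  obtain ⟨c, hc⟩ := exists_gradNormSq_eq hf hR
  -- Since |∇f|² = f + c, the condition f > |c| + 1 forces |∇f|² > 1.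
  refine ⟨300000, by norm_num, |c| + 1, by positivity, fun x hx => ?_⟩
  have hF : 1 ≤ gradNormSq f x := by
    simp only [sublevelSet, Set.mem_ofPred_eq, not_le] at hx
    linarith [hc x, neg_abs_le c]
  refine ⟨?_, fun φ hφ hxs lam e he ψ u hψ => covRicciNormSq_chart_le hf hR hF hφ hxs he hψ⟩
  obtain ⟨ψ, hψ⟩ := exists_isHypersurfaceParam hf.1
    (mfderiv_ne_zero_of_gradNormSq hf.1 (by linarith))
  exact ⟨ψ, 0, hψ⟩
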